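/- **The algebra.** Let $\omega$ be an indeterminate and $m\ge 1$. Let $\hat{\mathcal B}_{2m+1}(\omega)$ be the associative unital algebra generated by $s_a,\epsilon_a$ ($0\le a\le 2m-1$), $f[r]_a$ ($r\in\mathbb Z$, $0\le a\le m$), $\tau$ and $K$ subject to the relations below. It is defined over $\mathbb C[\omega]$, and is considered over $\mathbb C(\omega)$ unless stated otherwise. (1) The Brauer algebra relations with parameter $\omega$ on the nodes $0,1,\dots,2m$: $$s_a^2=1,\quad \epsilon_a^2=\omega\epsilon_a,\quad s_a\epsilon_a=\epsilon_as_a=\epsilon_a,$$ $$s_as_b=s_bs_a,\quad \epsilon_a\epsilon_b=\epsilon_b\epsilon_a,\quad s_a\epsilon_b=\epsilon_bs_a\qquad(|a-b|>1),$$ $$s_as_{a+1}s_a=s_{a+1}s_as_{a+1},\quad \epsilon_a\epsilon_{a+1}\epsilon_a=\epsilon_a,\quad \epsilon_{a+1}\epsilon_a\epsilon_{a+1}=\epsilon_{a+1},$$ $$s_a\epsilon_{a+1}\epsilon_a=s_{a+1}\epsilon_a,\quad \epsilon_{a+1}\epsilon_as_{a+1}=\epsilon_{a+1}s_a.$$ (2)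 $K$ is central, $\tau$ commutes with all $s_a,\epsilon_a$, and $f[r]_a\tau-\tau f[r]_a=r f[r-1]_a$. (3) For $a<b$ set $s_{ab}=s_{ba}=s_a\cdots s_{b-2}\,s_{b-1}\,s_{b-2}\cdots s_a$ and $\epsilon_{ab}=\epsilon_{ba}=s_a\cdots s_{b-2}\,\epsilon_{b-1}\,s_{b-2}\cdots s_a$. Then, for distinct indices and whenever the elements $f[\cdot]$ involved are among the generators, $$f[r]_af[t]_b-f[t]_bf[r]_a=(s_{ab}-\epsilon_{ab})f[r+t]_b-f[r+t]_b(s_{ab}-\epsilon_{ab})+r\delta_{r,-t}(s_{ab}-\epsilon_{ab})K,$$ $$s_{ab}f[r]_a=f[r]_bs_{ab},\quad \epsilon_{ab}(f[r]_a+f[r]_b)=(f[r]_a+f[r]_b)\epsilon_{ab}=0,\quad \epsilon_{ab}f[r]_a\epsilon_{ab}=0,$$ $$s_{ab}f[r]_c=f[r]_cs_{ab},\quad \epsilon_{ab}f[r]_c=f[r]_c\epsilon_{ab}\qquad(c\ne a,b).$$ **Notation.** For $1\le k\le m$ put $q^{(k)}=\epsilon_{1\,m+1}\cdots\epsilon_{k\,m+k}$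 and $\gamma_k(\omega)=\dfrac{\omega+k-2}{\omega+2k-2}$. Let $h^{(k)}=\frac1{k!}\sum_{\sigma\in\mathfrak S_k}\sigma$, where $\mathfrak S_k$ is generated by $s_1,\dots,s_{k-1}$. Let $s^{(k)}$ be the Brauer symmetriser, that is, the unique nonzero idempotent of the subalgebra $\langle s_a,\epsilon_a\mid 1\le a\le k-1\rangle$ over $\mathbb C(\omega)$ with $s_as^{(k)}=s^{(k)}s_a=s^{(k)}$ and $\epsilon_as^{(k)}=s^{(k)}\epsilon_a=0$ for $1\le a\le k-1$. Put $f_a=\tau+f[-1]_a$. For a partition $\lambda=(\lambda_1\ge\dots\ge\lambda_\ell>0)$ of $m$ of length $\ell=\ell(\lambda)$ put $f[-\lambda]=f[-\lambda_1]_1\cdots f[-\lambda_\ell]_\ell$, and let $c_\lambda$ be the number of permutations in $\mathfrak S_m$ of cycle type $\lambda$. Put $$\mathcal Y_{m,\ell}(T)=\frac{\ell!}{m!}\prod_{k=\ell}^{m-1}(T+k).$$ Every element of $\hat{\mathcal B}_{2m+1}(\omega)$ can be written as a polynomial in $\tau$ with the powers of $\tau$ on the right and with coefficients in the subalgebra generated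 by all the other generators. Let $$\phi_m=\gamma_m(\omega)\,q^{(m)}s^{(m)}f_1\cdots f_m\,q^{(m)}\cdot 1\qquad(\tau\cdot 1=0)$$ denote the constant term of $\gamma_m(\omega)\,q^{(m)}s^{(m)}f_1\cdots f_m\,q^{(m)}$. **Proposition.** (i) The constant term $\phi_m$ is well defined (unique), and $$\phi_m=\sum_{\lambda\vdash m,\ \ell(\lambda)\text{ even}}\mathcal Y_{m,\ell}(\omega-1)\,c_\lambda\,q^{(\ell)}h^{(\ell)}f[-\lambda]\,q^{(m)}.$$ (ii) In particular $\phi_m$ is defined over $\mathbb C[\omega]$: it is the image, under the canonical map from the algebra over $\mathbb C[\omega]$ to the algebra over $\mathbb C(\omega)$, of the element given by the same sum over $\mathbb C[\omega]$. (iii) For every partition $\lambda\vdash m$ of length $\ell$ (even or odd), $$\gamma_\ell(\omega)\,q^{(\ell)}s^{(\ell)}f[-\lambda]\,q^{(m)}=q^{(\ell)}h^{(\ell)}f[-\lambda]\,q^{(m)}.$$ -/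

import Mathlib

namespace ExtBrauer

open Polynomial

/-- Generators of the extended Brauer-type algebra on the `2m+1` nodes `0, 1, …, 2m`:
`s a`, `e a` are the Brauer generators attached to the neighbouring nodes `a, a+1`
(`0 ≤ a < 2m`), `f r a` stands for `f[r]_a` with `r ∈ ℤ` and `0 ≤ a ≤ m`. -/
inductive Gen (m : ℕ) : Type
  | s (a : Fin (2 * m)) : Gen m
  | e (a : Fin (2 * m)) : Gen m
  | f (r : ℤ) (a : Fin (m + 1)) : Gen m
  | tau : Gen m
  | K : Gen m

/-- The word `S_a S_{a+1} ⋯ S_{b-2} · T_{b-1} · S_{b-2} ⋯ S_{a+1} S_a` (for `a < b`), evaluated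
in any monoid. -/
def conjWord {A : Type*} [Monoid A] (S T : ℕ → A) (a b : ℕ) : A :=
  ((List.range' a (b - 1 - a)).map S).prod * T (b - 1) *
    ((List.range' a (b - 1 - a)).reverse.map S).prod

section Free

variable (R : Type*) [CommRing R] (m : ℕ)

/-- The generator `s_a` in the free algebra (`0` if the label is out of range). -/
def sFree (a : ℕ) : FreeAlgebra R (Gen m) :=
  if h : a < 2 * m then FreeAlgebra.ι R (Gen.s ⟨a, h⟩) else 0

/-- The generator `ε_a` in the free algebra (`0` if the label is out of range). -/
def eFree (a : ℕ) : FreeAlgebra R (Gen m) :=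
  if h : a < 2 * m then FreeAlgebra.ι R (Gen.e ⟨a, h⟩) else 0

/-- The generator `f[r]_a` in the free algebra (`0` if the label is out of range). -/
def fFree (r : ℤ) (a : ℕ) : FreeAlgebra R (Gen m) :=
  if h : a < m + 1 then FreeAlgebra.ι R (Gen.f r ⟨a, h⟩) else 0

/-- The generator `τ` in the free algebra. -/
def tauFree : FreeAlgebra R (Gen m) := FreeAlgebra.ι R Gen.tau

/-- The generator `K` in the free algebra. -/
def KFree : FreeAlgebra R (Gen m) := FreeAlgebra.ι R Gen.K

/-- The word for the transposition `s_{ab} = s_{ba}`. -/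
def ssFree (a b : ℕ) : FreeAlgebra R (Gen m) :=
  conjWord (sFree R m) (sFree R m) (min a b) (max a b)

/-- The word for `ε_{ab} = ε_{ba}`. -/
def eeFree (a b : ℕ) : FreeAlgebra R (Gen m) :=
  conjWord (sFree R m) (eFree R m) (min a b) (max a b)

variable {R}

/-- The defining relations of the extended Brauer-type algebra with parameter `ω`. The first group
presents the Brauer algebra on the nodes `0, …, 2m`. -/
inductive Rel (ω : R) : FreeAlgebra R (Gen m) → FreeAlgebra R (Gen m) → Prop
  | s_sq (a : ℕ) (ha : a < 2 * m) : Rel ω (sFree R m a * sFree R m a) 1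
  | e_sq (a : ℕ) (ha : a < 2 * m) : Rel ω (eFree R m a * eFree R m a) (ω • eFree R m a)
  | s_e (a : ℕ) (ha : a < 2 * m) : Rel ω (sFree R m a * eFree R m a) (eFree R m a)
  | e_s (a : ℕ) (ha : a < 2 * m) : Rel ω (eFree R m a * sFree R m a) (eFree R m a)
  | s_comm (a b : ℕ) (ha : a < 2 * m) (hb : b < 2 * m) (hab : a + 1 < b ∨ b + 1 < a) :
      Rel ω (sFree R m a * sFree R m b) (sFree R m b * sFree R m a)
  | e_comm (a b : ℕ) (ha : a < 2 * m) (hb : b < 2 * m) (hab : a + 1 < b ∨ b + 1 < a) :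
      Rel ω (eFree R m a * eFree R m b) (eFree R m b * eFree R m a)
  | s_e_comm (a b : ℕ) (ha : a < 2 * m) (hb : b < 2 * m) (hab : a + 1 < b ∨ b + 1 < a) :
      Rel ω (sFree R m a * eFree R m b) (eFree R m b * sFree R m a)
  | braid (a : ℕ) (ha : a + 1 < 2 * m) :
      Rel ω (sFree R m a * sFree R m (a + 1) * sFree R m a)
        (sFree R m (a + 1) * sFree R m a * sFree R m (a + 1))
  | e_e_e (a : ℕ) (ha : a + 1 < 2 * m) :
      Rel ω (eFree R m a * eFree R m (a + 1) * eFree R m a) (eFree R m a)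
  | e_e_e' (a : ℕ) (ha : a + 1 < 2 * m) :
      Rel ω (eFree R m (a + 1) * eFree R m a * eFree R m (a + 1)) (eFree R m (a + 1))
  | s_e_e (a : ℕ) (ha : a + 1 < 2 * m) :
      Rel ω (sFree R m a * eFree R m (a + 1) * eFree R m a) (sFree R m (a + 1) * eFree R m a)
  | e_e_s (a : ℕ) (ha : a + 1 < 2 * m) :
      Rel ω (eFree R m (a + 1) * eFree R m a * sFree R m (a + 1))
        (eFree R m (a + 1) * sFree R m a)
  | K_central (g : Gen m) :
      Rel ω (KFree R m * FreeAlgebra.ι R g) (FreeAlgebra.ι R g * KFree R m)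
  | tau_s (a : ℕ) (ha : a < 2 * m) :
      Rel ω (tauFree R m * sFree R m a) (sFree R m a * tauFree R m)
  | tau_e (a : ℕ) (ha : a < 2 * m) :
      Rel ω (tauFree R m * eFree R m a) (eFree R m a * tauFree R m)
  | f_comm (r t : ℤ) (a b : ℕ) (ha : a ≤ m) (hb : b ≤ m) (hab : a ≠ b) :
      Rel ω (fFree R m r a * fFree R m t b - fFree R m t b * fFree R m r a)
        ((ssFree R m a b - eeFree R m a b) * fFree R m (r + t) b
          - fFree R m (r + t) b * (ssFree R m a b - eeFree R m a b)
          + (if r = -t then (r : R) else 0) • ((ssFree R m a b - eeFree R m a b) * KFree R m))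
  | s_f (r : ℤ) (a b : ℕ) (ha : a ≤ m) (hb : b ≤ m) (hab : a ≠ b) :
      Rel ω (ssFree R m a b * fFree R m r a) (fFree R m r b * ssFree R m a b)
  | e_f (r : ℤ) (a b : ℕ) (ha : a ≤ m) (hb : b ≤ m) (hab : a ≠ b) :
      Rel ω (eeFree R m a b * (fFree R m r a + fFree R m r b)) 0
  | f_e (r : ℤ) (a b : ℕ) (ha : a ≤ m) (hb : b ≤ m) (hab : a ≠ b) :
      Rel ω ((fFree R m r a + fFree R m r b) * eeFree R m a b) 0
  | s_f_comm (r : ℤ) (a b c : ℕ) (ha : a ≤ 2 * m) (hb : b ≤ 2 * m) (hab : a ≠ b)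
      (hc : c ≤ m) (hca : c ≠ a) (hcb : c ≠ b) :
      Rel ω (ssFree R m a b * fFree R m r c) (fFree R m r c * ssFree R m a b)
  | e_f_comm (r : ℤ) (a b c : ℕ) (ha : a ≤ 2 * m) (hb : b ≤ 2 * m) (hab : a ≠ b)
      (hc : c ≤ m) (hca : c ≠ a) (hcb : c ≠ b) :
      Rel ω (eeFree R m a b * fFree R m r c) (fFree R m r c * eeFree R m a b)
  | e_f_e (r : ℤ) (a b : ℕ) (ha : a ≤ m) (hb : b ≤ 2 * m) (hab : a ≠ b) :
      Rel ω (eeFree R m a b * fFree R m r a * eeFree R m a b) 0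
  | f_tau (r : ℤ) (a : ℕ) (ha : a ≤ m) :
      Rel ω (fFree R m r a * tauFree R m - tauFree R m * fFree R m r a)
        ((r : R) • fFree R m (r - 1) a)

end Free

/-- The extended Brauer-type algebra on `2m+1` nodes with parameter `ω`, over the ring `R`. -/
abbrev Bhat (R : Type*) [CommRing R] (ω : R) (m : ℕ) : Type _ := RingQuot (Rel m ω)

section Elements

variable {R : Type*} [CommRing R] (ω : R) (m : ℕ)

/-- The canonical projection from the free algebra. -/
def proj : FreeAlgebra R (Gen m) →ₐ[R] Bhat R ω m := RingQuot.mkAlgHom R (Rel m ω)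

/-- The element `s_a = s_{a,a+1}`. -/
def s (a : ℕ) : Bhat R ω m := proj ω m (sFree R m a)

/-- The element `ε_a = ε_{a,a+1}`. -/
def e (a : ℕ) : Bhat R ω m := proj ω m (eFree R m a)

/-- The element `ε_{ab}`. -/
def ee (a b : ℕ) : Bhat R ω m := proj ω m (eeFree R m a b)

/-- The element `f[r]_a`. -/
def fr (r : ℤ) (a : ℕ) : Bhat R ω m := proj ω m (fFree R m r a)

/-- The element `τ`. -/
def tau : Bhat R ω m := proj ω m (tauFree R m)

/-- The element `K`. -/
def K : Bhat R ω m := proj ω m (KFree R m)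

/-- The element `f_a = τ + f[-1]_a`. -/
def f (a : ℕ) : Bhat R ω m := tau ω m + fr ω m (-1) a

/-- `q^{(k)} = ε_{1,m+1} ⋯ ε_{k,m+k}`. -/
def q (k : ℕ) : Bhat R ω m := ((List.range' 1 k).map fun i => ee ω m i (m + i)).prod

/-- The parts `λ_1 ≥ λ_2 ≥ ⋯ ≥ λ_ℓ > 0` of a partition in weakly decreasing order. -/
def sortedParts {n : ℕ} (l : n.Partition) : List ℕ := l.parts.sort (fun a b => b ≤ a)

/-- The length `ℓ(λ)` of a partition. -/
def len {n : ℕ} (l : n.Partition) : ℕ := l.parts.card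

/-- `f[-λ] = f[-λ_1]_1 ⋯ f[-λ_ℓ]_ℓ`. -/
def fPart (l : m.Partition) : Bhat R ω m :=
  ((sortedParts l).mapIdx fun i p => fr ω m (-(p : ℤ)) (i + 1)).prod

end Elements

section Symmetrisers

/-- The adjacent transposition `(i, i+1)` of `{0, …, k-1}`. -/
def adjSwap (k i : ℕ) : Equiv.Perm (Fin k) :=
  if h : i + 1 < k then Equiv.swap ⟨i, Nat.lt_of_succ_lt h⟩ ⟨i + 1, h⟩ else 1

theorem exists_word {k : ℕ} (σ : Equiv.Perm (Fin k)) :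
    ∃ l : List ℕ, (∀ i ∈ l, i + 1 < k) ∧ (l.map (adjSwap k)).prod = σ := by
  cases k with
  | zero => exact ⟨[], by simp, Subsingleton.elim _ _⟩
  | succ n =>
    have h : σ ∈ Submonoid.closure
        (Set.range fun i : Fin n => Equiv.swap i.castSucc i.succ) := by
      rw [Equiv.Perm.mclosure_swap_castSucc_succ]; trivial
    induction h using Submonoid.closure_induction with
    | mem x hx =>
      obtain ⟨i, rfl⟩ := hx
      refine ⟨[(i : ℕ)], by simp, ?_⟩
      have hi : (i : ℕ) + 1 < n + 1 := by omega
      simp only [List.map_cons, List.map_nil, List.prod_cons, List.prod_nil, mul_one, adjSwap, hi,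
        dif_pos]
      rfl
    | one => exact ⟨[], by simp, rfl⟩
    | mul x y _ _ hx hy =>
      obtain ⟨l, hl, rfl⟩ := hx
      obtain ⟨l', hl', rfl⟩ := hy
      refine ⟨l ++ l', ?_, by simp⟩
      intro i hi
      rcases List.mem_append.1 hi with h | h
      · exact hl i h
      · exact hl' i h

/-- Some expression of a permutation as a product of adjacent transpositions. -/
noncomputable def word {k : ℕ} (σ : Equiv.Perm (Fin k)) : List ℕ :=
  Classical.choose (exists_word σ)

variable {R : Type*} [CommRing R] (ω : R) (m : ℕ)

/-- The image of a permutation of the nodes `1, …, k` (identified with `0, …, k-1` in `Fin k`):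
an expression through adjacent transpositions is evaluated at the generators `s_1, …, s_{k-1}`.
By the relations among the `s_a` the result does not depend on the expression. -/
noncomputable def permElt {k : ℕ} (σ : Equiv.Perm (Fin k)) : Bhat R ω m :=
  ((word σ).map fun i => s ω m (i + 1)).prod

/-- The symmetriser `h^{(k)} = (1/k!) ∑_{σ ∈ S_k} σ` of the symmetric group on the nodes
`1, …, k`. -/
noncomputable def h [Algebra ℂ R] (k : ℕ) : Bhat R ω m :=
  algebraMap ℂ R ((k.factorial : ℂ)⁻¹) • ∑ σ : Equiv.Perm (Fin k), permElt ω m σ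

/-- The Brauer algebra on the nodes `1, …, k`, as the subalgebra generated by
`s_a, ε_a` with `1 ≤ a ≤ k-1`. -/
def brauerSub (k : ℕ) : Subalgebra R (Bhat R ω m) :=
  Algebra.adjoin R ({x | ∃ a, 1 ≤ a ∧ a + 1 ≤ k ∧ x = s ω m a} ∪
    {x | ∃ a, 1 ≤ a ∧ a + 1 ≤ k ∧ x = e ω m a})

/-- The characterising properties of the Brauer symmetriser `s^{(k)}`. -/
def IsBrauerSymmetriser (k : ℕ) (x : Bhat R ω m) : Prop :=
  x ∈ brauerSub ω m k ∧ x ≠ 0 ∧ x * x = x ∧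
    ∀ a, 1 ≤ a → a + 1 ≤ k →
      s ω m a * x = x ∧ x * s ω m a = x ∧ e ω m a * x = 0 ∧ x * e ω m a = 0

/-- The Brauer symmetriser `s^{(k)}`: the element with these properties (it exists and is unique
over the field of rational functions in `ω`). -/
noncomputable def brauerSym (k : ℕ) : Bhat R ω m :=
  Classical.epsilon (IsBrauerSymmetriser ω m k)

end Symmetrisers

section ConstantTerm

variable {R : Type*} [CommRing R] (ω : R) (m : ℕ)

/-- The subalgebra generated by all generators except `τ`. -/
def coeffSub : Subalgebra R (Bhat R ω m) :=
  Algebra.adjoin R ({x | ∃ a, a < 2 * m ∧ x = s ω m a} ∪ {x | ∃ a, a < 2 * m ∧ x = e ω m a} ∪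
    {x | ∃ r : ℤ, ∃ a, a ≤ m ∧ x = fr ω m r a} ∪ {K ω m})

/-- `y` is the constant term of `x`, written as a polynomial in `τ` with the powers of `τ` on the
right and with coefficients not involving `τ`; that is, `y` is `x · 1` where `τ · 1 = 0`. -/
def IsConstantTerm (x y : Bhat R ω m) : Prop :=
  ∃ (n : ℕ) (c : ℕ → Bhat R ω m), (∀ k, c k ∈ coeffSub ω m) ∧
    x = ∑ k ∈ Finset.range (n + 1), c k * tau ω m ^ k ∧ y = c 0

end ConstantTerm

section IntegralForm

/-- `𝒴_{m,ℓ}(T) = (ℓ!/m!) ∏_{k=ℓ}^{m-1} (T + k)`. -/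
noncomputable def Y (m l : ℕ) : ℂ[X] :=
  C ((l.factorial : ℂ) / (m.factorial : ℂ)) * ∏ k ∈ Finset.Ico l m, (X + C (k : ℂ))

/-- `c_λ`, the number of permutations in `S_m` of cycle type `λ` (fixed points count as
parts `1`). -/
noncomputable def cycleCount {m : ℕ} (l : m.Partition) : ℕ :=
  Nat.card {σ : Equiv.Perm (Fin m) // σ.partition.parts = l.parts}

/-- `∑_{λ ⊢ m, ℓ(λ) even} 𝒴_{m,ℓ}(ω-1) c_λ q^{(ℓ)} h^{(ℓ)} f[-λ] q^{(m)}`. -/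
noncomputable def integralForm {R : Type*} [CommRing R] [Algebra ℂ R] (ω : R) (m : ℕ) :
    Bhat R ω m :=
  ∑ l : m.Partition with Even (len l),
    (aeval (ω - 1) (Y m (len l)) * (cycleCount l : R)) •
      (q ω m (len l) * h ω m (len l) * fPart ω m l * q ω m m)

/-- `γ_k(ω) = (ω + k - 2) / (ω + 2k - 2)` in `ℂ(ω)`. -/
noncomputable def gam (k : ℕ) : RatFunc ℂ :=
  (RatFunc.X + (k : RatFunc ℂ) - 2) / (RatFunc.X + 2 * (k : RatFunc ℂ) - 2)

end IntegralForm

section BaseChange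

variable {R S : Type*} [CommRing R] [CommRing S] [Algebra R S] (ω : R) (ω' : S) (m : ℕ)

/-- The map of free algebras that extends scalars and fixes the generators. -/
def freeBaseChange : FreeAlgebra R (Gen m) →ₐ[R] FreeAlgebra S (Gen m) :=
  FreeAlgebra.lift R fun g => FreeAlgebra.ι S g

theorem freeBaseChange_sFree (a : ℕ) :
    freeBaseChange (S := S) m (sFree R m a) = sFree S m a := by
  unfold sFree freeBaseChange; split_ifs <;> simp

theorem freeBaseChange_eFree (a : ℕ) :
    freeBaseChange (S := S) m (eFree R m a) = eFree S m a := by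
  unfold eFree freeBaseChange; split_ifs <;> simp

theorem freeBaseChange_fFree (r : ℤ) (a : ℕ) :
    freeBaseChange (S := S) m (fFree R m r a) = fFree S m r a := by
  unfold fFree freeBaseChange; split_ifs <;> simp

theorem freeBaseChange_ι (g : Gen m) :
    freeBaseChange (R := R) (S := S) m (FreeAlgebra.ι R g) = FreeAlgebra.ι S g := by
  simp [freeBaseChange]

theorem freeBaseChange_tauFree :
    freeBaseChange (R := R) (S := S) m (tauFree R m) = tauFree S m := freeBaseChange_ι m _

theorem freeBaseChange_KFree :
    freeBaseChange (R := R) (S := S) m (KFree R m) = KFree S m := freeBaseChange_ι m _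

theorem freeBaseChange_ssFree (a b : ℕ) :
    freeBaseChange (S := S) m (ssFree R m a b) = ssFree S m a b := by
  simp [ssFree, conjWord, map_list_prod, Function.comp_def, freeBaseChange_sFree]

theorem freeBaseChange_eeFree (a b : ℕ) :
    freeBaseChange (S := S) m (eeFree R m a b) = eeFree S m a b := by
  simp [eeFree, conjWord, map_list_prod, Function.comp_def, freeBaseChange_sFree,
    freeBaseChange_eFree]

theorem freeBaseChange_rel (hω : algebraMap R S ω = ω') {x y : FreeAlgebra R (Gen m)}
    (hxy : Rel m ω x y) :
    proj ω' m (freeBaseChange m x) = proj ω' m (freeBaseChange m y) := by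
  have key : ∀ {x y : FreeAlgebra S (Gen m)}, Rel m ω' x y → proj ω' m x = proj ω' m y :=
    fun hr => RingQuot.mkAlgHom_rel S hr
  have hs : ∀ (r : R) (x : FreeAlgebra S (Gen m)), r • x = algebraMap R S r • x :=
    fun r x => by rw [algebraMap_smul]
  cases hxy <;>
    simp only [map_mul, map_add, map_sub, map_smul, map_one, map_zero, hs, hω,
      freeBaseChange_sFree, freeBaseChange_eFree, freeBaseChange_fFree, freeBaseChange_tauFree,
      freeBaseChange_KFree, freeBaseChange_ssFree, freeBaseChange_eeFree, freeBaseChange_ι,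
      map_intCast, apply_ite (algebraMap R S)] <;>
    simp only [← map_mul, ← map_add, ← map_sub, ← map_smul]
  case s_sq a ha => simpa using key (Rel.s_sq a ha)
  case e_sq a ha => exact key (Rel.e_sq a ha)
  case s_e a ha => exact key (Rel.s_e a ha)
  case e_s a ha => exact key (Rel.e_s a ha)
  case s_comm a b ha hb hab => exact key (Rel.s_comm a b ha hb hab)
  case e_comm a b ha hb hab => exact key (Rel.e_comm a b ha hb hab)
  case s_e_comm a b ha hb hab => exact key (Rel.s_e_comm a b ha hb hab)
  case braid a ha => exact key (Rel.braid a ha)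
  case e_e_e a ha => exact key (Rel.e_e_e a ha)
  case e_e_e' a ha => exact key (Rel.e_e_e' a ha)
  case s_e_e a ha => exact key (Rel.s_e_e a ha)
  case e_e_s a ha => exact key (Rel.e_e_s a ha)
  case K_central g => exact key (Rel.K_central g)
  case tau_s a ha => exact key (Rel.tau_s a ha)
  case tau_e a ha => exact key (Rel.tau_e a ha)
  case f_comm r t a b ha hb hab => exact key (Rel.f_comm r t a b ha hb hab)
  case s_f r a b ha hb hab => exact key (Rel.s_f r a b ha hb hab)
  case e_f r a b ha hb hab => simpa using key (Rel.e_f r a b ha hb hab)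
  case f_e r a b ha hb hab => simpa using key (Rel.f_e r a b ha hb hab)
  case s_f_comm r a b c ha hb hab hc hca hcb =>
    exact key (Rel.s_f_comm r a b c ha hb hab hc hca hcb)
  case e_f_comm r a b c ha hb hab hc hca hcb =>
    exact key (Rel.e_f_comm r a b c ha hb hab hc hca hcb)
  case e_f_e r a b ha hb hab => simpa using key (Rel.e_f_e r a b ha hb hab)
  case f_tau r a ha => exact key (Rel.f_tau r a ha)

/-- The canonical map of extended Brauer-type algebras induced by an extension of scalars `R → S`
that takes the parameter `ω` to `ω'`; it takes each generator to the generator of the same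
name. -/
def baseChange (hω : algebraMap R S ω = ω') : Bhat R ω m →ₐ[R] Bhat S ω' m :=
  RingQuot.liftAlgHom R
    ⟨((proj ω' m).restrictScalars R).comp (freeBaseChange m), fun _ _ hxy =>
      freeBaseChange_rel ω ω' m hω hxy⟩

end BaseChange

end ExtBrauer

/-! The contractions at the two ends close up every word in the `f[r]_a`. A simultaneous permutation
of the strands and of their partners is absorbed on both sides, and since `(f[r]_a + f[r]_b) ε_{ab}
= 0`, a closed word changes sign when a strand that carries a letter is exchanged with its partner.
To use this freely, `ε_{ab}` and `f[r]_a` are extended to all pairs of nodes and all nodes by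
conjugation with permutations (`bhatRep`), which rests on the Coxeter presentation of the symmetric
group.

Expansion. Moving every `τ` in `f_1 ⋯ f_m` to the right, a new factor `τ + f[-1]_a` either prepends
a letter of size `1` or raises a letter of size `p` to `p + 1`, with multiplicity `p`. This is how a
new point enters a permutation: as a fixed point, or in one of `p` places of a cycle of length `p`.
Closed by `q^{(m)} s^{(m)}` and `q^{(m)}`, a word depends only on the multiset of its sizes, because
the commutator of two letters is antisymmetric in the two nodes. So `f[-λ]` occurs with coefficient
`c_λ` (`q_mul_brSym_mul_sum_expand`).

Reduction. The symmetriser has an explicit form `s = ∑_j c_j E_j h`, where `E_j` is the sum over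
matchings with `j` pairs (`brSym`). A strand without a letter is removed by the partial trace of `s`
(`eps_mul_brSym_insert_mul_eps`); passing from `m` to `ℓ` strands this way produces the product in
`𝒴_{m,ℓ}`.

Comparison of `s` and `h`. On `ℓ` strands that all carry letters, the sign rule gives `Q E_{j+1} h V
= -(ℓ - 2j) Q E_j h V` (`IsPairing.matchSum_succ`), where `Q` is the contraction on the left and `V`
the closed word. Summed with the coefficients `c_j` this telescopes to `γ_ℓ Q s V = Q h V`, which is
(iii). For odd `ℓ` the factor never vanishes while `E_j` does for large `j`, so `Q h V = 0` and only
even lengths remain.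

The constant term exists because commutation with `τ` preserves the coefficient subalgebra. It is
unique because the homomorphism `τ ↦ τ + X`, followed by evaluation at `X = -τ`, recovers it from
the element alone (`IsConstantTerm.eq_eval`); no basis of the algebra is needed. -/

namespace ExtBrauer

/-! ### The Coxeter presentation of the symmetric group -/

section Words

/-- The relations of the symmetric group on `n` letters, among elements `t 0, …, t (n-2)`. -/
structure BraidRels {M : Type*} [Monoid M] (n : ℕ) (t : ℕ → M) : Prop where
  sq : ∀ i, i + 1 < n → t i * t i = 1
  comm : ∀ i j, i + 1 < j → j + 1 < n → t i * t j = t j * t i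
  braid : ∀ i, i + 2 < n → t i * t (i + 1) * t i = t (i + 1) * t i * t (i + 1)

/-- The product `t (p-1) ⋯ t 1 * t 0`. -/
def descProd {M : Type*} [Monoid M] (t : ℕ → M) : ℕ → M
  | 0 => 1
  | p + 1 => t p * descProd t p

variable {M : Type*} [Monoid M]

theorem BraidRels.succ {n : ℕ} {t : ℕ → M} (h : BraidRels (n + 1) t) :
    BraidRels n (fun i => t (i + 1)) where
  sq i hi := h.sq _ (by omega)
  comm i j hij hj := h.comm _ _ (by omega) (by omega)
  braid i hi := h.braid _ (by omega)

theorem BraidRels.mul_descProd_of_lt {n : ℕ} {t : ℕ → M} (h : BraidRels n t) {i p : ℕ}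
    (hp : p < i) (hi : i + 1 < n) : t i * descProd t p = descProd t p * t i := by
  induction p with
  | zero => simp [descProd]
  | succ p ih =>
    rw [descProd, ← mul_assoc, ← h.comm p i (by omega) hi, mul_assoc, ih (by omega), mul_assoc]

/-- The letter `t i` slides past the larger letters until it meets `t (i+1) * t i`. The braid
relation turns it into a `t (i+1)` behind them, which commutes with the remaining smaller letters.
-/
theorem BraidRels.mul_descProd_of_add_lt {n : ℕ} {t : ℕ → M} (h : BraidRels n t) {i p : ℕ}
    (hip : i + 1 < p) (hp : p < n) : t i * descProd t p = descProd t p * t (i + 1) := by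
  induction p with
  | zero => omega
  | succ p ih =>
    rcases Nat.lt_or_ge (i + 1) p with hlt | hge
    · rw [descProd, ← mul_assoc, h.comm i p hlt (by omega), mul_assoc, ih hlt (by omega), mul_assoc]
    · obtain rfl : p = i + 1 := by omega
      simp only [descProd]
      have := h.mul_descProd_of_lt (i := i + 1) (p := i) (by omega) (by omega)
      simp only [← mul_assoc]
      rw [h.braid i (by omega), mul_assoc _ (descProd t i), ← this, ← mul_assoc]

/-- This is the decomposition into cosets of the stabiliser of the first letter. A new letter on the
left cancels the leading factor of `descProd t p`, extends it, or passes through it and joins the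
word of the stabiliser. -/
theorem BraidRels.exists_normalForm {n : ℕ} {t : ℕ → M} (h : BraidRels (n + 1) t) (l : List ℕ)
    (hl : ∀ i ∈ l, i + 1 < n + 1) :
    ∃ p ≤ n, ∃ l' : List ℕ, (∀ i ∈ l', i + 1 < n) ∧
      (l.map t).prod = descProd t p * (l'.map fun i => t (i + 1)).prod := by
  induction l with
  | nil => exact ⟨0, by omega, [], by simp, by simp [descProd]⟩
  | cons i l ih =>
    obtain ⟨p, hp, l', hl', e⟩ := ih fun j hj => hl j (List.mem_cons_of_mem _ hj)
    have hi := hl i List.mem_cons_self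
    simp only [List.map_cons, List.prod_cons, e]
    rcases lt_trichotomy i p with hip | rfl | hip
    · rcases Nat.lt_or_ge (i + 1) p with hlt | hge
      · refine ⟨p, hp, i :: l', ?_, ?_⟩
        · intro j hj
          rcases List.mem_cons.1 hj with rfl | hj
          · omega
          · exact hl' j hj
        · rw [← mul_assoc, h.mul_descProd_of_add_lt hlt (by omega)]
          simp [mul_assoc]
      · obtain rfl : p = i + 1 := by omega
        refine ⟨i, by omega, l', hl', ?_⟩
        simp only [descProd, ← mul_assoc, h.sq i hi, one_mul]
    · exact ⟨i + 1, by omega, l', hl', by simp [descProd, mul_assoc]⟩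
    · refine ⟨p, hp, (i - 1) :: l', ?_, ?_⟩
      · intro j hj
        rcases List.mem_cons.1 hj with rfl | hj
        · omega
        · exact hl' j hj
      · rw [← mul_assoc, h.mul_descProd_of_lt hip hi]
        have : i - 1 + 1 = i := by omega
        simp [mul_assoc, this]

theorem adjSwap_of_lt {n i : ℕ} (h : i + 1 < n) :
    adjSwap n i = Equiv.swap ⟨i, Nat.lt_of_succ_lt h⟩ ⟨i + 1, h⟩ := dif_pos h

theorem swap_mul_swap_mul_swap' {α : Type*} [DecidableEq α] {a b c : α} (hac : a ≠ c)
    (hbc : b ≠ c) : Equiv.swap a b * Equiv.swap b c * Equiv.swap a b = Equiv.swap a c := by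
  rw [Equiv.mul_swap_eq_swap_mul (Equiv.swap a b), mul_assoc, Equiv.swap_mul_self, mul_one, Equiv.swap_apply_right,
    Equiv.swap_apply_of_ne_of_ne hac.symm hbc.symm]

theorem braidRels_adjSwap (n : ℕ) : BraidRels n (adjSwap n) where
  sq i hi := by rw [adjSwap_of_lt hi]; exact Equiv.swap_mul_self _ _
  comm i j hij hj := by
    rw [adjSwap_of_lt hj, adjSwap_of_lt (show i + 1 < n by omega)]
    refine (Equiv.Perm.disjoint_swap_swap ?_).commute.eq
    simp [Fin.ext_iff]
    omega
  braid i hi := by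
    rw [adjSwap_of_lt hi, adjSwap_of_lt (show i + 1 < n by omega)]
    have h1 : (⟨i, by omega⟩ : Fin n) ≠ ⟨i + 1, by omega⟩ := by simp [Fin.ext_iff]
    have h2 : (⟨i, by omega⟩ : Fin n) ≠ ⟨i + 2, by omega⟩ := by simp [Fin.ext_iff]
    have h3 : (⟨i + 1, by omega⟩ : Fin n) ≠ ⟨i + 2, by omega⟩ := by simp [Fin.ext_iff]
    refine (swap_mul_swap_mul_swap' h2 h3).trans ?_
    have := swap_mul_swap_mul_swap' h2.symm h1.symm
    rw [Equiv.swap_comm _ (⟨i + 1, _⟩ : Fin n), Equiv.swap_comm (⟨i + 1, _⟩ : Fin n) ⟨i, _⟩,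
      Equiv.swap_comm _ (⟨i, _⟩ : Fin n)] at this
    exact this.symm

theorem descProd_adjSwap_zero {n : ℕ} (p : ℕ) (hp : p < n + 1) :
    descProd (adjSwap (n + 1)) p 0 = ⟨p, hp⟩ := by
  induction p with
  | zero => rfl
  | succ p ih =>
    rw [descProd, Equiv.Perm.mul_apply, ih (by omega), adjSwap_of_lt hp, Equiv.swap_apply_left]

theorem prod_adjSwap_succ_zero {n : ℕ} (l : List ℕ) :
    (l.map fun i => adjSwap (n + 1) (i + 1)).prod 0 = 0 := by
  induction l with
  | nil => rfl
  | cons i l ih =>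
    rw [List.map_cons, List.prod_cons, Equiv.Perm.mul_apply, ih, adjSwap]
    split_ifs with h
    · exact Equiv.swap_apply_of_ne_of_ne (by simp [Fin.ext_iff]) (by simp [Fin.ext_iff])
    · rfl

theorem adjSwap_succ_succ {n : ℕ} (i : ℕ) (x : Fin n) :
    adjSwap (n + 1) (i + 1) x.succ = (adjSwap n i x).succ := by
  unfold adjSwap
  by_cases h : i + 1 < n
  · rw [dif_pos h, dif_pos (by omega), Equiv.swap_apply_def, Equiv.swap_apply_def]
    simp only [Fin.ext_iff, Fin.val_succ, Nat.add_right_cancel_iff]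
    split_ifs <;> simp
  · rw [dif_neg h, dif_neg (by omega)]; rfl

theorem prod_adjSwap_succ_succ {n : ℕ} (l : List ℕ) (x : Fin n) :
    (l.map fun i => adjSwap (n + 1) (i + 1)).prod x.succ = ((l.map (adjSwap n)).prod x).succ := by
  induction l with
  | nil => rfl
  | cons i l ih =>
    simp only [List.map_cons, List.prod_cons, Equiv.Perm.mul_apply, ih, adjSwap_succ_succ]

theorem descProd_prod {M' : Type*} [Monoid M'] (t : ℕ → M) (t' : ℕ → M') (p : ℕ) :
    descProd (fun i => (t i, t' i)) p = (descProd t p, descProd t' p) := by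
  induction p with
  | zero => rfl
  | succ p ih => simp [descProd, ih]

theorem prod_map_prodMk {M' : Type*} [Monoid M'] (t : ℕ → M) (t' : ℕ → M') (l : List ℕ) :
    (l.map fun i => (t i, t' i)).prod = ((l.map t).prod, (l.map t').prod) := by
  induction l with
  | nil => rfl
  | cons i l ih => simp [ih]

/-- Words in the adjacent transpositions that give the same permutation take the same value in
every monoid with elements that satisfy the braid relations. -/
theorem BraidRels.prod_eq_of_prod_adjSwap_eq {n : ℕ} : ∀ {t : ℕ → M}, BraidRels n t →
    ∀ {l l' : List ℕ}, (∀ i ∈ l, i + 1 < n) → (∀ i ∈ l', i + 1 < n) →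
      (l.map (adjSwap n)).prod = (l'.map (adjSwap n)).prod → (l.map t).prod = (l'.map t).prod := by
  induction n with
  | zero =>
    intro t _ l l' hl hl' _
    have : ∀ l : List ℕ, (∀ i ∈ l, i + 1 < 0) → l = [] := fun l hl =>
      List.eq_nil_iff_forall_not_mem.2 fun i hi => by simpa using hl i hi
    rw [this l hl, this l' hl']
  | succ n ih =>
    intro t h l l' hl hl' e
    -- The normal form is taken in the product monoid, so that one `p` and one remaining word serve
    -- both for `t` and for the permutations. There `p` is the image of `0`, hence determined.
    have hp : BraidRels (n + 1) (fun i => (t i, adjSwap (n + 1) i)) :=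
      { sq := fun i hi => Prod.ext (h.sq i hi) ((braidRels_adjSwap _).sq i hi)
        comm := fun i j hij hj => Prod.ext (h.comm i j hij hj) ((braidRels_adjSwap _).comm i j hij hj)
        braid := fun i hi => Prod.ext (h.braid i hi) ((braidRels_adjSwap _).braid i hi) }
    obtain ⟨p, hpn, k, hk, ek⟩ := hp.exists_normalForm l hl
    obtain ⟨p', hpn', k', hk', ek'⟩ := hp.exists_normalForm l' hl'
    rw [prod_map_prodMk, descProd_prod, prod_map_prodMk] at ek ek'
    have e1 := congrArg Prod.fst ek
    have e1' := congrArg Prod.fst ek'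
    have e2 := congrArg Prod.snd ek
    have e2' := congrArg Prod.snd ek'
    simp only [Prod.fst_mul, Prod.snd_mul] at e1 e1' e2 e2'
    rw [e2, e2'] at e
    have h0 := congrArg (fun g : Equiv.Perm (Fin (n + 1)) => g 0) e
    simp only [Equiv.Perm.mul_apply, prod_adjSwap_succ_zero] at h0
    rw [descProd_adjSwap_zero p (by omega), descProd_adjSwap_zero p' (by omega)] at h0
    obtain rfl : p = p' := by simpa [Fin.ext_iff] using h0
    have e3 := mul_left_cancel e
    have e4 : (k.map (adjSwap n)).prod = (k'.map (adjSwap n)).prod := by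
      ext x : 1
      have := congrArg (fun g : Equiv.Perm (Fin (n + 1)) => g x.succ) e3
      simp only [prod_adjSwap_succ_succ] at this
      exact Fin.succ_injective _ this
    rw [e1, e1', ih h.succ hk hk' e4]

theorem word_lt {k : ℕ} (σ : Equiv.Perm (Fin k)) : ∀ i ∈ word σ, i + 1 < k :=
  (Classical.choose_spec (exists_word σ)).1

theorem prod_word {k : ℕ} (σ : Equiv.Perm (Fin k)) : ((word σ).map (adjSwap k)).prod = σ :=
  (Classical.choose_spec (exists_word σ)).2

/-- The representation of the symmetric group given by elements that satisfy the braid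
relations. -/
noncomputable def BraidRels.hom {n : ℕ} {t : ℕ → M} (h : BraidRels n t) :
    Equiv.Perm (Fin n) →* M where
  toFun σ := ((word σ).map t).prod
  map_one' := by
    exact h.prod_eq_of_prod_adjSwap_eq (l' := []) (word_lt _) (by simp) (by simp [prod_word])
  map_mul' σ τ := by
    rw [← List.prod_append, ← List.map_append]
    refine h.prod_eq_of_prod_adjSwap_eq (word_lt _) ?_ (by simp [prod_word])
    intro i hi
    rcases List.mem_append.1 hi with hi | hi
    · exact word_lt _ i hi
    · exact word_lt _ i hi

theorem BraidRels.hom_adjSwap {n : ℕ} {t : ℕ → M} (h : BraidRels n t) {i : ℕ} (hi : i + 1 < n) :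
    h.hom (adjSwap n i) = t i := by
  have := h.prod_eq_of_prod_adjSwap_eq (l := word (adjSwap n i)) (l' := [i]) (word_lt _)
    (by simpa using hi) (by simp [prod_word])
  rw [List.map_singleton, List.prod_singleton] at this
  exact this

/-- A permutation that fixes the first `j` letters is a product of the later adjacent
transpositions. -/
theorem exists_word_of_fixes {n : ℕ} (j : ℕ) (σ : Equiv.Perm (Fin n))
    (hσ : ∀ x : Fin n, (x : ℕ) < j → σ x = x) :
    ∃ l : List ℕ, (∀ i ∈ l, j ≤ i ∧ i + 1 < n) ∧ (l.map (adjSwap n)).prod = σ := by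
  induction j generalizing n with
  | zero =>
    obtain ⟨l, hl, e⟩ := exists_word σ
    exact ⟨l, fun i hi => ⟨by omega, hl i hi⟩, e⟩
  | succ j ih =>
    cases n with
    | zero => exact ⟨[], by simp, Subsingleton.elim _ _⟩
    | succ n =>
      have h0 : σ 0 = 0 := hσ 0 (by simp)
      set σ' := (Equiv.Perm.decomposeFin σ).2 with hσ'
      have hd : σ = Equiv.Perm.decomposeFin.symm (0, σ') := by
        rw [Equiv.eq_symm_apply]
        refine Prod.ext ?_ rfl
        have := Equiv.Perm.decomposeFin_symm_apply_zero (Equiv.Perm.decomposeFin σ).1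
          (Equiv.Perm.decomposeFin σ).2
        rw [Prod.mk.eta, Equiv.symm_apply_apply, h0] at this
        exact this.symm
      have hs : ∀ x : Fin n, σ x.succ = (σ' x).succ := fun x => by
        rw [hd, Equiv.Perm.decomposeFin_symm_apply_succ, Equiv.swap_self, Equiv.refl_apply]
      obtain ⟨l, hl, e⟩ := ih σ' fun x hx => by
        have := hσ x.succ (by simpa using hx)
        rw [hs] at this
        exact Fin.succ_injective _ this
      refine ⟨l.map (· + 1), ?_, ?_⟩
      · intro i hi
        obtain ⟨i', hi', rfl⟩ := List.mem_map.1 hi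
        have := hl i' hi'
        omega
      · ext x : 1
        rw [List.map_map]
        refine Fin.cases ?_ (fun x => ?_) x
        · rw [h0]; exact prod_adjSwap_succ_zero l
        · rw [hs, ← e]; exact prod_adjSwap_succ_succ l x

end Words

/-! ### Brauer algebra and currents indexed by arbitrary nodes -/

/-- A representation of the Brauer algebra with parameter `ω` on a set `N` of nodes, in the form of
permutations of the nodes and elements `eps a b` for pairs of nodes (`0` if `a = b`). -/
structure BrauerRep (R : Type*) [CommRing R] (N : Type*) [DecidableEq N] (A : Type*) [Ring A]
    [Algebra R A] (ω : R) where
  rho : Equiv.Perm N →* A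
  eps : N → N → A
  eps_self : ∀ a, eps a a = 0
  eps_symm : ∀ a b, eps a b = eps b a
  conj : ∀ g a b, rho g * eps a b = eps (g a) (g b) * rho g
  swap_mul : ∀ a b, rho (Equiv.swap a b) * eps a b = eps a b
  mul_swap : ∀ a b, eps a b * rho (Equiv.swap a b) = eps a b
  eps_sq : ∀ a b, eps a b * eps a b = ω • eps a b
  mul_left : ∀ a b c, a ≠ b → a ≠ c → b ≠ c →
    eps a b * eps b c = rho (Equiv.swap a c) * eps b c
  mul_right : ∀ a b c, a ≠ b → a ≠ c → b ≠ c →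
    eps a b * eps b c = eps a b * rho (Equiv.swap a c)
  eps_comm : ∀ a b c d, a ≠ c → a ≠ d → b ≠ c → b ≠ d → eps a b * eps c d = eps c d * eps a b

/-- A representation of the Brauer algebra together with elements `f[r]_a` at all nodes. -/
structure CurrentRep (R : Type*) [CommRing R] (N : Type*) [DecidableEq N] (A : Type*) [Ring A]
    [Algebra R A] (ω : R) extends BrauerRep R N A ω where
  f : ℤ → N → A
  f_conj : ∀ g r a, rho g * f r a = f r (g a) * rho g
  eps_f : ∀ r a b, eps a b * (f r a + f r b) = 0
  f_eps : ∀ r a b, (f r a + f r b) * eps a b = 0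
  eps_f_comm : ∀ r a b c, c ≠ a → c ≠ b → eps a b * f r c = f r c * eps a b
  f_comm : ∀ r t a b, a ≠ b → r + t ≠ 0 → f r a * f t b - f t b * f r a =
    (rho (Equiv.swap a b) - eps a b) * f (r + t) b - f (r + t) b * (rho (Equiv.swap a b) - eps a b)

/-- Any list of distinct elements of a finite type is carried to any other one of the same length
by a permutation. -/
theorem exists_perm_map_eq {α : Type*} [Finite α] {l l' : List α} (hl : l.Nodup) (hl' : l'.Nodup)
    (h : l.length = l'.length) : ∃ g : Equiv.Perm α, l.map g = l' := by
  obtain ⟨g, hg⟩ := Equiv.Perm.exists_smul_eq_embedding (ι := Fin l.length)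
    ⟨l.get, List.nodup_iff_injective_get.1 hl⟩
    ⟨fun i => l'.get (Fin.cast h i), fun i j hij => by
      simpa using List.nodup_iff_injective_get.1 hl' hij⟩
  refine ⟨g, List.ext_get (by simpa using h) fun i h1 h2 => ?_⟩
  have := congrArg (fun e => e ⟨i, by simpa using h1⟩) hg
  simpa using this

/-! ### The extended algebra as a representation on all `2m + 1` nodes -/

section Construction

variable {R : Type*} [CommRing R] (ω : R) (m : ℕ)

theorem proj_eq_of_rel {x y : FreeAlgebra R (Gen m)} (h : Rel m ω x y) : proj ω m x = proj ω m y :=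
  RingQuot.mkAlgHom_rel R h

theorem s_sq {a : ℕ} (ha : a < 2 * m) : s ω m a * s ω m a = 1 := by
  simpa [s] using proj_eq_of_rel ω m (Rel.s_sq a ha)

theorem e_sq {a : ℕ} (ha : a < 2 * m) : e ω m a * e ω m a = ω • e ω m a := by
  simpa [e] using proj_eq_of_rel ω m (Rel.e_sq a ha)

theorem s_mul_e {a : ℕ} (ha : a < 2 * m) : s ω m a * e ω m a = e ω m a := by
  simpa [s, e] using proj_eq_of_rel ω m (Rel.s_e a ha)

theorem e_mul_s {a : ℕ} (ha : a < 2 * m) : e ω m a * s ω m a = e ω m a := by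
  simpa [s, e] using proj_eq_of_rel ω m (Rel.e_s a ha)

theorem e_mul_e_comm {a b : ℕ} (ha : a < 2 * m) (hb : b < 2 * m) (hab : a + 1 < b ∨ b + 1 < a) :
    e ω m a * e ω m b = e ω m b * e ω m a := by
  simpa [e] using proj_eq_of_rel ω m (Rel.e_comm a b ha hb hab)

theorem s_mul_e_comm {a b : ℕ} (ha : a < 2 * m) (hb : b < 2 * m) (hab : a + 1 < b ∨ b + 1 < a) :
    s ω m a * e ω m b = e ω m b * s ω m a := by
  simpa [s, e] using proj_eq_of_rel ω m (Rel.s_e_comm a b ha hb hab)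

theorem braidRels_s : BraidRels (2 * m + 1) (s ω m) where
  sq i hi := s_sq ω m (by omega)
  comm i j hij hj := by
    simpa [s] using proj_eq_of_rel ω m (Rel.s_comm i j (by omega) (by omega) (by omega))
  braid i hi := by simpa [s] using proj_eq_of_rel ω m (Rel.braid i (by omega))

theorem e_succ_mul_e {a : ℕ} (ha : a + 1 < 2 * m) :
    e ω m (a + 1) * e ω m a = s ω m a * s ω m (a + 1) * e ω m a := by
  have := proj_eq_of_rel ω m (Rel.s_e_e a ha)
  simp only [map_mul] at this
  change s ω m a * e ω m (a + 1) * e ω m a = s ω m (a + 1) * e ω m a at this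
  rw [mul_assoc (s ω m a), ← this, ← mul_assoc, ← mul_assoc, s_sq ω m (by omega), one_mul]

theorem e_succ_mul_e' {a : ℕ} (ha : a + 1 < 2 * m) :
    e ω m (a + 1) * e ω m a = e ω m (a + 1) * s ω m a * s ω m (a + 1) := by
  have := proj_eq_of_rel ω m (Rel.e_e_s a ha)
  simp only [map_mul] at this
  change e ω m (a + 1) * e ω m a * s ω m (a + 1) = e ω m (a + 1) * s ω m a at this
  rw [← this, mul_assoc _ (s ω m (a + 1)), s_sq ω m (by omega), mul_one]

/-- The action of the permutations of all nodes. -/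
noncomputable def perm : Equiv.Perm (Fin (2 * m + 1)) →* Bhat R ω m := (braidRels_s ω m).hom

/-- The node with number `a`. -/
def node (a : ℕ) : Fin (2 * m + 1) := Fin.ofNat (2 * m + 1) a

variable {m}

theorem node_eq {a : ℕ} (ha : a < 2 * m + 1) : node m a = ⟨a, ha⟩ :=
  Fin.ext (Nat.mod_eq_of_lt ha)

theorem node_val (x : Fin (2 * m + 1)) : node m x = x := node_eq x.2

theorem node_inj {a b : ℕ} (ha : a ≤ 2 * m) (hb : b ≤ 2 * m) : node m a = node m b ↔ a = b := by
  rw [node_eq (Nat.lt_succ_of_le ha), node_eq (Nat.lt_succ_of_le hb), Fin.mk.injEq]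

theorem perm_swap {a : ℕ} (ha : a < 2 * m) :
    perm ω m (Equiv.swap (node m a) (node m (a + 1))) = s ω m a := by
  rw [node_eq (by omega), node_eq (by omega), ← adjSwap_of_lt (by omega)]
  exact (braidRels_s ω m).hom_adjSwap (by omega)

theorem adjSwap_eq_node {a : ℕ} (ha : a < 2 * m) :
    adjSwap (2 * m + 1) a = Equiv.swap (node m a) (node m (a + 1)) := by
  rw [node_eq (by omega), node_eq (by omega), adjSwap_of_lt]

/-- An element that commutes with `s j, s (j+1), …` commutes with the permutations that fix
`0, …, j-1`. -/
theorem perm_commute_of_fixes (j : ℕ) {X : Bhat R ω m}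
    (hX : ∀ i, j ≤ i → i < 2 * m → s ω m i * X = X * s ω m i) (σ : Equiv.Perm (Fin (2 * m + 1)))
    (hσ : ∀ x : Fin (2 * m + 1), (x : ℕ) < j → σ x = x) : perm ω m σ * X = X * perm ω m σ := by
  obtain ⟨l, hl, rfl⟩ := exists_word_of_fixes j σ hσ
  clear hσ
  induction l with
  | nil => simp
  | cons i l ih =>
    have hi := hl i List.mem_cons_self
    rw [List.map_cons, List.prod_cons, map_mul, mul_assoc,
      ih fun k hk => hl k (List.mem_cons_of_mem _ hk), ← mul_assoc, ← mul_assoc,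
      adjSwap_eq_node (by omega), perm_swap ω (by omega), hX i hi.1 (by omega)]

theorem perm_mul_perm_inv (g : Equiv.Perm (Fin (2 * m + 1))) :
    perm ω m g * perm ω m g⁻¹ = 1 := by rw [← map_mul, mul_inv_cancel, map_one]

theorem perm_inv_mul_perm (g : Equiv.Perm (Fin (2 * m + 1))) :
    perm ω m g⁻¹ * perm ω m g = 1 := by rw [← map_mul, inv_mul_cancel, map_one]

theorem perm_swap_mul_self (a b : Fin (2 * m + 1)) :
    perm ω m (Equiv.swap a b) * perm ω m (Equiv.swap a b) = 1 := by
  rw [← map_mul, Equiv.swap_mul_self, map_one]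

section Transport

theorem exists_perm_pair (hm : 1 ≤ m) {a b : Fin (2 * m + 1)} (hab : a ≠ b) :
    ∃ g : Equiv.Perm (Fin (2 * m + 1)), g (node m 0) = a ∧ g (node m 1) = b := by
  obtain ⟨g, hg⟩ := exists_perm_map_eq (l := [node m 0, node m 1]) (l' := [a, b])
    (by simp [node_inj (show 0 ≤ 2 * m by omega) (show 1 ≤ 2 * m by omega)]) (by simpa) rfl
  exact ⟨g, by simpa using hg⟩

theorem exists_perm_triple (hm : 1 ≤ m) {a b c : Fin (2 * m + 1)} (hab : a ≠ b) (hac : a ≠ c) (hbc : b ≠ c) :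
    ∃ g : Equiv.Perm (Fin (2 * m + 1)),
      g (node m 0) = a ∧ g (node m 1) = b ∧ g (node m 2) = c := by
  obtain ⟨g, hg⟩ := exists_perm_map_eq (l := [node m 0, node m 1, node m 2]) (l' := [a, b, c])
    (by simp [node_inj (show 0 ≤ 2 * m by omega) (show 1 ≤ 2 * m by omega),
      node_inj (show 0 ≤ 2 * m by omega) (show 2 ≤ 2 * m by omega),
      node_inj (show 1 ≤ 2 * m by omega) (show 2 ≤ 2 * m by omega)]) (by simp [hab, hac, hbc]) rfl
  exact ⟨g, by simpa using hg⟩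

theorem exists_perm_quadruple (hm : 2 ≤ m) {a b c d : Fin (2 * m + 1)}
    (h : [a, b, c, d].Nodup) : ∃ g : Equiv.Perm (Fin (2 * m + 1)),
      g (node m 0) = a ∧ g (node m 1) = b ∧ g (node m 2) = c ∧ g (node m 3) = d := by
  obtain ⟨g, hg⟩ := exists_perm_map_eq (l := [node m 0, node m 1, node m 2, node m 3]) (by
    simp [node_inj (show 0 ≤ 2 * m by omega) (show 1 ≤ 2 * m by omega),
      node_inj (show 0 ≤ 2 * m by omega) (show 2 ≤ 2 * m by omega),
      node_inj (show 0 ≤ 2 * m by omega) (show 3 ≤ 2 * m by omega),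
      node_inj (show 1 ≤ 2 * m by omega) (show 3 ≤ 2 * m by omega),
      node_inj (show 2 ≤ 2 * m by omega) (show 3 ≤ 2 * m by omega),
      node_inj (show 1 ≤ 2 * m by omega) (show 2 ≤ 2 * m by omega)]) h rfl
  exact ⟨g, by simpa using hg⟩

open Classical in
/-- The element `ε_{ab}` at any two nodes (`0` if they coincide). -/
noncomputable def epsN (a b : Fin (2 * m + 1)) : Bhat R ω m :=
  if h : a ≠ b ∧ 1 ≤ m then
    perm ω m (exists_perm_pair h.2 h.1).choose * e ω m 0 *
      perm ω m (exists_perm_pair h.2 h.1).choose⁻¹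
  else 0

/-- Independence of the chosen permutation: two choices differ by a permutation that fixes the nodes
`0` and `1`, hence by a product of `s_i` with `i ≥ 2`, and these commute with `ε_0`. -/
theorem epsN_eq (hm : 1 ≤ m) (g : Equiv.Perm (Fin (2 * m + 1))) :
    epsN ω (g (node m 0)) (g (node m 1)) = perm ω m g * e ω m 0 * perm ω m g⁻¹ := by
  have h01 : node m 0 ≠ node m 1 := by
    rw [Ne, node_inj (by omega) (by omega)]; omega
  have h : g (node m 0) ≠ g (node m 1) ∧ 1 ≤ m := ⟨by simpa using h01, hm⟩
  rw [epsN, dif_pos h]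
  set g' := (exists_perm_pair h.2 h.1).choose with hg'
  obtain ⟨h0, h1⟩ := (exists_perm_pair h.2 h.1).choose_spec
  rw [← hg'] at h0 h1
  have key := perm_commute_of_fixes ω 2 (X := e ω m 0) (fun i hi hi' =>
    s_mul_e_comm ω m hi' (by omega) (by omega)) (g⁻¹ * g') (fun x hx => by
      rw [Equiv.Perm.mul_apply, Equiv.Perm.inv_eq_iff_eq, ← node_val x]
      obtain h | h : (x : ℕ) = 0 ∨ (x : ℕ) = 1 := by omega
      · rw [h, h0]
      · rw [h, h1])
  rw [map_mul] at key
  calc perm ω m g' * e ω m 0 * perm ω m g'⁻¹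
      = perm ω m g * (perm ω m g⁻¹ * perm ω m g' * e ω m 0) * perm ω m g'⁻¹ := by
        simp only [← mul_assoc, perm_mul_perm_inv, one_mul]
    _ = perm ω m g * e ω m 0 * perm ω m g⁻¹ := by
        rw [key]; simp only [mul_assoc, perm_mul_perm_inv, mul_one]

theorem epsN_self (a : Fin (2 * m + 1)) : epsN ω a a = 0 := by simp [epsN]

theorem epsN_conj (hm : 1 ≤ m) (g : Equiv.Perm (Fin (2 * m + 1))) (a b : Fin (2 * m + 1)) :
    perm ω m g * epsN ω a b = epsN ω (g a) (g b) * perm ω m g := by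
  rcases eq_or_ne a b with rfl | hab
  · simp [epsN_self]
  obtain ⟨k, rfl, rfl⟩ := exists_perm_pair hm hab
  rw [epsN_eq ω hm, ← Equiv.Perm.mul_apply, ← Equiv.Perm.mul_apply, epsN_eq ω hm, mul_inv_rev,
    map_mul, map_mul]
  simp only [mul_assoc, perm_inv_mul_perm, mul_one]

/-- Conjugation by `s_a s_{a+1}` takes `ε_a` to `ε_{a+1}`: the relations give two expressions for
`ε_{a+1} ε_a`, namely `s_a s_{a+1} ε_a` and `ε_{a+1} s_a s_{a+1}`. -/
theorem epsN_succ (hm : 1 ≤ m) {a : ℕ} (ha : a < 2 * m) :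
    epsN ω (node m a) (node m (a + 1)) = e ω m a := by
  induction a with
  | zero => simpa using epsN_eq ω hm 1
  | succ a ih =>
    have h := epsN_conj ω hm (Equiv.swap (node m a) (node m (a + 1)) *
      Equiv.swap (node m (a + 1)) (node m (a + 1 + 1))) (node m a) (node m (a + 1))
    have h1 : node m a ≠ node m (a + 1) := by rw [Ne, node_inj] <;> omega
    have h2 : node m a ≠ node m (a + 1 + 1) := by rw [Ne, node_inj] <;> omega
    have h3 : node m (a + 1) ≠ node m (a + 1 + 1) := by rw [Ne, node_inj] <;> omega
    rw [Equiv.Perm.mul_apply, Equiv.Perm.mul_apply, Equiv.swap_apply_left,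
      Equiv.swap_apply_of_ne_of_ne h1 h2, Equiv.swap_apply_left,
      Equiv.swap_apply_of_ne_of_ne h2.symm h3.symm, ih (by omega), map_mul,
      perm_swap ω (by omega), perm_swap ω ha, ← e_succ_mul_e ω m ha, e_succ_mul_e' ω m ha] at h
    have h' := congrArg (fun x => x * (s ω m (a + 1) * s ω m a)) h
    simp only [mul_assoc] at h'
    rw [← mul_assoc (s ω m (a + 1)) (s ω m (a + 1)), s_sq ω m ha, one_mul,
      s_sq ω m (by omega), mul_one, mul_one] at h'
    exact h'.symm

theorem ss_prod_range' {a d : ℕ} (h : a + d ≤ 2 * m) :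
    ∃ g : Equiv.Perm (Fin (2 * m + 1)),
      ((List.range' a d).map (s ω m)).prod = perm ω m g ∧
      ((List.range' a d).reverse.map (s ω m)).prod = perm ω m g⁻¹ ∧
      g (node m (a + d)) = node m a ∧
      ∀ b, a + d < b → b ≤ 2 * m → g (node m b) = node m b := by
  induction d generalizing a with
  | zero => exact ⟨1, by simp⟩
  | succ d ih =>
    obtain ⟨g, h1, h2, h3, h4⟩ := ih (a := a + 1) (by omega)
    refine ⟨Equiv.swap (node m a) (node m (a + 1)) * g, ?_, ?_, ?_, ?_⟩
    · rw [List.range'_succ, List.map_cons, List.prod_cons, h1, map_mul, perm_swap ω (by omega)]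
    · rw [List.range'_succ, List.reverse_cons, List.map_append, List.prod_append, h2, mul_inv_rev,
        map_mul, Equiv.swap_inv, perm_swap ω (by omega)]
      simp
    · rw [Equiv.Perm.mul_apply, show a + (d + 1) = a + 1 + d by omega, h3, Equiv.swap_apply_right]
    · intro b hb hb'
      rw [Equiv.Perm.mul_apply, h4 b (by omega) hb', Equiv.swap_apply_of_ne_of_ne] <;>
        rw [Ne, node_inj] <;> omega

theorem conjWord_eq (T : ℕ → Bhat R ω m) {a b : ℕ} (hab : a < b) (hb : b ≤ 2 * m) :
    ∃ g : Equiv.Perm (Fin (2 * m + 1)), g (node m (b - 1)) = node m a ∧ g (node m b) = node m b ∧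
      conjWord (s ω m) T a b = perm ω m g * T (b - 1) * perm ω m g⁻¹ := by
  obtain ⟨g, h1, h2, h3, h4⟩ := ss_prod_range' ω (m := m) (a := a) (d := b - 1 - a) (by omega)
  refine ⟨g, ?_, h4 b (by omega) hb, by rw [conjWord, h1, h2]⟩
  rw [show b - 1 = a + (b - 1 - a) by omega, h3]

theorem map_conjWord {A B F : Type*} [Monoid A] [Monoid B] [FunLike F A B] [MonoidHomClass F A B]
    (φ : F) (S T : ℕ → A) (a b : ℕ) :
    φ (conjWord S T a b) = conjWord (fun i => φ (S i)) (fun i => φ (T i)) a b := by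
  simp [conjWord, map_list_prod, Function.comp_def]

/-- The element `s_{ab}` is the transposition of the two nodes. -/
theorem proj_ssFree {a b : ℕ} (ha : a ≤ 2 * m) (hb : b ≤ 2 * m) (hab : a ≠ b) :
    proj ω m (ssFree R m a b) = perm ω m (Equiv.swap (node m a) (node m b)) := by
  wlog h : a < b generalizing a b
  · rw [Equiv.swap_comm, ← this hb ha hab.symm (by omega), ssFree, ssFree, min_comm, max_comm]
  rw [ssFree, min_eq_left h.le, max_eq_right h.le, map_conjWord]
  change conjWord (s ω m) (s ω m) a b = _
  obtain ⟨g, h1, h2, h3⟩ := conjWord_eq ω (s ω m) h hb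
  rw [h3, ← perm_swap ω (show b - 1 < 2 * m by omega), ← map_mul, ← map_mul,
    show b - 1 + 1 = b by omega, Equiv.mul_swap_eq_swap_mul, h1, h2, mul_inv_cancel_right]

/-- With the lemmas that pull `perm ω m g` to the left, this reduces an identity at arbitrary nodes
to one at the nodes `0, 1, 2, 3`: write the nodes as images under `g` and multiply by `perm ω m g`
on the right. -/
theorem perm_mul_right_cancel (g : Equiv.Perm (Fin (2 * m + 1))) {X Y : Bhat R ω m}
    (h : X * perm ω m g = Y * perm ω m g) : X = Y := by
  have := congrArg (· * perm ω m g⁻¹) h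
  simpa only [mul_assoc, perm_mul_perm_inv, mul_one] using this

theorem epsN_mul_perm (hm : 1 ≤ m) (g : Equiv.Perm (Fin (2 * m + 1))) (a b : Fin (2 * m + 1)) :
    epsN ω (g a) (g b) * perm ω m g = perm ω m g * epsN ω a b := (epsN_conj ω hm g a b).symm

theorem epsN_mul_perm_mul (hm : 1 ≤ m) (g : Equiv.Perm (Fin (2 * m + 1)))
    (a b : Fin (2 * m + 1)) (X : Bhat R ω m) :
    epsN ω (g a) (g b) * (perm ω m g * X) = perm ω m g * (epsN ω a b * X) := by
  rw [← mul_assoc, epsN_mul_perm ω hm, mul_assoc]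

theorem swap_mul_perm (g : Equiv.Perm (Fin (2 * m + 1))) (a b : Fin (2 * m + 1)) :
    perm ω m (Equiv.swap (g a) (g b)) * perm ω m g = perm ω m g * perm ω m (Equiv.swap a b) := by
  rw [← map_mul, ← map_mul, Equiv.mul_swap_eq_swap_mul]

theorem swap_mul_perm_mul (g : Equiv.Perm (Fin (2 * m + 1))) (a b : Fin (2 * m + 1))
    (X : Bhat R ω m) : perm ω m (Equiv.swap (g a) (g b)) * (perm ω m g * X) =
      perm ω m g * (perm ω m (Equiv.swap a b) * X) := by
  rw [← mul_assoc, swap_mul_perm, mul_assoc]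

theorem epsN_zero_one (hm : 1 ≤ m) : epsN ω (node m 0) (node m 1) = e ω m 0 :=
  epsN_succ ω hm (by omega)

theorem epsN_symm (hm : 1 ≤ m) (a b : Fin (2 * m + 1)) : epsN ω a b = epsN ω b a := by
  rcases eq_or_ne a b with rfl | hab
  · rfl
  obtain ⟨g, rfl, rfl⟩ := exists_perm_pair hm hab
  refine perm_mul_right_cancel ω g ?_
  rw [epsN_mul_perm ω hm, epsN_mul_perm ω hm, epsN_zero_one ω hm]
  have h := epsN_conj ω hm (Equiv.swap (node m 0) (node m 1)) (node m 0) (node m 1)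
  rw [Equiv.swap_apply_left, Equiv.swap_apply_right, epsN_zero_one ω hm,
    perm_swap ω (a := 0) (by omega), s_mul_e ω m (by omega)] at h
  have h' := congrArg (· * s ω m 0) h
  simp only [mul_assoc, s_sq ω m (show 0 < 2 * m by omega), mul_one,
    e_mul_s ω m (show 0 < 2 * m by omega)] at h'
  rw [h']

theorem swap_mul_epsN (hm : 1 ≤ m) (a b : Fin (2 * m + 1)) :
    perm ω m (Equiv.swap a b) * epsN ω a b = epsN ω a b := by
  rcases eq_or_ne a b with rfl | hab
  · rw [epsN_self, mul_zero]
  obtain ⟨g, rfl, rfl⟩ := exists_perm_pair hm hab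
  refine perm_mul_right_cancel ω g ?_
  simp only [mul_assoc, epsN_mul_perm ω hm, swap_mul_perm_mul]
  rw [epsN_zero_one ω hm, perm_swap ω (a := 0) (by omega), s_mul_e ω m (by omega)]

theorem epsN_mul_swap (hm : 1 ≤ m) (a b : Fin (2 * m + 1)) :
    epsN ω a b * perm ω m (Equiv.swap a b) = epsN ω a b := by
  have h := (epsN_conj ω hm (Equiv.swap a b) a b).symm
  rwa [Equiv.swap_apply_left, Equiv.swap_apply_right, epsN_symm ω hm b a, swap_mul_epsN ω hm] at h

theorem epsN_sq (hm : 1 ≤ m) (a b : Fin (2 * m + 1)) :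
    epsN ω a b * epsN ω a b = ω • epsN ω a b := by
  rcases eq_or_ne a b with rfl | hab
  · simp [epsN_self]
  obtain ⟨g, rfl, rfl⟩ := exists_perm_pair hm hab
  refine perm_mul_right_cancel ω g ?_
  simp only [mul_assoc, epsN_mul_perm ω hm, epsN_mul_perm_mul ω hm, smul_mul_assoc]
  rw [epsN_zero_one ω hm, e_sq ω m (by omega), mul_smul_comm]

theorem perm_swap_two (hm : 1 ≤ m) : perm ω m (Equiv.swap (node m 0) (node m 2)) =
    s ω m 0 * s ω m 1 * s ω m 0 := by
  have h1 : node m 0 ≠ node m 2 := by rw [Ne, node_inj] <;> omega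
  have h2 : node m 1 ≠ node m 2 := by rw [Ne, node_inj] <;> omega
  rw [← swap_mul_swap_mul_swap' h1 h2, map_mul, map_mul, perm_swap ω (a := 0) (by omega),
    perm_swap ω (a := 1) (by omega)]

theorem epsN_mul_epsN_left (hm : 1 ≤ m) (a b c : Fin (2 * m + 1)) (hab : a ≠ b) (hac : a ≠ c)
    (hbc : b ≠ c) : epsN ω a b * epsN ω b c = perm ω m (Equiv.swap a c) * epsN ω b c := by
  -- The nodes `c, b, a` are the images of `0, 1, 2` in this order, so that the product becomes `ε_1
  -- ε_0`, which the defining relations describe.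
  obtain ⟨g, rfl, rfl, rfl⟩ := exists_perm_triple hm hbc.symm hac.symm hab.symm
  refine perm_mul_right_cancel ω g ?_
  simp only [mul_assoc, epsN_mul_perm ω hm, epsN_mul_perm_mul ω hm, swap_mul_perm_mul]
  rw [epsN_symm ω hm (node m 1), epsN_symm ω hm (node m 2), epsN_zero_one ω hm,
    epsN_succ ω hm (a := 1) (by omega), Equiv.swap_comm, perm_swap_two ω hm,
    e_succ_mul_e ω m (a := 0) (by omega), mul_assoc (s ω m 0 * s ω m 1), s_mul_e ω m (by omega)]

theorem epsN_mul_epsN_right (hm : 1 ≤ m) (a b c : Fin (2 * m + 1)) (hab : a ≠ b) (hac : a ≠ c)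
    (hbc : b ≠ c) : epsN ω a b * epsN ω b c = epsN ω a b * perm ω m (Equiv.swap a c) := by
  have h := epsN_conj ω hm (Equiv.swap a c) b c
  rw [Equiv.swap_apply_right, Equiv.swap_apply_of_ne_of_ne hab.symm hbc] at h
  rw [epsN_mul_epsN_left ω hm a b c hab hac hbc, h, epsN_symm ω hm b a]

theorem epsN_comm (hm : 1 ≤ m) (a b c d : Fin (2 * m + 1)) (hac : a ≠ c) (had : a ≠ d)
    (hbc : b ≠ c) (hbd : b ≠ d) : epsN ω a b * epsN ω c d = epsN ω c d * epsN ω a b := by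
  rcases eq_or_ne a b with rfl | hab
  · simp [epsN_self]
  rcases eq_or_ne c d with rfl | hcd
  · simp [epsN_self]
  have hn : [a, b, c, d].Nodup := by simp [*]
  have hm2 : 2 ≤ m := by
    have := hn.length_le_card
    simp at this
    omega
  obtain ⟨g, rfl, rfl, rfl, rfl⟩ := exists_perm_quadruple hm2 hn
  refine perm_mul_right_cancel ω g ?_
  simp only [mul_assoc, epsN_mul_perm ω hm, epsN_mul_perm_mul ω hm]
  rw [epsN_zero_one ω hm, epsN_succ ω hm (a := 2) (by omega),
    e_mul_e_comm ω m (by omega) (by omega) (by omega)]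

/-- The element `ε_{ab}` of the algebra at two nodes. -/
theorem ee_eq (hm : 1 ≤ m) {a b : ℕ} (ha : a ≤ 2 * m) (hb : b ≤ 2 * m) (hab : a ≠ b) :
    ee ω m a b = epsN ω (node m a) (node m b) := by
  wlog h : a < b generalizing a b
  · rw [epsN_symm ω hm, ← this hb ha hab.symm (by omega), ee, ee, eeFree, eeFree, min_comm,
      max_comm]
  rw [ee, eeFree, min_eq_left h.le, max_eq_right h.le, map_conjWord]
  change conjWord (s ω m) (e ω m) a b = _
  obtain ⟨g, h1, h2, h3⟩ := conjWord_eq ω (e ω m) h hb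
  rw [h3, ← epsN_succ ω hm (show b - 1 < 2 * m by omega), show b - 1 + 1 = b by omega,
    epsN_conj ω hm, h1, h2, mul_assoc, perm_mul_perm_inv, mul_one]

/-- The element `f[r]_a` at any node. -/
noncomputable def fN (r : ℤ) (a : Fin (2 * m + 1)) : Bhat R ω m :=
  perm ω m (Equiv.swap (node m 0) a) * fr ω m r 0 * perm ω m (Equiv.swap (node m 0) a)

/-- The nodes above `m` carry no generator `f`; conjugates of `f[r]_0` take their place. The
conjugating permutation does not matter, since `f[r]_0` commutes with every `s_i`, `i ≥ 1`. -/
theorem fN_eq (r : ℤ) (g : Equiv.Perm (Fin (2 * m + 1))) :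
    fN ω r (g (node m 0)) = perm ω m g * fr ω m r 0 * perm ω m g⁻¹ := by
  have key := perm_commute_of_fixes ω 1 (X := fr ω m r 0) (fun i hi hi' => by
      have := proj_eq_of_rel ω m (Rel.s_f_comm r i (i + 1) 0 (by omega) (by omega) (by omega)
        (by omega) (by omega) (by omega))
      rw [map_mul, map_mul, proj_ssFree ω (by omega) (by omega) (by omega),
        perm_swap ω (by omega)] at this
      exact this)
    (g⁻¹ * Equiv.swap (node m 0) (g (node m 0))) (fun x hx => by
      obtain rfl : x = node m 0 := by rw [← node_val x]; congr 1; omega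
      simp)
  rw [map_mul] at key
  calc perm ω m (Equiv.swap (node m 0) (g (node m 0))) * fr ω m r 0 *
        perm ω m (Equiv.swap (node m 0) (g (node m 0)))
      = perm ω m g * (perm ω m g⁻¹ * perm ω m (Equiv.swap (node m 0) (g (node m 0))) *
          fr ω m r 0) * perm ω m (Equiv.swap (node m 0) (g (node m 0))) := by
        simp only [← mul_assoc, perm_mul_perm_inv, one_mul]
    _ = perm ω m g * fr ω m r 0 * perm ω m g⁻¹ := by
        rw [key]; simp only [mul_assoc, perm_swap_mul_self, mul_one]

theorem fN_conj (r : ℤ) (g : Equiv.Perm (Fin (2 * m + 1))) (a : Fin (2 * m + 1)) :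
    perm ω m g * fN ω r a = fN ω r (g a) * perm ω m g := by
  have h := fN_eq ω r (g * Equiv.swap (node m 0) a)
  rw [Equiv.Perm.mul_apply, Equiv.swap_apply_left] at h
  rw [h, fN, mul_inv_rev, Equiv.swap_inv, map_mul, map_mul]
  simp only [mul_assoc, perm_inv_mul_perm, mul_one]

theorem fN_mul_perm (r : ℤ) (g : Equiv.Perm (Fin (2 * m + 1))) (a : Fin (2 * m + 1)) :
    fN ω r (g a) * perm ω m g = perm ω m g * fN ω r a := (fN_conj ω r g a).symm

theorem fN_mul_perm_mul (r : ℤ) (g : Equiv.Perm (Fin (2 * m + 1))) (a : Fin (2 * m + 1))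
    (X : Bhat R ω m) : fN ω r (g a) * (perm ω m g * X) = perm ω m g * (fN ω r a * X) := by
  rw [← mul_assoc, fN_mul_perm, mul_assoc]

theorem fr_eq (r : ℤ) {a : ℕ} (ha : a ≤ m) : fr ω m r a = fN ω r (node m a) := by
  rcases Nat.eq_zero_or_pos a with rfl | hpos
  · rw [fN, Equiv.swap_self]
    change _ = perm ω m 1 * _ * perm ω m 1
    simp
  have := proj_eq_of_rel ω m (Rel.s_f r 0 a (by omega) ha (by omega))
  rw [map_mul, map_mul, proj_ssFree ω (by omega) (by omega) (by omega)] at this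
  change _ * fr ω m r 0 = fr ω m r a * _ at this
  rw [fN, this, mul_assoc, perm_swap_mul_self, mul_one]

theorem epsN_mul_fN (hm : 1 ≤ m) (r : ℤ) (a b : Fin (2 * m + 1)) :
    epsN ω a b * (fN ω r a + fN ω r b) = 0 := by
  rcases eq_or_ne a b with rfl | hab
  · rw [epsN_self, zero_mul]
  obtain ⟨g, rfl, rfl⟩ := exists_perm_pair hm hab
  refine perm_mul_right_cancel ω g ?_
  simp only [mul_assoc, add_mul, fN_mul_perm, ← mul_add, epsN_mul_perm_mul ω hm, zero_mul]
  have := proj_eq_of_rel ω m (Rel.e_f r 0 1 (by omega) hm (by omega))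
  rw [map_mul, map_add, map_zero] at this
  change ee ω m 0 1 * (fr ω m r 0 + fr ω m r 1) = 0 at this
  rw [ee_eq ω hm (by omega) (by omega) (by omega), fr_eq ω r (by omega), fr_eq ω r hm] at this
  rw [this, mul_zero]

theorem fN_mul_epsN (hm : 1 ≤ m) (r : ℤ) (a b : Fin (2 * m + 1)) :
    (fN ω r a + fN ω r b) * epsN ω a b = 0 := by
  rcases eq_or_ne a b with rfl | hab
  · rw [epsN_self, mul_zero]
  obtain ⟨g, rfl, rfl⟩ := exists_perm_pair hm hab
  refine perm_mul_right_cancel ω g ?_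
  simp only [mul_assoc, add_mul, fN_mul_perm_mul, ← mul_add, epsN_mul_perm ω hm, zero_mul]
  have := proj_eq_of_rel ω m (Rel.f_e r 0 1 (by omega) hm (by omega))
  rw [map_mul, map_add, map_zero] at this
  change (fr ω m r 0 + fr ω m r 1) * ee ω m 0 1 = 0 at this
  rw [ee_eq ω hm (by omega) (by omega) (by omega), fr_eq ω r (by omega), fr_eq ω r hm,
    add_mul] at this
  rw [this, mul_zero]

theorem epsN_fN_comm (hm : 1 ≤ m) (r : ℤ) (a b c : Fin (2 * m + 1)) (hca : c ≠ a) (hcb : c ≠ b) :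
    epsN ω a b * fN ω r c = fN ω r c * epsN ω a b := by
  rcases eq_or_ne a b with rfl | hab
  · simp [epsN_self]
  obtain ⟨g, rfl, rfl, rfl⟩ := exists_perm_triple hm hca hcb hab
  refine perm_mul_right_cancel ω g ?_
  simp only [mul_assoc, fN_mul_perm_mul, fN_mul_perm, epsN_mul_perm ω hm, epsN_mul_perm_mul ω hm]
  have := proj_eq_of_rel ω m (Rel.e_f_comm r 1 2 0 (by omega) (by omega) (by omega) (by omega)
    (by omega) (by omega))
  rw [map_mul, map_mul] at this
  change ee ω m 1 2 * fr ω m r 0 = fr ω m r 0 * ee ω m 1 2 at this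
  rw [ee_eq ω hm (by omega) (by omega) (by omega), fr_eq ω r (by omega)] at this
  rw [this]

/-- The condition `r + t ≠ 0` removes the central term. It holds wherever two letters are
interchanged, because their indices are negative there. -/
theorem fN_comm (hm : 1 ≤ m) (r t : ℤ) (a b : Fin (2 * m + 1)) (hab : a ≠ b) (hrt : r + t ≠ 0) :
    fN ω r a * fN ω t b - fN ω t b * fN ω r a =
      (perm ω m (Equiv.swap a b) - epsN ω a b) * fN ω (r + t) b -
        fN ω (r + t) b * (perm ω m (Equiv.swap a b) - epsN ω a b) := by
  obtain ⟨g, rfl, rfl⟩ := exists_perm_pair hm hab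
  refine perm_mul_right_cancel ω g ?_
  simp only [mul_assoc, sub_mul, fN_mul_perm_mul, fN_mul_perm, epsN_mul_perm ω hm,
    epsN_mul_perm_mul ω hm, swap_mul_perm, swap_mul_perm_mul, ← mul_sub]
  have := proj_eq_of_rel ω m (Rel.f_comm r t 0 1 (by omega) hm (by omega))
  rw [if_neg (by omega), zero_smul, add_zero] at this
  simp only [map_mul, map_sub] at this
  rw [proj_ssFree ω (by omega) (by omega) (by omega)] at this
  change fr ω m r 0 * fr ω m t 1 - fr ω m t 1 * fr ω m r 0 =
    (_ - ee ω m 0 1) * fr ω m (r + t) 1 - fr ω m (r + t) 1 * (_ - ee ω m 0 1) at this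
  rw [ee_eq ω hm (by omega) (by omega) (by omega), fr_eq ω r (by omega), fr_eq ω t hm,
    fr_eq ω _ hm, sub_mul] at this
  rw [this]

/-- The extended Brauer-type algebra, with the elements `f[r]_a` extended to all nodes. -/
noncomputable def bhatRep (hm : 1 ≤ m) : CurrentRep R (Fin (2 * m + 1)) (Bhat R ω m) ω where
  rho := perm ω m
  eps := epsN ω
  eps_self := epsN_self ω
  eps_symm := epsN_symm ω hm
  conj := epsN_conj ω hm
  swap_mul := swap_mul_epsN ω hm
  mul_swap := epsN_mul_swap ω hm
  eps_sq := epsN_sq ω hm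
  mul_left := epsN_mul_epsN_left ω hm
  mul_right := epsN_mul_epsN_right ω hm
  eps_comm := epsN_comm ω hm
  f := fN ω
  f_conj g r a := fN_conj ω r g a
  eps_f := epsN_mul_fN ω hm
  f_eps := fN_mul_epsN ω hm
  eps_f_comm := epsN_fN_comm ω hm
  f_comm := fN_comm ω hm

end Transport

end Construction
-- Permutations supported on a set of nodes
/-- The permutations that move only elements of `S`. -/
def permsOn {N : Type*} [DecidableEq N] [Fintype N] (S : Finset N) : Finset (Equiv.Perm N) :=
  Finset.univ.filter fun g => ∀ x ∉ S, g x = x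

theorem map_swap_eq_of_notMem {N : Type*} [DecidableEq N] {S : Finset N} {a b : N} (ha : a ∉ S)
    (hb : b ∉ S) : S.map (Equiv.swap a b).toEmbedding = S := by
  refine Finset.eq_of_subset_of_card_le ?_ (by simp)
  intro y hy
  obtain ⟨x, hx, rfl⟩ := Finset.mem_map.1 hy
  have hxa : x ≠ a := fun h => ha (h ▸ hx)
  have hxb : x ≠ b := fun h => hb (h ▸ hx)
  rwa [Equiv.coe_toEmbedding, Equiv.swap_apply_of_ne_of_ne hxa hxb]

section PermsOn

variable {N : Type*} [DecidableEq N] [Fintype N] {S T : Finset N} {g k : Equiv.Perm N}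

theorem mem_permsOn : g ∈ permsOn S ↔ ∀ x ∉ S, g x = x := by simp [permsOn]

theorem permsOn_mono (h : S ⊆ T) (hg : g ∈ permsOn S) : g ∈ permsOn T :=
  mem_permsOn.2 fun x hx => mem_permsOn.1 hg x fun hx' => hx (h hx')

theorem mul_mem_permsOn (hg : g ∈ permsOn S) (hk : k ∈ permsOn S) : g * k ∈ permsOn S := by
  rw [mem_permsOn] at *
  intro x hx
  rw [Equiv.Perm.mul_apply, hk x hx, hg x hx]

theorem inv_mem_permsOn (hg : g ∈ permsOn S) : g⁻¹ ∈ permsOn S := by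
  rw [mem_permsOn] at *
  intro x hx
  rw [Equiv.Perm.inv_eq_iff_eq, hg x hx]

theorem swap_mem_permsOn {a b : N} (ha : a ∈ S) (hb : b ∈ S) : Equiv.swap a b ∈ permsOn S := by
  rw [mem_permsOn]
  intro x hx
  exact Equiv.swap_apply_of_ne_of_ne (fun h => hx (h ▸ ha)) (fun h => hx (h ▸ hb))

theorem apply_mem_of_mem_permsOn (hg : g ∈ permsOn S) {x : N} (hx : x ∈ S) : g x ∈ S := by
  by_contra h
  have h1 := mem_permsOn.1 hg _ h
  exact h ((g.injective h1).symm ▸ hx)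

theorem map_eq_of_mem_permsOn (hg : g ∈ permsOn S) : S.map g.toEmbedding = S := by
  refine Finset.eq_of_subset_of_card_le ?_ (by simp)
  intro y hy
  obtain ⟨x, hx, rfl⟩ := Finset.mem_map.1 hy
  exact apply_mem_of_mem_permsOn hg hx

/-- Coset decomposition by the image `c` of `v`; the term `c = v` has the trivial transposition. -/
theorem permsOn_insert_sum {M : Type*} [AddCommMonoid M] {v : N} (hv : v ∉ S)
    (F : Equiv.Perm N → M) :
    ∑ g ∈ permsOn (insert v S), F g =
      ∑ c ∈ insert v S, ∑ g ∈ permsOn S, F (Equiv.swap v c * g) := by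
  rw [← Finset.sum_product']
  symm
  refine Finset.sum_bij' (fun p _ => Equiv.swap v p.1 * p.2)
    (fun g _ => (g v, Equiv.swap v (g v) * g)) ?_ ?_ ?_ ?_ ?_
  · rintro ⟨c, g⟩ h
    obtain ⟨hc, hg⟩ := Finset.mem_product.1 h
    exact mul_mem_permsOn (swap_mem_permsOn (Finset.mem_insert_self _ _) hc)
      (permsOn_mono (Finset.subset_insert _ _) hg)
  · intro g hg
    have hgv := apply_mem_of_mem_permsOn hg (Finset.mem_insert_self v S)
    refine Finset.mem_product.2 ⟨hgv, mem_permsOn.2 fun x hx => ?_⟩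
    rcases eq_or_ne x v with rfl | hxv
    · simp
    · have hx' : x ∉ insert v S := by simp [hx, hxv]
      rw [Equiv.Perm.mul_apply, mem_permsOn.1 hg x hx']
      exact Equiv.swap_apply_of_ne_of_ne hxv fun h => hx' (h ▸ hgv)
  · rintro ⟨c, g⟩ h
    obtain ⟨hc, hg⟩ := Finset.mem_product.1 h
    have hgv := mem_permsOn.1 hg v hv
    simp [hgv, ← mul_assoc]
  · intro g hg
    simp [← mul_assoc]
  · intro p hp
    rfl

theorem permsOn_empty : permsOn (∅ : Finset N) = {1} := by
  ext g
  simp [mem_permsOn, Equiv.ext_iff]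

theorem card_permsOn (S : Finset N) :
    (permsOn S).card = S.card.factorial := by
  induction S using Finset.induction_on with
  | empty => rw [permsOn_empty]; simp
  | insert v S hv ih =>
    have := permsOn_insert_sum hv (fun _ => 1)
    simp only [Finset.sum_const, smul_eq_mul, mul_one] at this
    rw [this, ih, Finset.card_insert_of_notMem hv, Nat.factorial_succ]

end PermsOn

/-! ### Sums over matchings -/

namespace BrauerRep

variable {𝕜 : Type*} [Field 𝕜] {N : Type*} [DecidableEq N] {A : Type*} [Ring A]
  [Algebra 𝕜 A] {ω : 𝕜} (B : BrauerRep 𝕜 N A ω)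

theorem rho_swap_mul_rho_swap (a b : N) :
    B.rho (Equiv.swap a b) * B.rho (Equiv.swap a b) = 1 := by
  rw [← map_mul, Equiv.swap_mul_self, map_one]

theorem mul_right' {a b c : N} (hab : a ≠ b) (hac : a ≠ c) (hbc : b ≠ c) :
    B.eps a b * B.eps a c = B.eps a b * B.rho (Equiv.swap b c) := by
  rw [B.eps_symm a b, B.mul_right b a c hab.symm hbc hac]

/-- The representation on the opposite algebra. -/
def op : BrauerRep 𝕜 N Aᵐᵒᵖ ω where
  rho :=
    { toFun := fun g => MulOpposite.op (B.rho g⁻¹)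
      map_one' := by simp
      map_mul' := fun g h => by rw [mul_inv_rev, map_mul, MulOpposite.op_mul] }
  eps a b := MulOpposite.op (B.eps a b)
  eps_self a := by rw [B.eps_self, MulOpposite.op_zero]
  eps_symm a b := by rw [B.eps_symm]
  conj g a b := by
    have h := B.conj g⁻¹ (g a) (g b)
    rw [← Equiv.Perm.mul_apply, ← Equiv.Perm.mul_apply, inv_mul_cancel, Equiv.Perm.one_apply,
      Equiv.Perm.one_apply] at h
    exact congrArg MulOpposite.op h.symm
  swap_mul a b := congrArg MulOpposite.op (by
    change B.eps a b * B.rho (Equiv.swap a b)⁻¹ = _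
    rw [Equiv.swap_inv, B.mul_swap])
  mul_swap a b := congrArg MulOpposite.op (by
    change B.rho (Equiv.swap a b)⁻¹ * B.eps a b = _
    rw [Equiv.swap_inv, B.swap_mul])
  eps_sq a b := congrArg MulOpposite.op (B.eps_sq a b)
  mul_left a b c hab hac hbc := congrArg MulOpposite.op (by
    change B.eps b c * B.eps a b = B.eps b c * B.rho (Equiv.swap a c)⁻¹
    rw [Equiv.swap_inv, B.eps_symm b c, B.eps_symm a b, Equiv.swap_comm,
      B.mul_right c b a hbc.symm hac.symm hab.symm])
  mul_right a b c hab hac hbc := congrArg MulOpposite.op (by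
    change B.eps b c * B.eps a b = B.rho (Equiv.swap a c)⁻¹ * B.eps a b
    rw [Equiv.swap_inv, B.eps_symm b c, B.eps_symm a b, Equiv.swap_comm,
      B.mul_left c b a hbc.symm hac.symm hab.symm])
  eps_comm a b c d hac had hbc hbd := congrArg MulOpposite.op
    (B.eps_comm a b c d hac had hbc hbd).symm

theorem op_rho (g : Equiv.Perm N) : B.op.rho g = MulOpposite.op (B.rho g⁻¹) := rfl

theorem op_eps (a b : N) : B.op.eps a b = MulOpposite.op (B.eps a b) := rfl

/-- The sum of the products `ε_{a_1 b_1} ⋯ ε_{a_j b_j}` over all sets of `j` disjoint pairs in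
`S`. -/
noncomputable def matchSum : ℕ → Finset N → A
  | 0, _ => 1
  -- A set of `j + 1` pairs arises once for each choice of the first pair and of its order; the
  -- terms with `a = b` vanish by `eps_self`.
  | j + 1, S => (2 * (j + 1 : 𝕜))⁻¹ •
      ∑ a ∈ S, ∑ b ∈ S, B.eps a b * matchSum j ((S.erase a).erase b)

theorem matchSum_zero (S : Finset N) : B.matchSum 0 S = 1 := rfl

theorem rho_mul_matchSum (g : Equiv.Perm N) (j : ℕ) (S : Finset N) :
    B.rho g * B.matchSum j S = B.matchSum j (S.map g.toEmbedding) * B.rho g := by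
  induction j generalizing S with
  | zero => simp [matchSum]
  | succ j ih =>
    simp only [matchSum, mul_smul_comm, smul_mul_assoc, Finset.mul_sum, Finset.sum_mul,
      Finset.sum_map]
    congr 1
    refine Finset.sum_congr rfl fun a _ => Finset.sum_congr rfl fun b _ => ?_
    rw [← mul_assoc, B.conj, mul_assoc, ih, Finset.map_erase, Finset.map_erase, mul_assoc]
    rfl

theorem rho_mul_matchSum_of_map_eq {g : Equiv.Perm N} {S : Finset N}
    (h : S.map g.toEmbedding = S) (j : ℕ) :
    B.rho g * B.matchSum j S = B.matchSum j S * B.rho g := by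
  rw [rho_mul_matchSum, h]

theorem eps_mul_matchSum {x y : N} {S : Finset N} (hx : x ∉ S) (hy : y ∉ S) (j : ℕ) :
    B.eps x y * B.matchSum j S = B.matchSum j S * B.eps x y := by
  induction j generalizing S with
  | zero => simp [matchSum]
  | succ j ih =>
    simp only [matchSum, mul_smul_comm, smul_mul_assoc, Finset.mul_sum, Finset.sum_mul]
    congr 1
    refine Finset.sum_congr rfl fun a ha => Finset.sum_congr rfl fun b hb => ?_
    have ne : ∀ {z w : N}, z ∉ S → w ∈ S → z ≠ w := fun hz hw h => hz (h ▸ hw)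
    rw [← mul_assoc, B.eps_comm x y a b (ne hx ha) (ne hx hb) (ne hy ha) (ne hy hb), mul_assoc,
      ih (by simp [hx]) (by simp [hy]), mul_assoc]

theorem op_matchSum (j : ℕ) (S : Finset N) :
    B.op.matchSum j S = MulOpposite.op (B.matchSum j S) := by
  induction j generalizing S with
  | zero => rfl
  | succ j ih =>
    simp only [matchSum, MulOpposite.op_smul, Finset.op_sum, ih]
    congr 1
    refine Finset.sum_congr rfl fun a ha => Finset.sum_congr rfl fun b hb => ?_
    rw [B.eps_mul_matchSum (by simp) (by simp)]
    rfl

theorem matchSum_eq_zero {j : ℕ} {S : Finset N} (h : S.card < 2 * j) : B.matchSum j S = 0 := by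
  induction j generalizing S with
  | zero => omega
  | succ j ih =>
    rw [matchSum, Finset.sum_eq_zero, smul_zero]
    intro a ha
    refine Finset.sum_eq_zero fun b hb => ?_
    rcases eq_or_ne a b with rfl | hab
    · rw [B.eps_self, zero_mul]
    · rw [ih, mul_zero]
      rw [Finset.card_erase_of_mem (by simp [hb, hab.symm]), Finset.card_erase_of_mem ha]
      have : 2 ≤ S.card := Finset.one_lt_card.2 ⟨a, ha, b, hb, hab⟩
      omega

variable [CharZero 𝕜]

theorem two_mul_smul_matchSum_succ (j : ℕ) (S : Finset N) :
    (2 * (j + 1 : 𝕜)) • B.matchSum (j + 1) S =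
      ∑ a ∈ S, ∑ b ∈ S, B.eps a b * B.matchSum j ((S.erase a).erase b) := by
  have : (2 * (j + 1 : 𝕜)) ≠ 0 := mul_ne_zero two_ne_zero (Nat.cast_add_one_ne_zero j)
  rw [matchSum, smul_smul, mul_inv_cancel₀ this, one_smul]

theorem sum_eps_mul_matchSum_erase (j : ℕ) (S : Finset N) :
    ∑ a ∈ S, ∑ b ∈ S.erase a, B.eps a b * B.matchSum j ((S.erase a).erase b) =
      (2 * (j + 1 : 𝕜)) • B.matchSum (j + 1) S := by
  rw [two_mul_smul_matchSum_succ]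
  refine Finset.sum_congr rfl fun a ha => ?_
  rw [← Finset.add_sum_erase S _ ha, B.eps_self, zero_mul, zero_add]

/-- Expansion of the sum over matchings by the partner of a node. -/
theorem matchSum_insert (j : ℕ) {S : Finset N} {v : N} (hv : v ∉ S) :
    B.matchSum (j + 1) (insert v S) =
      B.matchSum (j + 1) S + ∑ a ∈ S, B.eps v a * B.matchSum j (S.erase a) := by
  have hc : (2 * (j + 1 : 𝕜)) ≠ 0 := mul_ne_zero two_ne_zero (Nat.cast_add_one_ne_zero j)
  induction j generalizing S with
  | zero =>
    refine smul_right_injective A hc ?_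
    simp only [smul_add, two_mul_smul_matchSum_succ, matchSum_zero, mul_one]
    rw [Finset.sum_insert hv, Finset.sum_insert hv, B.eps_self]
    simp only [Finset.sum_insert hv, Finset.sum_add_distrib, B.eps_symm _ v]
    simp only [Nat.cast_zero, zero_add, mul_one, two_smul]
    abel
  | succ j ih =>
    have hc' : (2 * (j + 1 : 𝕜)) ≠ 0 := mul_ne_zero two_ne_zero (Nat.cast_add_one_ne_zero j)
    refine smul_right_injective A hc ?_
    simp only [smul_add, two_mul_smul_matchSum_succ]
    rw [Finset.sum_insert hv, Finset.sum_insert hv, B.eps_self, zero_mul, zero_add]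
    simp only [Finset.sum_insert hv, Finset.sum_add_distrib, B.eps_symm _ v,
      Finset.erase_insert hv]
    have e1 : ∑ a ∈ S, B.eps v a * B.matchSum (j + 1) (((insert v S).erase a).erase v) =
        ∑ a ∈ S, B.eps v a * B.matchSum (j + 1) (S.erase a) :=
      Finset.sum_congr rfl fun a _ => by rw [Finset.erase_right_comm, Finset.erase_insert hv]
    -- Expand the remaining matching by the partner `c` of `v` and move `ε_{vc}` to the front. The
    -- pairs `(a, b)` next to it sum to `2(j + 1)` times the matching sum on `S \ c`. With the two
    -- terms in which the pair of `v` is the first one, the total is `2(j + 2)`.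
    have e2 : ∑ a ∈ S, ∑ b ∈ S, B.eps a b *
          B.matchSum (j + 1) (((insert v S).erase a).erase b) =
        ∑ a ∈ S, ∑ b ∈ S, B.eps a b * B.matchSum (j + 1) ((S.erase a).erase b) +
        ∑ c ∈ S, B.eps v c * ((2 * (j + 1 : 𝕜)) • B.matchSum (j + 1) (S.erase c)) := by
      have : ∀ a ∈ S, ∀ b ∈ S, B.eps a b * B.matchSum (j + 1) (((insert v S).erase a).erase b) =
          B.eps a b * B.matchSum (j + 1) ((S.erase a).erase b) +
          ∑ c ∈ (S.erase a).erase b,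
            B.eps a b * (B.eps v c * B.matchSum j (((S.erase a).erase b).erase c)) := by
        intro a ha b hb
        have hva : v ≠ a := fun h => hv (h ▸ ha)
        have hvb : v ≠ b := fun h => hv (h ▸ hb)
        rw [Finset.erase_insert_of_ne hva, Finset.erase_insert_of_ne hvb,
          ih (by simp [hv]) hc', mul_add, Finset.mul_sum]
      rw [Finset.sum_congr rfl fun a ha => Finset.sum_congr rfl fun b hb => this a ha b hb]
      simp only [Finset.sum_add_distrib]
      congr 1
      have h1 : ∀ a ∈ S, ∑ b ∈ S, ∑ c ∈ (S.erase a).erase b,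
            B.eps a b * (B.eps v c * B.matchSum j (((S.erase a).erase b).erase c)) =
          ∑ c ∈ S.erase a, ∑ b ∈ S.erase c,
            B.eps a b * (B.eps v c * B.matchSum j (((S.erase a).erase b).erase c)) := by
        intro a _
        refine Finset.sum_comm' fun b c => ?_
        simp only [Finset.mem_erase]
        tauto
      rw [Finset.sum_congr rfl h1, Finset.sum_comm' (t' := S) (s' := fun c => S.erase c)
        (fun a c => by simp only [Finset.mem_erase]; tauto)]
      refine Finset.sum_congr rfl fun c hc => ?_
      rw [two_mul_smul_matchSum_succ, Finset.mul_sum]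
      refine Finset.sum_congr rfl fun a ha => ?_
      rw [Finset.mul_sum]
      refine Finset.sum_congr rfl fun b hb => ?_
      have hva : v ≠ a := fun h => hv (h ▸ (Finset.mem_of_mem_erase ha))
      have hvb : v ≠ b := fun h => hv (h ▸ (Finset.mem_of_mem_erase hb))
      rw [← mul_assoc, ← mul_assoc, B.eps_comm a b v c hva.symm (Finset.ne_of_mem_erase ha)
        hvb.symm (Finset.ne_of_mem_erase hb), Finset.erase_right_comm (a := b),
        Finset.erase_right_comm (a := a) (b := c)]
    rw [e1, e2]
    simp only [mul_smul_comm, ← Finset.smul_sum]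
    push_cast
    module

/-- A matching with `j` pairs leaves `S.card - 2 * j` nodes free, and it is counted once for each of
them. -/
theorem sum_matchSum_erase (j : ℕ) (S : Finset N) :
    ∑ c ∈ S, B.matchSum j (S.erase c) = ((S.card : 𝕜) - 2 * j) • B.matchSum j S := by
  cases j with
  | zero => simp [matchSum_zero, ← Nat.cast_smul_eq_nsmul 𝕜]
  | succ j =>
    have : ∀ c ∈ S, B.matchSum (j + 1) (S.erase c) = B.matchSum (j + 1) S -
        ∑ a ∈ S.erase c, B.eps c a * B.matchSum j ((S.erase c).erase a) := fun c hc => by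
      conv_rhs => rw [← Finset.insert_erase hc, B.matchSum_insert j (Finset.notMem_erase c S),
        Finset.erase_insert (Finset.notMem_erase c S)]
      simp
    rw [Finset.sum_congr rfl this, Finset.sum_sub_distrib, sum_eps_mul_matchSum_erase,
      Finset.sum_const, ← Nat.cast_smul_eq_nsmul 𝕜, ← sub_smul]
    push_cast
    rfl

/-- Sort the matchings by what happens to `a` and `b`. The pair `(a, b)` itself gives `ω`. If just
one of the two is matched, to `c` say, the product with `ε_{ab}` becomes a transposition, which `X`
absorbs; this gives `S.card - 2j` for each of `a` and `b`. If both are matched, to `c` and `d`, the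
pairs merge to `ε_{cd}`, which gives `2j`. The sum is `ω + 2 * S.card - 2 * j`. -/
theorem eps_mul_matchSum_insert_mul (j : ℕ) {S : Finset N} {a b : N} (hab : a ≠ b) (ha : a ∉ S)
    (hb : b ∉ S) {X : A} (hX : ∀ c ∈ S, B.rho (Equiv.swap a c) * X = X)
    (hX' : ∀ c ∈ S, B.rho (Equiv.swap b c) * X = X) :
    B.eps a b * B.matchSum (j + 1) (insert a (insert b S)) * X =
      (ω + 2 * S.card - 2 * j) • (B.eps a b * B.matchSum j S * X) +
        B.eps a b * B.matchSum (j + 1) S * X := by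
  have hab' : a ∉ insert b S := by simp [ha, hab]
  have ne : ∀ {z w : N}, z ∉ S → w ∈ S → z ≠ w := fun hz hw h => hz (h ▸ hw)
  have t2 : ∀ (i : ℕ), ∀ c ∈ S, B.eps a b * (B.eps b c * B.matchSum i (S.erase c)) * X =
      B.eps a b * B.matchSum i (S.erase c) * X := by
    intro i c hc
    rw [← mul_assoc, B.mul_right a b c hab (ne ha hc) (ne hb hc), mul_assoc (B.eps a b),
      B.rho_mul_matchSum_of_map_eq (map_swap_eq_of_notMem (by simp [ha]) (by simp)), mul_assoc,
      mul_assoc (B.matchSum i _), hX c hc, ← mul_assoc]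
  have t3 : ∀ (i : ℕ), ∀ c ∈ S, B.eps a b * (B.eps a c * B.matchSum i (S.erase c)) * X =
      B.eps a b * B.matchSum i (S.erase c) * X := by
    intro i c hc
    rw [← mul_assoc, B.mul_right' hab (ne ha hc) (ne hb hc), mul_assoc (B.eps a b),
      B.rho_mul_matchSum_of_map_eq (map_swap_eq_of_notMem (by simp [hb]) (by simp)), mul_assoc,
      mul_assoc (B.matchSum i _), hX' c hc, ← mul_assoc]
  have key : ∑ c ∈ S, B.eps a b * (B.eps a c * B.matchSum j (insert b (S.erase c))) * X =
      ∑ c ∈ S, B.eps a b * B.matchSum j (S.erase c) * X +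
        (2 * j : 𝕜) • (B.eps a b * B.matchSum j S * X) := by
    cases j with
    | zero =>
      rw [Nat.cast_zero, mul_zero, zero_smul, add_zero]
      exact Finset.sum_congr rfl fun c hc => by simpa [matchSum_zero] using t3 0 c hc
    | succ j =>
      have : ∀ c ∈ S, B.eps a b * (B.eps a c * B.matchSum (j + 1) (insert b (S.erase c))) * X =
          B.eps a b * B.matchSum (j + 1) (S.erase c) * X +
          B.eps a b * (∑ d ∈ S.erase c, B.eps c d * B.matchSum j ((S.erase c).erase d)) * X := by
        intro c hc
        rw [B.matchSum_insert j (by simp [hb]), mul_add, mul_add, add_mul, t3 (j + 1) c hc]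
        congr 1
        simp only [Finset.mul_sum, Finset.sum_mul]
        refine Finset.sum_congr rfl fun d hd => ?_
        have hdS := Finset.mem_of_mem_erase hd
        have hdc := Finset.ne_of_mem_erase hd
        have hsw : B.rho (Equiv.swap b c) * B.eps b d = B.eps c d * B.rho (Equiv.swap b c) := by
          rw [B.conj, Equiv.swap_apply_left,
            Equiv.swap_apply_of_ne_of_ne (ne hb hdS).symm hdc]
        rw [← mul_assoc, B.mul_right' hab (ne ha hc) (ne hb hc), mul_assoc (B.eps a b),
          ← mul_assoc _ (B.eps b d), hsw, mul_assoc (B.eps c d),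
          B.rho_mul_matchSum_of_map_eq (map_swap_eq_of_notMem (by simp [hb]) (by simp))]
        simp only [mul_assoc]
        rw [hX' c hc]
      rw [Finset.sum_congr rfl this, Finset.sum_add_distrib, ← Finset.sum_mul, ← Finset.mul_sum,
        ← Finset.sum_mul, ← Finset.mul_sum, sum_eps_mul_matchSum_erase]
      simp
  rw [B.matchSum_insert j hab', B.matchSum_insert j hb, Finset.sum_insert hb,
    Finset.erase_insert hb]
  simp only [mul_add, add_mul, Finset.mul_sum, Finset.sum_mul]
  have e : ∀ c ∈ S, B.eps a b * (B.eps a c * B.matchSum j ((insert b S).erase c)) * X =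
      B.eps a b * (B.eps a c * B.matchSum j (insert b (S.erase c))) * X := fun c hc => by
    rw [Finset.erase_insert_of_ne (ne hb hc)]
  rw [Finset.sum_congr rfl (t2 j), Finset.sum_congr rfl e, key, ← Finset.sum_mul,
    ← Finset.mul_sum, sum_matchSum_erase, ← mul_assoc, B.eps_sq]
  simp only [mul_smul_comm, smul_mul_assoc]
  module

end BrauerRep
-- The explicit Brauer symmetriser and its partial trace
/-- The coefficients `(-1)^j / ∏_{i=1}^{j} (ω + 2n - 2 - 2i)` of the Brauer symmetriser. -/
noncomputable def symCoeff {𝕜 : Type*} [Field 𝕜] (ω : 𝕜) (n : ℕ) : ℕ → 𝕜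
  | 0 => 1
  | j + 1 => -symCoeff ω n j / (ω + 2 * n - 4 - 2 * j)

theorem symCoeff_succ {𝕜 : Type*} [Field 𝕜] {ω : 𝕜} (hω : ∀ z : ℤ, ω + z ≠ 0) (n j : ℕ) :
    symCoeff ω n (j + 1) * (ω + 2 * n - 4 - 2 * j) = -symCoeff ω n j := by
  have h : ω + 2 * n - 4 - 2 * j ≠ 0 := by
    have := hω (2 * n - 4 - 2 * j)
    push_cast at this
    convert this using 1
    ring
  rw [symCoeff, div_mul_cancel₀ _ h]

namespace BrauerRep

variable {𝕜 : Type*} [Field 𝕜] {N : Type*} [DecidableEq N] [Fintype N] {A : Type*} [Ring A]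
  [Algebra 𝕜 A] {ω : 𝕜} (B : BrauerRep 𝕜 N A ω)

/-- The average of the permutations of `S`. -/
noncomputable def permSym (S : Finset N) : A :=
  (S.card.factorial : 𝕜)⁻¹ • ∑ g ∈ permsOn S, B.rho g

/-- The symmetriser of the Brauer algebra on the nodes in `S`. -/
noncomputable def brSym (S : Finset N) : A :=
  ∑ j ∈ Finset.range (S.card + 1), symCoeff ω S.card j • (B.matchSum j S * B.permSym S)

theorem rho_mul_permSym {g : Equiv.Perm N} {S : Finset N} (hg : g ∈ permsOn S) :
    B.rho g * B.permSym S = B.permSym S := by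
  rw [permSym, mul_smul_comm, Finset.mul_sum]
  congr 1
  refine Finset.sum_bij' (fun k _ => g * k) (fun k _ => g⁻¹ * k)
    (fun k hk => mul_mem_permsOn hg hk) (fun k hk => mul_mem_permsOn (inv_mem_permsOn hg) hk)
    (by simp) (by simp) (by simp)

theorem permSym_mul_rho {g : Equiv.Perm N} {S : Finset N} (hg : g ∈ permsOn S) :
    B.permSym S * B.rho g = B.permSym S := by
  rw [permSym, smul_mul_assoc, Finset.sum_mul]
  congr 1
  refine Finset.sum_bij' (fun k _ => k * g) (fun k _ => k * g⁻¹)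
    (fun k hk => mul_mem_permsOn hk hg) (fun k hk => mul_mem_permsOn hk (inv_mem_permsOn hg))
    (by simp) (by simp) (by simp)

theorem permSym_commute {S : Finset N} {X : A}
    (hX : ∀ g ∈ permsOn S, B.rho g * X = X * B.rho g) : B.permSym S * X = X * B.permSym S := by
  rw [permSym, smul_mul_assoc, mul_smul_comm, Finset.sum_mul, Finset.mul_sum]
  exact congrArg _ (Finset.sum_congr rfl hX)

theorem permSym_commute_eps {S : Finset N} {a b : N} (ha : a ∉ S) (hb : b ∉ S) :
    B.permSym S * B.eps a b = B.eps a b * B.permSym S :=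
  B.permSym_commute fun g hg => by
    rw [B.conj, mem_permsOn.1 hg a ha, mem_permsOn.1 hg b hb]

theorem permSym_commute_matchSum (S : Finset N) (j : ℕ) :
    B.permSym S * B.matchSum j S = B.matchSum j S * B.permSym S :=
  B.permSym_commute fun _ hg => B.rho_mul_matchSum_of_map_eq (map_eq_of_mem_permsOn hg) j

theorem op_permSym (S : Finset N) : B.op.permSym S = MulOpposite.op (B.permSym S) := by
  rw [permSym, permSym, MulOpposite.op_smul, Finset.op_sum]
  congr 1
  exact Finset.sum_bij' (fun k _ => k⁻¹) (fun k _ => k⁻¹) (fun k hk => inv_mem_permsOn hk)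
    (fun k hk => inv_mem_permsOn hk) (by simp) (by simp) (by simp [op_rho])

/-- The matching sums commute with `permSym`, so the symmetriser is invariant under reversal of
products. Statements about multiplication on the right thus follow from those on the left. -/
theorem op_brSym (S : Finset N) : B.op.brSym S = MulOpposite.op (B.brSym S) := by
  rw [brSym, brSym, Finset.op_sum]
  refine Finset.sum_congr rfl fun j _ => ?_
  rw [op_matchSum, op_permSym, MulOpposite.op_smul, ← permSym_commute_matchSum,
    MulOpposite.op_mul]

theorem rho_mul_brSym {g : Equiv.Perm N} {S : Finset N} (hg : g ∈ permsOn S) :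
    B.rho g * B.brSym S = B.brSym S := by
  rw [brSym, Finset.mul_sum]
  refine Finset.sum_congr rfl fun j _ => ?_
  rw [mul_smul_comm, ← mul_assoc, B.rho_mul_matchSum_of_map_eq (map_eq_of_mem_permsOn hg),
    mul_assoc, B.rho_mul_permSym hg]

theorem brSym_mul_rho {g : Equiv.Perm N} {S : Finset N} (hg : g ∈ permsOn S) :
    B.brSym S * B.rho g = B.brSym S := by
  rw [brSym, Finset.sum_mul]
  refine Finset.sum_congr rfl fun j _ => ?_
  rw [smul_mul_assoc, mul_assoc, B.permSym_mul_rho hg]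

theorem permSym_empty : B.permSym ∅ = 1 := by
  simp [permSym, permsOn_empty]

theorem permSym_insert {S : Finset N} {v : N} (hv : v ∉ S) :
    B.permSym (insert v S) = ((S.card : 𝕜) + 1)⁻¹ •
      ((1 + ∑ c ∈ S, B.rho (Equiv.swap v c)) * B.permSym S) := by
  rw [permSym, permSym, permsOn_insert_sum hv, Finset.card_insert_of_notMem hv,
    Nat.factorial_succ, Finset.sum_insert hv, mul_smul_comm, smul_smul, Equiv.swap_self]
  congr 1
  · push_cast
    rw [mul_inv]
  · rw [add_mul, one_mul, Finset.sum_mul]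
    simp only [map_mul, Finset.mul_sum]
    congr 1
    exact Finset.sum_congr rfl fun g _ => by
      change B.rho 1 * _ = _
      rw [map_one, one_mul]

variable [CharZero 𝕜]

theorem permSym_mul {S : Finset N} {X : A} (hX : ∀ g ∈ permsOn S, B.rho g * X = X) :
    B.permSym S * X = X := by
  rw [permSym, smul_mul_assoc, Finset.sum_mul, Finset.sum_congr rfl hX, Finset.sum_const,
    card_permsOn, ← Nat.cast_smul_eq_nsmul 𝕜, smul_smul, inv_mul_cancel₀, one_smul]
  exact_mod_cast Nat.factorial_ne_zero _

theorem mul_permSym {S : Finset N} {X : A} (hX : ∀ g ∈ permsOn S, X * B.rho g = X) :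
    X * B.permSym S = X := by
  rw [permSym, mul_smul_comm, Finset.mul_sum, Finset.sum_congr rfl hX, Finset.sum_const,
    card_permsOn, ← Nat.cast_smul_eq_nsmul 𝕜, smul_smul, inv_mul_cancel₀, one_smul]
  exact_mod_cast Nat.factorial_ne_zero _

theorem brSym_empty : B.brSym ∅ = 1 := by
  simp [brSym, permSym_empty, matchSum_zero, symCoeff]

variable {B}

/-- By `eps_mul_matchSum_insert_mul` each term produces matchings with `j` and with `j - 1` pairs on
the remaining nodes. The recursion of `symCoeff` is what makes neighbouring terms cancel, and the
last one vanishes for want of nodes. -/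
theorem eps_mul_brSym (hω : ∀ z : ℤ, ω + z ≠ 0) {S : Finset N} {a b : N} (ha : a ∈ S)
    (hb : b ∈ S) : B.eps a b * B.brSym S = 0 := by
  rcases eq_or_ne a b with rfl | hab
  · rw [B.eps_self, zero_mul]
  obtain ⟨S', rfl, ha', hb'⟩ : ∃ S', S = insert a (insert b S') ∧ a ∉ S' ∧ b ∉ S' := by
    refine ⟨(S.erase a).erase b, ?_, by simp, by simp⟩
    rw [Finset.insert_erase (by simp [hb, hab.symm]), Finset.insert_erase ha]
  have hab' : a ∉ insert b S' := by simp [ha', hab]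
  set S := insert a (insert b S') with hS
  have hcard : S.card = S'.card + 2 := by
    rw [hS, Finset.card_insert_of_notMem hab', Finset.card_insert_of_notMem hb']
  have key : ∀ n, ∑ j ∈ Finset.range (n + 1),
      symCoeff ω S.card j • (B.eps a b * B.matchSum j S * B.permSym S) =
      symCoeff ω S.card n • (B.eps a b * B.matchSum n S' * B.permSym S) := by
    intro n
    induction n with
    | zero => simp [matchSum_zero]
    | succ n ih =>
      rw [Finset.sum_range_succ, ih, hS, B.eps_mul_matchSum_insert_mul n hab ha' hb'
        (fun c hc => B.rho_mul_permSym (swap_mem_permsOn (by simp) (by simp [hc])))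
        (fun c hc => B.rho_mul_permSym (swap_mem_permsOn (by simp) (by simp [hc]))), ← hS,
        smul_add, smul_smul, ← add_assoc, ← add_smul]
      have : ω + 2 * (S'.card : 𝕜) - 2 * n = ω + 2 * (S.card : 𝕜) - 4 - 2 * n := by
        rw [hcard]; push_cast; ring
      rw [this, symCoeff_succ hω, add_neg_cancel, zero_smul, zero_add]
  rw [brSym, Finset.mul_sum]
  simp only [mul_smul_comm, ← mul_assoc]
  rw [key, B.matchSum_eq_zero (by omega)]
  simp

theorem brSym_mul_eps (hω : ∀ z : ℤ, ω + z ≠ 0) {S : Finset N} {a b : N} (ha : a ∈ S)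
    (hb : b ∈ S) : B.brSym S * B.eps a b = 0 := by
  have := eps_mul_brSym (B := B.op) hω ha hb
  rw [op_brSym, op_eps, ← MulOpposite.op_mul] at this
  exact MulOpposite.op_injective this

theorem matchSum_mul_brSym (hω : ∀ z : ℤ, ω + z ≠ 0) {S T : Finset N} (h : T ⊆ S) (j : ℕ) :
    B.matchSum (j + 1) T * B.brSym S = 0 := by
  rw [matchSum, smul_mul_assoc, Finset.sum_mul, Finset.sum_eq_zero, smul_zero]
  intro a ha
  rw [Finset.sum_mul]
  refine Finset.sum_eq_zero fun b hb => ?_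
  rw [B.eps_mul_matchSum (by simp) (by simp), mul_assoc, eps_mul_brSym hω (h ha) (h hb), mul_zero]

theorem brSym_mul_matchSum (hω : ∀ z : ℤ, ω + z ≠ 0) {S T : Finset N} (h : T ⊆ S) (j : ℕ) :
    B.brSym S * B.matchSum (j + 1) T = 0 := by
  rw [matchSum, mul_smul_comm, Finset.mul_sum, Finset.sum_eq_zero, smul_zero]
  intro a ha
  rw [Finset.mul_sum]
  refine Finset.sum_eq_zero fun b hb => ?_
  rw [← mul_assoc, brSym_mul_eps hω (h ha) (h hb), zero_mul]

theorem permSym_mul_brSym {S T : Finset N} (h : T ⊆ S) :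
    B.permSym T * B.brSym S = B.brSym S :=
  B.permSym_mul fun _ hg => B.rho_mul_brSym (permsOn_mono h hg)

theorem brSym_mul_brSym (hω : ∀ z : ℤ, ω + z ≠ 0) {S T : Finset N} (h : T ⊆ S) :
    B.brSym T * B.brSym S = B.brSym S := by
  conv_lhs => rw [brSym]
  rw [Finset.sum_mul, Finset.sum_range_succ', Finset.sum_eq_zero, matchSum_zero, one_mul,
    smul_mul_assoc, permSym_mul_brSym h, symCoeff, one_smul, zero_add]
  intro j _
  rw [smul_mul_assoc, mul_assoc, permSym_mul_brSym h, matchSum_mul_brSym hω h, smul_zero]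

/-- Recursion for the Brauer symmetriser. -/
theorem brSym_insert (hω : ∀ z : ℤ, ω + z ≠ 0) {S : Finset N} {v : N} (hv : v ∉ S) :
    B.brSym (insert v S) = B.brSym S *
      (1 - (ω + 2 * S.card - 2)⁻¹ • ∑ a ∈ S, B.eps v a) * B.permSym (insert v S) := by
  have hc : (insert v S).card = S.card + 1 := Finset.card_insert_of_notMem hv
  -- A matching with at least two pairs has a pair inside `S`, which `B.brSym S` annihilates. So
  -- only the terms with no pair and with one pair survive.
  have hz : ∀ j, B.brSym S * B.matchSum (j + 2) (insert v S) = 0 := by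
    intro j
    rw [B.matchSum_insert _ hv, mul_add, brSym_mul_matchSum hω subset_rfl, zero_add,
      Finset.mul_sum]
    refine Finset.sum_eq_zero fun a ha => ?_
    rw [B.eps_mul_matchSum (by simp [hv]) (by simp), ← mul_assoc,
      brSym_mul_matchSum hω (Finset.erase_subset _ _), zero_mul]
  rw [← brSym_mul_brSym hω (Finset.subset_insert v S)]
  conv_lhs => arg 2; rw [brSym]
  rw [Finset.mul_sum, hc, Finset.sum_range_succ']
  have h1 : ∑ j ∈ Finset.range (S.card + 1), B.brSym S * symCoeff ω (S.card + 1) (j + 1) •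
      (B.matchSum (j + 1) (insert v S) * B.permSym (insert v S)) =
      -((ω + 2 * S.card - 2)⁻¹ • (B.brSym S * (∑ a ∈ S, B.eps v a) *
        B.permSym (insert v S))) := by
    rw [Finset.sum_range_succ', Finset.sum_eq_zero, B.matchSum_insert _ hv]
    · rw [zero_add, mul_smul_comm, add_mul, mul_add, ← mul_assoc, brSym_mul_matchSum hω subset_rfl,
        zero_mul, zero_add, ← neg_smul]
      simp only [matchSum_zero, mul_one, symCoeff, mul_assoc]
      rw [zero_add]
      congr 1
      push_cast
      rw [neg_div, one_div]
      congr 2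
      ring
    · intro j _
      rw [mul_smul_comm, ← mul_assoc, hz, zero_mul, smul_zero]
  rw [h1, matchSum_zero, one_mul, symCoeff, one_smul, mul_sub, sub_mul, mul_one, mul_smul_comm,
    smul_mul_assoc]
  abel

theorem eps_mul_eps_mul_eps {a b c : N} (hab : a ≠ b) (hac : a ≠ c) (hbc : b ≠ c) :
    B.eps a b * B.eps b c * B.eps a b = B.eps a b := by
  rw [B.mul_left a b c hab hac hbc, B.eps_symm b c, B.eps_symm a b, mul_assoc,
    B.mul_left c b a hbc.symm hac.symm hab.symm, Equiv.swap_comm c a, ← mul_assoc,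
    rho_swap_mul_rho_swap, one_mul]

theorem eps_mul_swap_mul_eps {a b c : N} (hab : a ≠ b) (hac : a ≠ c) (hbc : b ≠ c) :
    B.eps a b * B.rho (Equiv.swap a c) * B.eps a b = B.eps a b := by
  rw [← B.mul_right a b c hab hac hbc, eps_mul_eps_mul_eps hab hac hbc]

theorem eps_mul_permSym {S : Finset N} {a b : N} (ha : a ∉ S) (hb : b ∉ S) :
    B.eps a b * B.permSym S = B.permSym S * B.eps a b := (B.permSym_commute_eps ha hb).symm

theorem eps_mul_brSym_comm {S : Finset N} {a b : N} (ha : a ∉ S) (hb : b ∉ S) :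
    B.eps a b * B.brSym S = B.brSym S * B.eps a b := by
  rw [brSym, Finset.mul_sum, Finset.sum_mul]
  refine Finset.sum_congr rfl fun j _ => ?_
  rw [mul_smul_comm, smul_mul_assoc, ← mul_assoc, B.eps_mul_matchSum ha hb, mul_assoc,
    eps_mul_permSym ha hb, mul_assoc]

/-- The partial trace of the Brauer symmetriser. -/
theorem eps_mul_brSym_insert_mul_eps (hω : ∀ z : ℤ, ω + z ≠ 0) {S : Finset N} {v x : N}
    (hv : v ∉ S) (hx : x ∉ S) (hvx : v ≠ x) :
    B.eps v x * B.brSym (insert v S) * B.eps v x =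
      ((ω + S.card - 2) * (ω + 2 * S.card) / ((S.card + 1) * (ω + 2 * S.card - 2))) •
        (B.brSym S * B.eps v x) := by
  have ne : ∀ {z w : N}, z ∉ S → w ∈ S → z ≠ w := fun hz hw h => hz (h ▸ hw)
  have e1 : ∀ b ∈ S, B.eps v x * B.rho (Equiv.swap v b) * B.eps v x = B.eps v x := fun b hb =>
    eps_mul_swap_mul_eps hvx (ne hv hb) (ne hx hb)
  have e2 : ∀ a ∈ S, B.eps v x * B.eps v a * B.eps v x = B.eps v x := fun a ha => by
    rw [B.eps_symm v x, eps_mul_eps_mul_eps hvx.symm (ne hx ha) (ne hv ha)]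
  -- For `a ≠ b` one has `ε_{va} s_{vb} = s_{vb} ε_{ba}`, and `ε_{ba}` reaches `B.brSym S` and is
  -- annihilated.
  have e3 : ∀ a ∈ S, ∀ b ∈ S, B.brSym S *
      (B.eps v x * (B.eps v a * B.rho (Equiv.swap v b)) * B.eps v x) =
      if a = b then B.brSym S * B.eps v x else 0 := by
    intro a ha b hb
    split_ifs with hab
    · rw [hab, B.mul_swap, e2 b hb]
    · have h := B.conj (Equiv.swap v b) b a
      rw [Equiv.swap_apply_right, Equiv.swap_apply_of_ne_of_ne (ne hv ha).symm hab] at h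
      have h' : B.eps v x * (B.rho (Equiv.swap v b) * B.eps b a) * B.eps v x =
          B.eps v x * B.rho (Equiv.swap v b) * B.eps v x * B.eps b a := by
        simp only [mul_assoc]
        rw [B.eps_comm b a v x (ne hv hb).symm (ne hx hb).symm (ne hv ha).symm (ne hx ha).symm]
      rw [← h, h', e1 b hb, ← mul_assoc, ← eps_mul_brSym_comm hv hx, mul_assoc,
        brSym_mul_eps hω hb ha, mul_zero]
  -- With `n = S.card`: the product of the units gives `ω`, the transpositions give `n`, the
  -- contractions `n`, and the mixed products another `n` from the diagonal `a = b`.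
  have e4 : B.brSym S * (B.eps v x * ((1 - (ω + 2 * S.card - 2)⁻¹ • ∑ a ∈ S, B.eps v a) *
      (1 + ∑ c ∈ S, B.rho (Equiv.swap v c))) * B.eps v x) =
      (ω + S.card - (ω + 2 * S.card - 2)⁻¹ * (2 * S.card)) • (B.brSym S * B.eps v x) := by
    simp only [sub_mul, mul_add, mul_sub, add_mul, one_mul, mul_one, smul_mul_assoc,
      mul_smul_comm, Finset.mul_sum, Finset.sum_mul]
    have s1 : ∑ b ∈ S, B.brSym S * (B.eps v x * B.rho (Equiv.swap v b) * B.eps v x) =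
        ∑ b ∈ S, B.brSym S * B.eps v x := Finset.sum_congr rfl fun b hb => by rw [e1 b hb]
    have s2 : ∑ b ∈ S, B.brSym S * (B.eps v x * B.eps v b * B.eps v x) =
        ∑ b ∈ S, B.brSym S * B.eps v x := Finset.sum_congr rfl fun b hb => by rw [e2 b hb]
    rw [B.eps_sq, Finset.sum_sub_distrib, ← Finset.smul_sum, s1, s2,
      Finset.sum_congr rfl fun b hb => Finset.sum_congr rfl fun a ha => e3 a ha b hb]
    simp only [Finset.sum_ite_eq', Finset.sum_ite_mem, Finset.inter_self, Finset.sum_const,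
      mul_smul_comm, ← Nat.cast_smul_eq_nsmul 𝕜]
    module
  have hc : ω + 2 * (S.card : 𝕜) - 2 ≠ 0 := by
    have := hω (2 * S.card - 2)
    push_cast at this
    convert this using 1
    ring
  have hn : (S.card : 𝕜) + 1 ≠ 0 := Nat.cast_add_one_ne_zero _
  rw [brSym_insert hω hv, B.permSym_insert hv]
  calc _ = ((S.card : 𝕜) + 1)⁻¹ • (B.brSym S * (B.eps v x *
        ((1 - (ω + 2 * S.card - 2)⁻¹ • ∑ a ∈ S, B.eps v a) *
        (1 + ∑ c ∈ S, B.rho (Equiv.swap v c))) * B.eps v x) * B.permSym S) := by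
        simp only [mul_smul_comm, smul_mul_assoc, mul_assoc]
        rw [← eps_mul_permSym hv hx, ← mul_assoc (B.eps v x) (B.brSym S),
          eps_mul_brSym_comm hv hx, mul_assoc (B.brSym S)]
    _ = _ := by
        rw [e4, smul_mul_assoc, mul_assoc (B.brSym S), eps_mul_permSym hv hx,
          ← mul_assoc (B.brSym S), B.mul_permSym fun g hg => B.brSym_mul_rho hg, smul_smul]
        congr 1
        rw [eq_div_iff (mul_ne_zero hn hc)]
        generalize hd : ω + 2 * (S.card : 𝕜) - 2 = d at hc
        field_simp
        rw [← hd]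
        ring

end BrauerRep
-- Closing up by contractions on the left and signs on the right
namespace BrauerRep

variable {𝕜 : Type*} [Field 𝕜] {N : Type*} [DecidableEq N] [Fintype N] {A : Type*} [Ring A]
  [Algebra 𝕜 A] {ω : 𝕜} {B : BrauerRep 𝕜 N A ω}

theorem rho_mul_permSym_map (B : BrauerRep 𝕜 N A ω) (g : Equiv.Perm N) (S : Finset N) :
    B.rho g * B.permSym S = B.permSym (S.map g.toEmbedding) * B.rho g := by
  rw [permSym, permSym, mul_smul_comm, smul_mul_assoc, Finset.card_map, Finset.mul_sum,
    Finset.sum_mul]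
  congr 1
  refine Finset.sum_bij' (fun k _ => g * k * g⁻¹) (fun k _ => g⁻¹ * k * g) ?_ ?_ ?_ ?_ ?_
  · intro k hk
    rw [mem_permsOn] at hk ⊢
    intro x hx
    simp only [Equiv.Perm.mul_apply]
    rw [hk]
    · simp
    exact fun h => hx (Finset.mem_map.2 ⟨_, h, by simp⟩)
  · intro k hk
    rw [mem_permsOn] at hk ⊢
    intro x hx
    simp only [Equiv.Perm.mul_apply]
    rw [hk]
    · simp
    intro h
    obtain ⟨y, hy, hxy⟩ := Finset.mem_map.1 h
    exact hx (g.injective hxy ▸ hy)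
  · intro k _
    group
  · intro k _
    group
  · intro k _
    rw [← map_mul, ← map_mul]
    congr 1
    group

/-- Exchanging the first ends of the two arcs yields the same pair of arcs as exchanging their
second ends. -/
theorem eps_mul_eps_mul_swap {a b c d : N} (hab : a ≠ b) (hac : a ≠ c) (had : a ≠ d) (hbc : b ≠ c)
    (hbd : b ≠ d) (hcd : c ≠ d) :
    B.eps a b * B.eps c d * B.rho (Equiv.swap a c) =
      B.eps a b * B.eps c d * B.rho (Equiv.swap b d) := by
  rw [mul_assoc, Equiv.swap_comm a c, ← B.mul_right c d a hcd hac.symm had.symm, ← mul_assoc,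
    B.eps_comm a b c d hac had hbc hbd, mul_assoc, B.eps_symm d a, B.eps_symm a b,
    B.mul_right b a d hab.symm hbd had, mul_assoc]

/-- `Q` on the left and `V` on the right realise the pairing of each node `a` of `T` with a
partner `p a`: closing with `Q` contracts `a` and `p a`, and `V` changes sign under their
exchange. -/
structure IsPairing (B : BrauerRep 𝕜 N A ω) (T : Finset N) (p : N → N) (Q V : A) : Prop where
  notMem : ∀ a ∈ T, p a ∉ T
  mul_eps : ∀ a ∈ T, Q * B.eps a (p a) = ω • Q
  mul_swap : ∀ a ∈ T, ∀ b ∈ T, a ≠ b →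
    Q * B.rho (Equiv.swap a b * Equiv.swap (p a) (p b)) = Q
  swap_mul : ∀ a ∈ T, ∀ b ∈ T, a ≠ b →
    B.rho (Equiv.swap a b * Equiv.swap (p a) (p b)) * V = V
  neg_mul : ∀ a ∈ T, B.rho (Equiv.swap a (p a)) * V = -V

namespace IsPairing

variable {T : Finset N} {p : N → N} {Q V : A}

theorem ne (hQ : B.IsPairing T p Q V) {a b : N} (ha : a ∈ T) (hb : b ∈ T) : p a ≠ b :=
  fun h => hQ.notMem a ha (h ▸ hb)

/-- Up to the factor `ω`, `Q` emits a contraction of `v` with its partner, which passes `X` and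
meets `U`; `V` emits their transposition with a sign, which passes `Y`. So `U` may be replaced by
whatever agrees with it between the two. -/
theorem flip (hQ : B.IsPairing T p Q V) (hω : ω ≠ 0) {v : N} (hv : v ∈ T) {X U W Y : A}
    (hX : B.eps v (p v) * X = X * B.eps v (p v))
    (hY : B.rho (Equiv.swap v (p v)) * Y = Y * B.rho (Equiv.swap v (p v)))
    (hU : B.eps v (p v) * U * B.rho (Equiv.swap v (p v)) = B.eps v (p v) * W) :
    Q * (X * U * Y) * V = -(Q * (X * W * Y) * V) := by
  have key : ∀ U' : A, ω • (Q * (X * U' * Y) * V) = Q * X * (B.eps v (p v) * U') * (Y * V) := by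
    intro U'
    have h1 : Q * X * (B.eps v (p v) * U') = Q * B.eps v (p v) * X * U' := by
      simp only [mul_assoc]
      rw [← mul_assoc X, ← hX, mul_assoc]
    rw [h1, hQ.mul_eps v hv]
    simp only [smul_mul_assoc, mul_assoc]
  have h2 : Y * V = -(B.rho (Equiv.swap v (p v)) * (Y * V)) := by
    rw [← mul_assoc, hY, mul_assoc, hQ.neg_mul v hv, mul_neg, neg_neg]
  have h3 : ω • (Q * (X * U * Y) * V) = ω • -(Q * (X * W * Y) * V) := by
    rw [key, h2, smul_neg, key, ← hU]
    simp only [mul_assoc, mul_neg]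
  have := congrArg (fun z => ω⁻¹ • z) h3
  simpa only [smul_smul, inv_mul_cancel₀ hω, one_smul] using this

/-- A transposition of two nodes together with that of their partners is absorbed by `Q` and by `V`,
so everything between may be conjugated by it. -/
theorem conj_eq (hQ : B.IsPairing T p Q V) {a b : N} (ha : a ∈ T) (hb : b ∈ T) (hab : a ≠ b)
    {X Y : A} (h : B.rho (Equiv.swap a b * Equiv.swap (p a) (p b)) * X =
      Y * B.rho (Equiv.swap a b * Equiv.swap (p a) (p b))) : Q * X * V = Q * Y * V := by
  conv_lhs => rw [← hQ.mul_swap a ha b hb hab]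
  rw [mul_assoc Q, h, ← mul_assoc, mul_assoc _ _ V, hQ.swap_mul a ha b hb hab]

theorem swap_apply (hQ : B.IsPairing T p Q V) {a b x : N} (ha : a ∈ T) (hb : b ∈ T) (hx : x ∈ T) :
    (Equiv.swap a b * Equiv.swap (p a) (p b)) x = Equiv.swap a b x := by
  rw [Equiv.Perm.mul_apply, Equiv.swap_apply_of_ne_of_ne (hQ.ne ha hx).symm (hQ.ne hb hx).symm]

theorem map_eq (hQ : B.IsPairing T p Q V) {a b : N} (ha : a ∈ T) (hb : b ∈ T) {S : Finset N}
    (hS : S ⊆ T) : S.map (Equiv.swap a b * Equiv.swap (p a) (p b)).toEmbedding =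
      S.map (Equiv.swap a b).toEmbedding := by
  rw [Finset.map_eq_image, Finset.map_eq_image]
  exact Finset.image_congr fun x hx => hQ.swap_apply ha hb (hS hx)

theorem map_swap_erase {a b : N} {T : Finset N} (ha : a ∈ T) (hb : b ∈ T) :
    (T.erase a).map (Equiv.swap a b).toEmbedding = T.erase b := by
  rw [Finset.map_erase, map_eq_of_mem_permsOn (swap_mem_permsOn ha hb)]
  simp

/-- A product closed up by `Q` and `V` vanishes if its factors commute with `ε` resp. the
transposition of a pair of matched nodes. -/
theorem off_eq_zero (hQ : B.IsPairing T p Q V) [CharZero 𝕜] (hω : ω ≠ 0) {v : N} (hv : v ∈ T)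
    {X Y : A}
    (hX : B.eps v (p v) * X = X * B.eps v (p v))
    (hY : B.rho (Equiv.swap v (p v)) * Y = Y * B.rho (Equiv.swap v (p v))) :
    Q * (X * Y) * V = 0 := by
  have h := hQ.flip hω hv (U := 1) (W := 1) hX hY (by rw [mul_one, B.mul_swap])
  rw [mul_one] at h
  have h2 : (2 : 𝕜) • (Q * (X * Y) * V) = 0 := by
    rw [two_smul]
    nth_rw 1 [h]
    simp
  simpa using h2

/-- Next to the contraction of `v` with its partner, `s_{vc}` and `ε_{vc}` differ only by the
exchange of these two nodes, which costs a sign by `flip`. -/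
theorem swap_eq_neg_eps (hQ : B.IsPairing T p Q V) (hω : ω ≠ 0) {v c : N} (hv : v ∈ T) (hc : c ∈ T)
    (hvc : v ≠ c) {X Y : A}
    (hX : B.eps v (p v) * X = X * B.eps v (p v))
    (hY : B.rho (Equiv.swap v (p v)) * Y = Y * B.rho (Equiv.swap v (p v))) :
    Q * (X * B.rho (Equiv.swap v c) * Y) * V = -(Q * (X * B.eps v c * Y) * V) := by
  refine hQ.flip hω hv hX hY ?_
  rw [← B.mul_right v (p v) c (hQ.ne hv hv).symm hvc (hQ.ne hv hc), mul_assoc]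
  have h := B.conj (Equiv.swap v (p v)) v c
  rw [Equiv.swap_apply_left, Equiv.swap_apply_of_ne_of_ne hvc.symm (hQ.ne hv hc).symm] at h
  rw [← h, ← mul_assoc, B.mul_swap]

/-- The contraction of `v` with its partner turns `ε_{va}` into a transposition that moves the
partner. The exchange of `v` and its partner then interchanges the roles of `a` and `c`. -/
theorem eps_swap_eq_neg (hQ : B.IsPairing T p Q V) (hω : ω ≠ 0) {v a c : N} (hv : v ∈ T)
    (ha : a ∈ T) (hc : c ∈ T) (hva : v ≠ a) (hvc : v ≠ c) (hac : a ≠ c) {X Y : A}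
    (hX : B.eps v (p v) * X = X * B.eps v (p v))
    (hY : B.rho (Equiv.swap v (p v)) * Y = Y * B.rho (Equiv.swap v (p v))) :
    Q * (X * (B.eps v a * B.rho (Equiv.swap v c)) * Y) * V =
      -(Q * (X * (B.eps v c * B.rho (Equiv.swap v a)) * Y) * V) := by
  refine hQ.flip hω hv hX hY ?_
  rw [← mul_assoc, ← mul_assoc, B.mul_right' (hQ.ne hv hv).symm hva (hQ.ne hv ha),
    B.mul_right' (hQ.ne hv hv).symm hvc (hQ.ne hv hc), mul_assoc, mul_assoc, mul_assoc]
  simp only [← map_mul]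
  have h : Equiv.swap (p v) a * (Equiv.swap v c * Equiv.swap v (p v)) =
      Equiv.swap v (p v) * (Equiv.swap (p v) c * Equiv.swap v a) := by
    have hpa := hQ.ne hv ha
    have hpc := hQ.ne hv hc
    have hpv := hQ.ne hv hv
    have e1 : Equiv.swap v (p v) * Equiv.swap v a = Equiv.swap (p v) a * Equiv.swap v (p v) := by
      rw [Equiv.mul_swap_eq_swap_mul, Equiv.swap_apply_left,
        Equiv.swap_apply_of_ne_of_ne hva.symm hpa.symm]
    have e2 : Equiv.swap v (p v) * Equiv.swap (p v) c = Equiv.swap v c * Equiv.swap v (p v) := by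
      rw [Equiv.mul_swap_eq_swap_mul, Equiv.swap_apply_right,
        Equiv.swap_apply_of_ne_of_ne hvc.symm hpc.symm]
    have e3 : Equiv.swap (p v) a * Equiv.swap v c = Equiv.swap v c * Equiv.swap (p v) a := by
      rw [Equiv.mul_swap_eq_swap_mul, Equiv.swap_apply_of_ne_of_ne hpv.symm hva,
        Equiv.swap_apply_of_ne_of_ne hpc.symm hac.symm]
    rw [← mul_assoc (Equiv.swap v (p v)), e2, mul_assoc, e1, ← mul_assoc, e3, mul_assoc]
  rw [h, map_mul, ← mul_assoc, B.mul_swap]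

/-- The expression equals its own negative: `s_{vc}` becomes `-ε_{vc}`, and as `Y` absorbs `s_{cd}`,
the product `ε_{cd} ε_{vc} Y` is again `ε_{cd} s_{vc} Y`. -/
theorem eps_mul_swap_eq_zero (hQ : B.IsPairing T p Q V) [CharZero 𝕜] (hω : ω ≠ 0) {v c d : N}
    (hv : v ∈ T) (hc : c ∈ T)
    (hd : d ∈ T) (hvc : v ≠ c) (hvd : v ≠ d) (hcd : c ≠ d) {X Y : A}
    (hX : B.eps v (p v) * X = X * B.eps v (p v))
    (hY : B.rho (Equiv.swap v (p v)) * Y = Y * B.rho (Equiv.swap v (p v)))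
    (hYc : B.rho (Equiv.swap c d) * Y = Y) :
    Q * (X * B.eps c d * B.rho (Equiv.swap v c) * Y) * V = 0 := by
  have hX' : B.eps v (p v) * (X * B.eps c d) = X * B.eps c d * B.eps v (p v) := by
    rw [← mul_assoc, hX, mul_assoc,
      B.eps_comm _ _ _ _ hvc hvd (hQ.ne hv hc) (hQ.ne hv hd), mul_assoc]
  have h := hQ.swap_eq_neg_eps hω hv hc hvc hX' hY
  have h1 : X * B.eps c d * B.eps v c * Y = X * B.eps c d * B.rho (Equiv.swap v c) * Y := by
    have h3 : Equiv.swap c d * Equiv.swap d v = Equiv.swap v c * Equiv.swap c d := by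
      rw [Equiv.mul_swap_eq_swap_mul, Equiv.swap_apply_right,
        Equiv.swap_apply_of_ne_of_ne hvc hvd, Equiv.swap_comm]
    rw [B.eps_symm v c, mul_assoc X, B.eps_symm c d, B.mul_right d c v hcd.symm hvd.symm hvc.symm,
      ← B.mul_swap d c, mul_assoc (B.eps d c), ← map_mul, Equiv.swap_comm d c, h3, map_mul,
      mul_assoc, mul_assoc, mul_assoc (B.rho _), hYc, ← mul_assoc, Equiv.swap_comm c d,
      B.mul_swap]
    simp only [mul_assoc]
  rw [h1] at h
  have h2 : (2 : 𝕜) • (Q * (X * B.eps c d * B.rho (Equiv.swap v c) * Y) * V) = 0 := by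
    rw [two_smul]
    nth_rw 1 [h]
    simp
  simpa using h2

end IsPairing
end BrauerRep
namespace BrauerRep

variable {𝕜 : Type*} [Field 𝕜] {N : Type*} [DecidableEq N] [Fintype N] {A : Type*} [Ring A]
  [Algebra 𝕜 A] {ω : 𝕜} {B : BrauerRep 𝕜 N A ω}

theorem swap_mul_matchSum {a b : N} {S : Finset N} (ha : a ∉ S) (hb : b ∉ S) (j : ℕ) :
    B.rho (Equiv.swap a b) * B.matchSum j S = B.matchSum j S * B.rho (Equiv.swap a b) :=
  B.rho_mul_matchSum_of_map_eq (map_swap_eq_of_notMem ha hb) j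

theorem swap_mul_permSym {a b : N} {S : Finset N} (ha : a ∉ S) (hb : b ∉ S) :
    B.rho (Equiv.swap a b) * B.permSym S = B.permSym S * B.rho (Equiv.swap a b) := by
  rw [rho_mul_permSym_map, map_swap_eq_of_notMem ha hb]

theorem matchSum_of_mem [CharZero 𝕜] {S : Finset N} {c : N} (hc : c ∈ S) (j : ℕ) :
    B.matchSum (j + 1) S = B.matchSum (j + 1) (S.erase c) +
      ∑ d ∈ S.erase c, B.eps c d * B.matchSum j ((S.erase c).erase d) := by
  rw [← B.matchSum_insert j (Finset.notMem_erase c S), Finset.insert_erase hc]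

namespace IsPairing

variable {T S : Finset N} {p : N → N} {Q V : A} [CharZero 𝕜]

/-- Matchings in which `c` has a partner contribute nothing by `eps_mul_swap_eq_zero`; in the others
the transposition turns into `-ε_{vc}`. -/
theorem matchSum_swap (hω : ω ≠ 0) {v c : N} (hv : v ∉ S) (hQ : B.IsPairing (insert v S) p Q V)
    (hc : c ∈ S) (j : ℕ) :
    Q * (B.matchSum j S * B.rho (Equiv.swap v c) * B.permSym S) * V =
      -(Q * (B.eps v c * B.matchSum j (S.erase c) * B.permSym S) * V) := by
  have hvT := Finset.mem_insert_self v S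
  have hcT : c ∈ insert v S := Finset.mem_insert_of_mem hc
  have hp : p v ∉ S := fun h => hQ.notMem v hvT (Finset.mem_insert_of_mem h)
  have hvc : v ≠ c := fun h => hv (h ▸ hc)
  have hh := swap_mul_permSym (B := B) hv hp
  have key : ∀ j, Q * (B.matchSum j (S.erase c) * B.rho (Equiv.swap v c) * B.permSym S) * V =
      -(Q * (B.eps v c * B.matchSum j (S.erase c) * B.permSym S) * V) := by
    intro j
    rw [hQ.swap_eq_neg_eps hω hvT hcT hvc
      (B.eps_mul_matchSum (by simp [hv]) (by simp [hp]) j) hh,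
      B.eps_mul_matchSum (by simp [hv]) (by simp) j]
  cases j with
  | zero => simpa [matchSum_zero] using key 0
  | succ j =>
    have hS := matchSum_of_mem (B := B) hc j
    rw [hS, add_mul, add_mul, mul_add, add_mul, key, Finset.sum_mul, Finset.sum_mul,
      Finset.mul_sum, Finset.sum_mul, Finset.sum_eq_zero, add_zero]
    intro d hd
    obtain ⟨hdc, hd⟩ := Finset.mem_erase.1 hd
    rw [B.eps_mul_matchSum (by simp) (by simp)]
    refine hQ.eps_mul_swap_eq_zero hω hvT hcT (Finset.mem_insert_of_mem hd) hvc
      (fun h => hv (h ▸ hd)) hdc.symm (B.eps_mul_matchSum (by simp [hv]) (by simp [hp]) _) hh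
      (B.rho_mul_permSym (swap_mem_permsOn hc hd))

/-- Flipping `v` interchanges `a` and `c` with a sign, while conjugation by the transposition of
`a`, `c` and their partners interchanges them without one. -/
theorem eps_matchSum_swap (hω : ω ≠ 0) {v a c : N} (hv : v ∉ S)
    (hQ : B.IsPairing (insert v S) p Q V) (ha : a ∈ S) (hc : c ∈ S) (hac : a ≠ c) (j : ℕ) :
    Q * (B.eps v a * B.matchSum j ((S.erase a).erase c) * B.rho (Equiv.swap v c) * B.permSym S) * V
      = 0 := by
  have hvT := Finset.mem_insert_self v S
  have haT : a ∈ insert v S := Finset.mem_insert_of_mem ha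
  have hcT : c ∈ insert v S := Finset.mem_insert_of_mem hc
  have hp : p v ∉ S := fun h => hQ.notMem v hvT (Finset.mem_insert_of_mem h)
  have hvc : v ≠ c := fun h => hv (h ▸ hc)
  have hva : v ≠ a := fun h => hv (h ▸ ha)
  have h1 := hQ.eps_swap_eq_neg hω hvT haT hcT hva hvc hac
    (B.eps_mul_matchSum (by simp [hv]) (by simp [hp]) j : B.eps v (p v) *
      B.matchSum j ((S.erase a).erase c) = _) (swap_mul_permSym (B := B) hv hp)
  set g := Equiv.swap a c * Equiv.swap (p a) (p c) with hg
  have gv : g v = v := by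
    rw [hQ.swap_apply haT hcT hvT, Equiv.swap_apply_of_ne_of_ne hva hvc]
  have ga : g a = c := by rw [hQ.swap_apply haT hcT haT, Equiv.swap_apply_left]
  have gc : g c = a := by rw [hQ.swap_apply haT hcT hcT, Equiv.swap_apply_right]
  have gE : B.rho g * B.matchSum j ((S.erase a).erase c) =
      B.matchSum j ((S.erase a).erase c) * B.rho g := by
    refine B.rho_mul_matchSum_of_map_eq ?_ j
    rw [hQ.map_eq haT hcT (((Finset.erase_subset _ _).trans (Finset.erase_subset _ _)).trans
      (Finset.subset_insert _ _)), map_swap_eq_of_notMem (by simp) (by simp)]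
  have gh : B.rho g * B.permSym S = B.permSym S * B.rho g := by
    rw [rho_mul_permSym_map, hQ.map_eq haT hcT (Finset.subset_insert _ _),
      map_eq_of_mem_permsOn (swap_mem_permsOn ha hc)]
  have gs : B.rho g * B.rho (Equiv.swap v c) = B.rho (Equiv.swap v a) * B.rho g := by
    rw [← map_mul, Equiv.mul_swap_eq_swap_mul, gv, gc, map_mul]
  have ge : B.rho g * B.eps v a = B.eps v c * B.rho g := by rw [B.conj, gv, ga]
  have h2 : Q * (B.matchSum j ((S.erase a).erase c) * (B.eps v a * B.rho (Equiv.swap v c)) *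
      B.permSym S) * V = Q * (B.matchSum j ((S.erase a).erase c) *
        (B.eps v c * B.rho (Equiv.swap v a)) * B.permSym S) * V := by
    refine hQ.conj_eq haT hcT hac ?_
    rw [← hg]
    simp only [mul_assoc]
    rw [← gh, ← mul_assoc, gE, mul_assoc, ← mul_assoc (B.rho g), ge, mul_assoc,
      ← mul_assoc (B.rho g), gs, mul_assoc]
  rw [← h2] at h1
  have h3 : (2 : 𝕜) • (Q * (B.matchSum j ((S.erase a).erase c) * (B.eps v a *
      B.rho (Equiv.swap v c)) * B.permSym S) * V) = 0 := by
    rw [two_smul]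
    nth_rw 1 [h1]
    simp
  rw [B.eps_mul_matchSum (by simp [hv]) (by simp), mul_assoc (B.matchSum _ _)]
  simpa using h3

/-- The unit and `c = a` contribute one copy each. Any other `c` must be matched, to `d` say; then
`s_{vc}` acts like `s_{ad}`, which `permSym` absorbs. A matching with `j` pairs has `2j` such nodes.
-/
theorem eps_matchSum_erase_swap (hω : ω ≠ 0) {v a : N} (hv : v ∉ S)
    (hQ : B.IsPairing (insert v S) p Q V) (ha : a ∈ S) (j : ℕ) :
    Q * (B.eps v a * B.matchSum j (S.erase a) * (1 + ∑ c ∈ S, B.rho (Equiv.swap v c)) *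
      B.permSym S) * V =
      (2 * (j + 1 : 𝕜)) • (Q * (B.eps v a * B.matchSum j (S.erase a) * B.permSym S) * V) := by
  have hva : v ≠ a := fun h => hv (h ▸ ha)
  have h0 : B.eps v a * B.matchSum j (S.erase a) * B.rho (Equiv.swap v a) =
      B.eps v a * B.matchSum j (S.erase a) := by
    rw [mul_assoc, ← swap_mul_matchSum (by simp [hv]) (by simp), ← mul_assoc, B.mul_swap]
  have h1 : ∑ c ∈ S.erase a, Q * (B.eps v a * B.matchSum j (S.erase a) *
      B.rho (Equiv.swap v c) * B.permSym S) * V =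
      (2 * j : 𝕜) • (Q * (B.eps v a * B.matchSum j (S.erase a) * B.permSym S) * V) := by
    cases j with
    | zero =>
      rw [Finset.sum_eq_zero]
      · simp
      intro c hc
      obtain ⟨hca, hc⟩ := Finset.mem_erase.1 hc
      simpa [matchSum_zero] using eps_matchSum_swap hω hv hQ ha hc hca.symm 0
    | succ j =>
      rw [← smul_mul_assoc, ← mul_smul_comm, ← smul_mul_assoc, ← mul_smul_comm, Nat.cast_succ,
        ← B.sum_eps_mul_matchSum_erase, Finset.mul_sum, Finset.sum_mul, Finset.mul_sum,
        Finset.sum_mul]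
      refine Finset.sum_congr rfl fun c hc => ?_
      have hS := matchSum_of_mem (B := B) hc j
      obtain ⟨hca, hc'⟩ := Finset.mem_erase.1 hc
      have hvc : v ≠ c := fun h => hv (h ▸ hc')
      rw [hS, mul_add, add_mul, add_mul, mul_add, add_mul,
        eps_matchSum_swap hω hv hQ ha hc' hca.symm, zero_add]
      simp only [Finset.mul_sum, Finset.sum_mul]
      refine Finset.sum_congr rfl fun d hd => ?_
      obtain ⟨hdc, hd⟩ := Finset.mem_erase.1 hd
      obtain ⟨hda, hd'⟩ := Finset.mem_erase.1 hd
      have hvd : v ≠ d := fun h => hv (h ▸ hd')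
      congr 2
      have e1 : B.eps v a * (B.eps c d * B.matchSum j (((S.erase a).erase c).erase d)) =
          B.matchSum j (((S.erase a).erase c).erase d) * (B.eps v a * B.eps c d) := by
        rw [B.eps_mul_matchSum (by simp) (by simp), ← mul_assoc,
          B.eps_mul_matchSum (by simp [hv]) (by simp), mul_assoc]
      rw [e1, mul_assoc _ _ (B.rho _),
        eps_mul_eps_mul_swap hva hvc hvd hca.symm hda.symm hdc.symm, mul_assoc, mul_assoc,
        B.rho_mul_permSym (swap_mem_permsOn ha hd')]
      simp only [mul_assoc]
  rw [← Finset.add_sum_erase _ _ ha]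
  simp only [mul_add, add_mul, mul_one, Finset.mul_sum, Finset.sum_mul]
  rw [h0, h1]
  module

theorem card_smul_star (hω : ω ≠ 0) {v : N} (hv : v ∉ S)
    (hQ : B.IsPairing (insert v S) p Q V) (j : ℕ) :
    (S.card + 1 : 𝕜) • (Q * ((∑ a ∈ S, B.eps v a * B.matchSum j (S.erase a)) *
      B.permSym (insert v S)) * V) =
      (2 * (j + 1 : 𝕜)) • (Q * ((∑ a ∈ S, B.eps v a * B.matchSum j (S.erase a)) *
        B.permSym S) * V) := by
  have hn : (S.card + 1 : 𝕜) ≠ 0 := Nat.cast_add_one_ne_zero _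
  rw [B.permSym_insert hv, mul_smul_comm, mul_smul_comm, smul_mul_assoc, smul_smul,
    mul_inv_cancel₀ hn, one_smul, ← mul_assoc (∑ a ∈ S, _), Finset.sum_mul, Finset.sum_mul, Finset.mul_sum,
    Finset.sum_mul, Finset.sum_mul, Finset.mul_sum, Finset.sum_mul, Finset.smul_sum]
  exact Finset.sum_congr rfl fun a ha => eps_matchSum_erase_swap hω hv hQ ha j

theorem card_smul_matchSum (hω : ω ≠ 0) {v : N} (hv : v ∉ S)
    (hQ : B.IsPairing (insert v S) p Q V) (j : ℕ) :
    (S.card + 1 : 𝕜) • (Q * (B.matchSum j S * B.permSym (insert v S)) * V) =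
      -(Q * ((∑ a ∈ S, B.eps v a * B.matchSum j (S.erase a)) * B.permSym S) * V) := by
  have hn : (S.card + 1 : 𝕜) ≠ 0 := Nat.cast_add_one_ne_zero _
  have hvT := Finset.mem_insert_self v S
  have hp : p v ∉ S := fun h => hQ.notMem v hvT (Finset.mem_insert_of_mem h)
  rw [B.permSym_insert hv, mul_smul_comm, mul_smul_comm, smul_mul_assoc, smul_smul,
    mul_inv_cancel₀ hn, one_smul]
  simp only [mul_add, add_mul, one_mul, Finset.mul_sum, Finset.sum_mul]
  rw [hQ.off_eq_zero hω hvT (B.eps_mul_matchSum hv hp j) (swap_mul_permSym hv hp), zero_add,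
    ← Finset.sum_neg_distrib]
  refine Finset.sum_congr rfl fun c hc => ?_
  rw [← mul_assoc (B.matchSum j S), matchSum_swap hω hv hQ hc]

/-- An equivariant family has the same closed value at every node, by `conj_eq`. This replaces sums
over all nodes by the term at a single `v`. -/
theorem sum_const_of_conj (hQ : B.IsPairing T p Q V) {F : N → A}
    (hF : ∀ a ∈ T, ∀ b ∈ T, a ≠ b →
      B.rho (Equiv.swap a b * Equiv.swap (p a) (p b)) * F a =
        F b * B.rho (Equiv.swap a b * Equiv.swap (p a) (p b))) {v : N} (hv : v ∈ T) :
    Q * ((∑ a ∈ T, F a) * B.permSym T) * V =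
      (T.card : 𝕜) • (Q * (F v * B.permSym T) * V) := by
  rw [Finset.sum_mul, Finset.mul_sum, Finset.sum_mul, Nat.cast_smul_eq_nsmul, ← Finset.sum_const]
  refine Finset.sum_congr rfl fun a ha => ?_
  rcases eq_or_ne a v with rfl | hav
  · rfl
  refine hQ.conj_eq ha hv hav ?_
  rw [← mul_assoc, hF a ha v hv hav, mul_assoc, rho_mul_permSym_map,
    hQ.map_eq ha hv subset_rfl, map_eq_of_mem_permsOn (swap_mem_permsOn ha hv), mul_assoc]

/-- Fix `v` and let `Z` be the closed value of `∑ ε_{va} E_j(T \ {v, a})` with the symmetriser of `T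
\ v`. The sum of `E_j(T \ v)` over `v` counts each matching `T.card - 2j` times, and its closed
value is `-Z`. The sum over `v` of the matchings in which `v` is paired counts each `2(j + 1)`
times, and its closed value is `2(j + 1) Z`. Eliminating `Z` gives the recursion. -/
theorem matchSum_succ (hω : ω ≠ 0) (hT : T.Nonempty) (hQ : B.IsPairing T p Q V) (j : ℕ) :
    Q * (B.matchSum (j + 1) T * B.permSym T) * V =
      -((T.card - 2 * j : 𝕜) • (Q * (B.matchSum j T * B.permSym T) * V)) := by
  obtain ⟨v, hv⟩ := hT
  have hv' := Finset.notMem_erase v T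
  have hQ' := hQ
  rw [← Finset.insert_erase hv] at hQ'
  have hc : ((T.erase v).card + 1 : 𝕜) = T.card := by
    exact_mod_cast Finset.card_erase_add_one hv
  have h1 := card_smul_star hω hv' hQ' j
  have h2 := card_smul_matchSum hω hv' hQ' j
  rw [hc, Finset.insert_erase hv] at h1 h2
  have h3 := hQ.sum_const_of_conj (F := fun a => B.matchSum j (T.erase a)) (fun a ha b hb _ => by
    rw [rho_mul_matchSum, hQ.map_eq ha hb (Finset.erase_subset _ _), map_swap_erase ha hb]) hv
  have h4 := hQ.sum_const_of_conj
    (F := fun v => ∑ a ∈ T.erase v, B.eps v a * B.matchSum j ((T.erase v).erase a))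
    (fun a ha b hb _ => by
      set g := Equiv.swap a b * Equiv.swap (p a) (p b) with hg
      have hga : g a = b := by rw [hQ.swap_apply ha hb ha, Equiv.swap_apply_left]
      have hm : (T.erase a).map g.toEmbedding = T.erase b := by
        rw [hQ.map_eq ha hb (Finset.erase_subset _ _), map_swap_erase ha hb]
      rw [Finset.mul_sum, Finset.sum_mul, ← hm, Finset.sum_map]
      refine Finset.sum_congr rfl fun x _ => ?_
      rw [← mul_assoc, B.conj, mul_assoc, rho_mul_matchSum, Finset.map_erase, mul_assoc]
      simp only [Equiv.coe_toEmbedding, hga]) hv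
  rw [sum_matchSum_erase, smul_mul_assoc, mul_smul_comm, smul_mul_assoc, h2] at h3
  rw [sum_eps_mul_matchSum_erase, smul_mul_assoc, mul_smul_comm, smul_mul_assoc, h1] at h4
  have h5 : (2 * (j + 1 : 𝕜)) ≠ 0 := mul_ne_zero two_ne_zero (Nat.cast_add_one_ne_zero j)
  have h6 := congrArg (fun z => (2 * (j + 1 : 𝕜))⁻¹ • z) h4
  simp only [smul_smul, inv_mul_cancel₀ h5, one_smul] at h6
  rw [h6, h3, neg_neg]

/-- For odd `T.card` the factor `T.card - 2j` in `matchSum_succ` is never zero, so the vanishing of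
the matching sums for large `j` descends to `j = 0`. -/
theorem permSym_eq_zero (hω : ω ≠ 0) (hT : Odd T.card) (hQ : B.IsPairing T p Q V) :
    Q * B.permSym T * V = 0 := by
  have key : ∀ i j, T.card < 2 * (i + j) → Q * (B.matchSum j T * B.permSym T) * V = 0 := by
    intro i
    induction i with
    | zero =>
      intro j hj
      rw [B.matchSum_eq_zero (by omega), zero_mul, mul_zero, zero_mul]
    | succ i ih =>
      intro j hj
      have h := hQ.matchSum_succ hω (Finset.card_pos.1 hT.pos) j
      rw [ih (j + 1) (by omega), eq_comm, neg_eq_zero, smul_eq_zero] at h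
      refine h.resolve_left fun h0 => ?_
      obtain ⟨t, ht⟩ := hT
      rw [sub_eq_zero] at h0
      have : T.card = 2 * j := by exact_mod_cast h0
      omega
  simpa [matchSum_zero] using key T.card 0 (by have := hT.pos; omega)

/-- The Brauer symmetriser closes up to a multiple of the symmetriser of the symmetric group. -/
theorem brSym_eq (hω : ∀ z : ℤ, ω + z ≠ 0) (hQ : B.IsPairing T p Q V) :
    (ω + T.card - 2) • (Q * B.brSym T * V) = (ω + 2 * T.card - 2) • (Q * B.permSym T * V) := by
  rcases T.eq_empty_or_nonempty with rfl | hT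
  · simp [brSym_empty, permSym_empty]
  set L : ℕ → A := fun j => Q * (B.matchSum j T * B.permSym T) * V with hL
  have hω0 : ω ≠ 0 := by simpa using hω 0
  -- The partial sums telescope with an explicit remainder. At `n = 0` this reads `ω + T.card - 2 =
  -- (ω + 2 * T.card - 2) - T.card`, and at `n = T.card` the remainder contains a matching sum with
  -- too many pairs.
  have key : ∀ n, (ω + T.card - 2) • ∑ j ∈ Finset.range (n + 1), symCoeff ω T.card j • L j =
      (ω + 2 * T.card - 2) • L 0 - (symCoeff ω T.card n * (T.card - 2 * n)) • L n := by
    intro n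
    induction n with
    | zero =>
      simp only [zero_add, Finset.sum_range_one, symCoeff]
      push_cast
      module
    | succ n ih =>
      have h1 := hQ.matchSum_succ hω0 hT n
      have h2 := symCoeff_succ hω T.card n
      have h3 : (symCoeff ω T.card n * (T.card - 2 * n)) • L n =
          (symCoeff ω T.card (n + 1) * (ω + 2 * T.card - 4 - 2 * n)) • L (n + 1) := by
        rw [h2]
        simp only [hL]
        rw [h1, smul_neg, neg_smul, neg_neg, mul_smul]
      rw [Finset.sum_range_succ, smul_add, ih, h3]
      push_cast
      module
  have h := key T.card
  have hz : L T.card = 0 := by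
    simp only [hL]
    rw [B.matchSum_eq_zero (by have := hT.card_pos; omega), zero_mul, mul_zero, zero_mul]
  rw [hz, smul_zero, sub_zero] at h
  have h0 : L 0 = Q * B.permSym T * V := by simp [hL, matchSum_zero]
  rw [h0] at h
  rw [← h, brSym, Finset.mul_sum, Finset.sum_mul]
  simp only [hL, mul_smul_comm, smul_mul_assoc]

end IsPairing
end BrauerRep
-- Permutations acting simultaneously on strands and partners
theorem swap_mul_mem_permsOn {N : Type*} [DecidableEq N] [Fintype N] {S : Finset N} {v : N}
    {g : Equiv.Perm N} (hg : g ∈ permsOn (insert v S)) :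
    Equiv.swap v (g v) * g ∈ permsOn S := by
  rw [mem_permsOn] at hg ⊢
  intro x hx
  rw [Equiv.Perm.mul_apply]
  rcases eq_or_ne x v with rfl | hxv
  · rw [Equiv.swap_apply_right]
  · have hgx : g x = x := hg x (by simp [hx, hxv])
    rw [hgx, Equiv.swap_apply_of_ne_of_ne hxv]
    intro h
    rw [← hgx] at h
    exact hxv (g.injective h)

theorem permsOn_induction {N : Type*} [DecidableEq N] [Fintype N] {S : Finset N}
    {P : Equiv.Perm N → Prop} (h1 : P 1)
    (h2 : ∀ a ∈ S, ∀ b ∈ S, a ≠ b → ∀ g ∈ permsOn S, P g → P (Equiv.swap a b * g)) :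
    ∀ g ∈ permsOn S, P g := by
  suffices h : ∀ T, T ⊆ S → ∀ g ∈ permsOn T, P g from h S subset_rfl
  intro T
  induction T using Finset.induction_on with
  | empty =>
    intro _ g hg
    rw [permsOn_empty, Finset.mem_singleton] at hg
    exact hg ▸ h1
  | insert v T hv ih =>
    intro hT g hg
    have hT' := (Finset.subset_insert v T).trans hT
    have h3 := swap_mul_mem_permsOn hg
    rcases eq_or_ne v (g v) with h4 | h4
    · rw [← h4, Equiv.swap_self] at h3
      exact ih hT' g h3
    · have h5 := h2 v (hT (Finset.mem_insert_self v T)) (g v)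
        (hT (apply_mem_of_mem_permsOn hg (Finset.mem_insert_self v T))) h4 _
        (permsOn_mono hT' h3) (ih hT' _ h3)
      rwa [← mul_assoc, Equiv.swap_mul_self, one_mul] at h5

theorem exists_permsOn_map_eq {N : Type*} [DecidableEq N] [Fintype N] {S : Finset N}
    {l l' : List N} (hl : l.Nodup) (hlS : ∀ x ∈ l, x ∈ S) (hl' : l'.Nodup) (hlS' : ∀ x ∈ l', x ∈ S)
    (h : l.length = l'.length) : ∃ g ∈ permsOn S, l.map g = l' := by
  lift l to List {x // x ∈ S} using hlS
  lift l' to List {x // x ∈ S} using hlS'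
  obtain ⟨σ, rfl⟩ := exists_perm_map_eq (hl.of_map _) (hl'.of_map _) (by simpa using h)
  refine ⟨Equiv.Perm.ofSubtype σ,
    mem_permsOn.2 fun x hx => Equiv.Perm.ofSubtype_apply_of_not_mem σ hx, ?_⟩
  rw [List.map_map, List.map_map]
  exact List.map_congr_left fun x _ => Equiv.Perm.ofSubtype_apply_coe σ x

section Doubling

variable {N : Type*} [DecidableEq N] [Fintype N] {T : Finset N} {π : Equiv.Perm N}

/-- The permutation that acts like `g` both on a set of nodes and on its translate by `π`. -/
def dbl (π g : Equiv.Perm N) : Equiv.Perm N := g * (π * g * π⁻¹)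

theorem dbl_one : dbl π 1 = 1 := by simp [dbl]

theorem dbl_swap (a b : N) : dbl π (Equiv.swap a b) = Equiv.swap a b * Equiv.swap (π a) (π b) := by
  rw [dbl, Equiv.mul_swap_eq_swap_mul, mul_assoc, mul_inv_cancel, mul_one]

theorem translate_mem_permsOn {g : Equiv.Perm N} (hg : g ∈ permsOn T) {x : N} (hx : π⁻¹ x ∉ T) :
    (π * g * π⁻¹) x = x := by
  simp only [Equiv.Perm.mul_apply]
  rw [mem_permsOn.1 hg _ hx]
  simp

theorem inv_notMem (hT : ∀ a ∈ T, π a ∉ T) {x : N} (hx : x ∈ T) : π⁻¹ x ∉ T := fun h => by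
  have := hT _ h
  simp [hx] at this

/-- The two copies act on `T` and on its translate, which are disjoint, and therefore commute. -/
theorem dbl_mul (hT : ∀ a ∈ T, π a ∉ T) {g k : Equiv.Perm N} (hg : g ∈ permsOn T)
    (hk : k ∈ permsOn T) : dbl π (g * k) = dbl π g * dbl π k := by
  have hc : Commute (π * g * π⁻¹) k := by
    refine Equiv.Perm.Disjoint.commute fun x => ?_
    by_cases hx : x ∈ T
    · exact Or.inl (translate_mem_permsOn hg (inv_notMem hT hx))
    · exact Or.inr (mem_permsOn.1 hk x hx)
  calc _ = g * (k * (π * g * π⁻¹)) * (π * k * π⁻¹) := by simp only [dbl]; group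
    _ = _ := by
      rw [← hc.eq]
      simp only [dbl]
      group

theorem dbl_apply (hT : ∀ a ∈ T, π a ∉ T) {g : Equiv.Perm N} (hg : g ∈ permsOn T) {x : N}
    (hx : x ∈ T) : dbl π g x = g x := by
  rw [dbl, Equiv.Perm.mul_apply, translate_mem_permsOn hg (inv_notMem hT hx)]

theorem dbl_apply_translate (hT : ∀ a ∈ T, π a ∉ T) {g : Equiv.Perm N} (hg : g ∈ permsOn T)
    {x : N} (hx : x ∈ T) : dbl π g (π x) = π (g x) := by
  simp only [dbl, Equiv.Perm.mul_apply, Equiv.Perm.inv_def, Equiv.symm_apply_apply]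
  exact mem_permsOn.1 hg _ (hT _ (apply_mem_of_mem_permsOn hg hx))

end Doubling

namespace BrauerRep

variable {𝕜 : Type*} [Field 𝕜] {N : Type*} [DecidableEq N] [Fintype N] {A : Type*} [Ring A]
  [Algebra 𝕜 A] {ω : 𝕜} {B : BrauerRep 𝕜 N A ω} {T : Finset N} {π : Equiv.Perm N}

/-- It suffices to treat a transposition. Up to `ω ^ 2`, `Q` emits the contractions at `a` and `b`,
after which `s_{ab}` and the transposition of the partners agree; their product is then a square. -/
theorem mul_dbl_of_mul_eps (hω : ω ≠ 0) (hT : ∀ a ∈ T, π a ∉ T) {Q : A}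
    (hQ : ∀ a ∈ T, Q * B.eps a (π a) = ω • Q) {g : Equiv.Perm N} (hg : g ∈ permsOn T) :
    Q * B.rho (dbl π g) = Q := by
  refine permsOn_induction (P := fun g => Q * B.rho (dbl π g) = Q) ?_ ?_ g hg
  · rw [dbl_one, map_one, mul_one]
  · intro a ha b hb hab g hg ih
    rw [dbl_mul hT (swap_mem_permsOn ha hb) hg, map_mul, ← mul_assoc]
    suffices h : Q * B.rho (dbl π (Equiv.swap a b)) = Q by rw [h, ih]
    have h1 : ω • ω • Q = Q * (B.eps a (π a) * B.eps b (π b)) := by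
      rw [← mul_assoc, hQ a ha, smul_mul_assoc, hQ b hb]
    have ne : ∀ {x y}, x ∈ T → y ∈ T → x ≠ π y := fun hx hy h => hT _ hy (h ▸ hx)
    have h2 : ω • ω • (Q * B.rho (dbl π (Equiv.swap a b))) = ω • ω • Q := by
      rw [← smul_mul_assoc, ← smul_mul_assoc, h1, dbl_swap, map_mul, mul_assoc, ← mul_assoc
        (B.eps a (π a) * B.eps b (π b)), eps_mul_eps_mul_swap (ne ha ha) hab (ne ha hb)
        (ne hb ha).symm (fun h => hab (π.injective h)) (ne hb hb), mul_assoc (_ * _),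
        rho_swap_mul_rho_swap, mul_one]
    rw [smul_smul, smul_smul] at h2
    have h3 := congrArg (fun z => (ω * ω)⁻¹ • z) h2
    simpa only [smul_smul, inv_mul_cancel₀ (mul_ne_zero hω hω), one_smul] using h3

theorem swap_mul_of_eps_mul (hω : ω ≠ 0) {a b : N} {Y : A} (hY : B.eps a b * Y = ω • Y) :
    B.rho (Equiv.swap a b) * Y = Y := by
  have h : ω • (B.rho (Equiv.swap a b) * Y) = ω • Y := by
    rw [← mul_smul_comm, ← hY, ← mul_assoc, B.swap_mul]
  have h3 := congrArg (fun z => ω⁻¹ • z) h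
  simpa only [smul_smul, inv_mul_cancel₀ hω, one_smul] using h3

theorem dbl_mul_of_eps_mul (hω : ω ≠ 0) (hT : ∀ a ∈ T, π a ∉ T) {Y : A}
    (hY : ∀ a ∈ T, B.eps a (π a) * Y = ω • Y) {g : Equiv.Perm N} (hg : g ∈ permsOn T) :
    B.rho (dbl π g) * Y = Y := by
  have h := mul_dbl_of_mul_eps (B := B.op) (Q := MulOpposite.op Y) hω hT (fun a ha => by
    rw [op_eps, ← MulOpposite.op_mul, hY a ha, MulOpposite.op_smul]) hg
  rw [op_rho, ← MulOpposite.op_mul] at h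
  have h1 := MulOpposite.op_injective h
  conv_lhs => rw [← h1]
  rw [← mul_assoc, ← map_mul, mul_inv_cancel, map_one, one_mul]

theorem brSym_commute_of_map_eq {g : Equiv.Perm N} (h : T.map g.toEmbedding = T) :
    B.rho g * B.brSym T = B.brSym T * B.rho g := by
  rw [brSym, Finset.mul_sum, Finset.sum_mul]
  refine Finset.sum_congr rfl fun j _ => ?_
  rw [mul_smul_comm, smul_mul_assoc, ← mul_assoc, B.rho_mul_matchSum_of_map_eq h, mul_assoc,
    rho_mul_permSym_map, h, mul_assoc]

theorem map_dbl (hT : ∀ a ∈ T, π a ∉ T) {g : Equiv.Perm N} (hg : g ∈ permsOn T) :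
    T.map (dbl π g).toEmbedding = T := by
  rw [Finset.map_eq_image]
  conv_rhs => rw [← map_eq_of_mem_permsOn hg, Finset.map_eq_image]
  exact Finset.image_congr fun x hx => dbl_apply hT hg hx

theorem mul_brSym_mul_dbl (hω : ω ≠ 0) (hT : ∀ a ∈ T, π a ∉ T) {Q : A}
    (hQ : ∀ a ∈ T, Q * B.eps a (π a) = ω • Q) {g : Equiv.Perm N} (hg : g ∈ permsOn T) :
    Q * B.brSym T * B.rho (dbl π g) = Q * B.brSym T := by
  rw [mul_assoc, ← brSym_commute_of_map_eq (map_dbl hT hg), ← mul_assoc,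
    mul_dbl_of_mul_eps hω hT hQ hg]

theorem mul_permSym_mul_dbl (hω : ω ≠ 0) (hT : ∀ a ∈ T, π a ∉ T) {Q : A}
    (hQ : ∀ a ∈ T, Q * B.eps a (π a) = ω • Q) {g : Equiv.Perm N} (hg : g ∈ permsOn T) :
    Q * B.permSym T * B.rho (dbl π g) = Q * B.permSym T := by
  have h := rho_mul_permSym_map B (dbl π g) T
  rw [map_dbl hT hg] at h
  rw [mul_assoc, ← h, ← mul_assoc, mul_dbl_of_mul_eps hω hT hQ hg]

/-- The average of `W` over the doubled permutations of `T`. -/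
noncomputable def dblAvg (B : BrauerRep 𝕜 N A ω) (T : Finset N) (π : Equiv.Perm N) (W : A) : A :=
  (T.card.factorial : 𝕜)⁻¹ • ∑ g ∈ permsOn T, B.rho (dbl π g) * W

theorem mul_dblAvg [CharZero 𝕜] {X W : A} (hX : ∀ g ∈ permsOn T, X * B.rho (dbl π g) = X) :
    X * B.dblAvg T π W = X * W := by
  rw [dblAvg, mul_smul_comm, Finset.mul_sum, Finset.sum_congr rfl fun g hg => by
    rw [← mul_assoc, hX g hg], Finset.sum_const, card_permsOn, ← Nat.cast_smul_eq_nsmul 𝕜,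
    smul_smul, inv_mul_cancel₀, one_smul]
  exact_mod_cast Nat.factorial_ne_zero _

/-- Averaging supplies the invariance `swap_mul`, which `W` itself need not have. The signs survive
because doubled permutations carry matched pairs to matched pairs. By `mul_dblAvg` the average may
be replaced by `W` again behind `Q * B.brSym T` or `Q * B.permSym T`. -/
theorem isPairing_dblAvg (hω : ω ≠ 0) (hT : ∀ a ∈ T, π a ∉ T) {Q W : A}
    (hQ : ∀ a ∈ T, Q * B.eps a (π a) = ω • Q)
    (hW : ∀ a ∈ T, B.rho (Equiv.swap a (π a)) * W = -W) :
    B.IsPairing T π Q (B.dblAvg T π W) where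
  notMem := hT
  mul_eps := hQ
  mul_swap a ha b hb _ := by
    rw [← dbl_swap]
    exact mul_dbl_of_mul_eps hω hT hQ (swap_mem_permsOn ha hb)
  swap_mul a ha b hb _ := by
    have hs := swap_mem_permsOn ha hb
    rw [← dbl_swap, dblAvg, mul_smul_comm, Finset.mul_sum]
    congr 1
    refine Finset.sum_bij' (fun k _ => Equiv.swap a b * k) (fun k _ => Equiv.swap a b * k)
      (fun k hk => mul_mem_permsOn hs hk) (fun k hk => mul_mem_permsOn hs hk)
      (by simp) (by simp) ?_
    intro k hk
    rw [dbl_mul hT hs hk, map_mul, mul_assoc]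
  neg_mul a ha := by
    rw [dblAvg, mul_smul_comm, Finset.mul_sum, ← smul_neg, ← Finset.sum_neg_distrib]
    congr 1
    refine Finset.sum_congr rfl fun g hg => ?_
    have hb := apply_mem_of_mem_permsOn (inv_mem_permsOn hg) ha
    have h : Equiv.swap a (π a) * dbl π g = dbl π g * Equiv.swap (g⁻¹ a) (π (g⁻¹ a)) := by
      rw [Equiv.mul_swap_eq_swap_mul, dbl_apply hT hg hb, dbl_apply_translate hT hg hb]
      simp
    rw [← mul_assoc, ← map_mul, h, map_mul, mul_assoc, hW _ hb, mul_neg]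

theorem smul_mul_brSym_mul [CharZero 𝕜] (hω : ∀ z : ℤ, ω + z ≠ 0) (hT : ∀ a ∈ T, π a ∉ T) {Q W : A}
    (hQ : ∀ a ∈ T, Q * B.eps a (π a) = ω • Q)
    (hW : ∀ a ∈ T, B.rho (Equiv.swap a (π a)) * W = -W) :
    (ω + T.card - 2) • (Q * B.brSym T * W) = (ω + 2 * T.card - 2) • (Q * B.permSym T * W) := by
  have hω0 : ω ≠ 0 := by simpa using hω 0
  have h := (isPairing_dblAvg hω0 hT hQ hW).brSym_eq hω
  rwa [mul_dblAvg fun g hg => mul_brSym_mul_dbl hω0 hT hQ hg,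
    mul_dblAvg fun g hg => mul_permSym_mul_dbl hω0 hT hQ hg] at h

theorem mul_permSym_mul_eq_zero [CharZero 𝕜] (hω : ω ≠ 0) (hT : ∀ a ∈ T, π a ∉ T)
    (hodd : Odd T.card) {Q W : A}
    (hQ : ∀ a ∈ T, Q * B.eps a (π a) = ω • Q)
    (hW : ∀ a ∈ T, B.rho (Equiv.swap a (π a)) * W = -W) :
    Q * B.permSym T * W = 0 := by
  have h := (isPairing_dblAvg hω hT hQ hW).permSym_eq_zero hω hodd
  rwa [mul_dblAvg fun g hg => mul_permSym_mul_dbl hω hT hQ hg] at h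

end BrauerRep

/-! ### Words in the currents between contractions -/

namespace CurrentRep

variable {𝕜 : Type*} [Field 𝕜] {N : Type*} [DecidableEq N] [Fintype N] {A : Type*} [Ring A]
  [Algebra 𝕜 A] {ω : 𝕜} {C : CurrentRep 𝕜 N A ω} {M : Finset N} {π : Equiv.Perm N}

/-- The product `f[r_1]_{a_1} ⋯ f[r_n]_{a_n}`. -/
def fWord {R N A : Type*} [CommRing R] [DecidableEq N] [Ring A] [Algebra R A] {ω : R}
    (C : CurrentRep R N A ω) (w : List (ℤ × N)) : A :=
  (w.map fun x => C.f x.1 x.2).prod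

theorem fWord_nil : C.fWord [] = 1 := rfl

theorem fWord_cons (x : ℤ × N) (w : List (ℤ × N)) : C.fWord (x :: w) = C.f x.1 x.2 * C.fWord w :=
  rfl

theorem fWord_append (w w' : List (ℤ × N)) : C.fWord (w ++ w') = C.fWord w * C.fWord w' := by
  simp [fWord]

theorem eps_mul_fWord {w : List (ℤ × N)} {a b : N} (ha : a ∉ w.map Prod.snd)
    (hb : b ∉ w.map Prod.snd) : C.eps a b * C.fWord w = C.fWord w * C.eps a b := by
  induction w with
  | nil => simp [fWord_nil]
  | cons x w ih =>
    simp only [List.map_cons, List.mem_cons, not_or] at ha hb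
    rw [fWord_cons, ← mul_assoc, C.eps_f_comm _ _ _ _ (Ne.symm ha.1) (Ne.symm hb.1), mul_assoc,
      ih ha.2 hb.2, mul_assoc]

theorem rho_mul_fWord (g : Equiv.Perm N) (w : List (ℤ × N)) :
    C.rho g * C.fWord w = C.fWord (w.map fun x => (x.1, g x.2)) * C.rho g := by
  induction w with
  | nil => simp [fWord_nil]
  | cons x w ih =>
    rw [fWord_cons, ← mul_assoc, C.f_conj, mul_assoc, ih, List.map_cons, fWord_cons, mul_assoc]

theorem eps_mul_fWord_mul {w : List (ℤ × N)} {a b : N} (ha : a ∉ w.map Prod.snd)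
    (hb : b ∉ w.map Prod.snd) {Y : A} (hY : C.eps a b * Y = ω • Y) :
    C.eps a b * (C.fWord w * Y) = ω • (C.fWord w * Y) := by
  rw [← mul_assoc, eps_mul_fWord ha hb, mul_assoc, hY, mul_smul_comm]

theorem f_mul_of_eps_mul (hω : ω ≠ 0) {a b : N} {Y : A} (hY : C.eps a b * Y = ω • Y) (r : ℤ) :
    C.f r b * Y = -(C.f r a * Y) := by
  have h := congrArg (fun z => ω⁻¹ • (z * Y)) (C.f_eps r a b)
  simp only [mul_assoc, hY, zero_mul, smul_zero, mul_smul_comm, add_mul, smul_add, smul_smul,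
    inv_mul_cancel₀ hω, one_smul] at h
  exact (neg_eq_of_add_eq_zero_right h).symm

/-- The transposition moves the letter at `a` to the partner, where in front of the contraction it
is the negative of the original letter. The transposition itself is absorbed by the contraction. -/
theorem swap_mul_fWord_mul (hω : ω ≠ 0) (hM : ∀ a ∈ M, π a ∉ M) {w : List (ℤ × N)}
    (hw : (w.map Prod.snd).Nodup) (hwM : ∀ x ∈ w.map Prod.snd, x ∈ M) {Y : A} {a : N}
    (ha : a ∈ w.map Prod.snd) (hY : C.eps a (π a) * Y = ω • Y) :
    C.rho (Equiv.swap a (π a)) * (C.fWord w * Y) = -(C.fWord w * Y) := by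
  induction w with
  | nil => simp at ha
  | cons x w ih =>
    obtain ⟨r, x⟩ := x
    simp only [List.map_cons, List.nodup_cons] at hw
    simp only [List.map_cons, List.mem_cons, forall_eq_or_imp] at hwM ha
    rw [fWord_cons, mul_assoc, ← mul_assoc, C.f_conj]
    simp only
    rcases ha with rfl | ha
    · have h := eps_mul_fWord_mul hw.1 (fun h => hM _ hwM.1 (hwM.2 _ h)) hY
      rw [Equiv.swap_apply_left, mul_assoc, BrauerRep.swap_mul_of_eps_mul hω h,
        f_mul_of_eps_mul hω h]
    · rw [Equiv.swap_apply_of_ne_of_ne (fun h : x = a => hw.1 (h ▸ ha))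
        (fun h : x = π a => hM _ (hwM.2 _ ha) (h ▸ hwM.1)), mul_assoc, ih hw.2 hwM.2 ha, mul_neg]

/-- Doubled permutations are absorbed by `Q * C.brSym M` on the left and by `Y` on the right, so the
nodes of the word may be relabelled. -/
theorem mul_brSym_mul_fWord_map (hω : ω ≠ 0) (hM : ∀ a ∈ M, π a ∉ M)
    {Q Y : A} (hQ : ∀ a ∈ M, Q * C.eps a (π a) = ω • Q)
    (hY : ∀ a ∈ M, C.eps a (π a) * Y = ω • Y) {w : List (ℤ × N)}
    (hwM : ∀ x ∈ w.map Prod.snd, x ∈ M) {g : Equiv.Perm N} (hg : g ∈ permsOn M) :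
    Q * C.brSym M * C.fWord (w.map fun x => (x.1, g x.2)) * Y =
      Q * C.brSym M * C.fWord w * Y := by
  have h : C.fWord (w.map fun x => (x.1, g x.2)) * C.rho (dbl π g) =
      C.rho (dbl π g) * C.fWord w := by
    rw [rho_mul_fWord]
    congr 2
    refine List.map_congr_left fun x hx => ?_
    rw [dbl_apply hM hg (hwM _ (List.mem_map_of_mem hx))]
  conv_lhs => rw [← BrauerRep.dbl_mul_of_eps_mul hω hM hY hg]
  rw [mul_assoc (Q * C.brSym M), ← mul_assoc (C.fWord _), h, ← mul_assoc, ← mul_assoc,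
    BrauerRep.mul_brSym_mul_dbl hω hM hQ hg]

/-- Closed up words only depend on the sequence of the indices `r`. -/
theorem mul_brSym_mul_fWord_eq (hω : ω ≠ 0) (hM : ∀ a ∈ M, π a ∉ M)
    {Q Y : A} (hQ : ∀ a ∈ M, Q * C.eps a (π a) = ω • Q)
    (hY : ∀ a ∈ M, C.eps a (π a) * Y = ω • Y) {w w' : List (ℤ × N)}
    (hw : (w.map Prod.snd).Nodup) (hwM : ∀ x ∈ w.map Prod.snd, x ∈ M)
    (hw' : (w'.map Prod.snd).Nodup) (hwM' : ∀ x ∈ w'.map Prod.snd, x ∈ M)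
    (h : w.map Prod.fst = w'.map Prod.fst) :
    Q * C.brSym M * C.fWord w * Y = Q * C.brSym M * C.fWord w' * Y := by
  have hl : w.length = w'.length := by simpa using congrArg List.length h
  obtain ⟨g, hg, h2⟩ := exists_permsOn_map_eq hw hwM hw' hwM' (by simpa using hl)
  rw [← mul_brSym_mul_fWord_map hω hM hQ hY hwM hg]
  congr 3
  refine List.ext_getElem (by simpa using hl) fun i h3 h4 => ?_
  have e1 := List.getElem_of_eq h (i := i) (by simpa using h3)
  have e2 := List.getElem_of_eq h2 (i := i) (by simpa using h3)
  simp only [List.getElem_map] at e1 e2 ⊢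
  exact Prod.ext e1 e2

end CurrentRep
theorem map_snd_zip_sublist {α β : Type*} (l : List α) (l' : List β) :
    ((l.zip l').map Prod.snd).Sublist l' := by
  induction l generalizing l' with
  | nil => simp
  | cons a l ih =>
    cases l' with
    | nil => simp
    | cons b l' => simpa using ih l'

namespace CurrentRep

variable {𝕜 : Type*} [Field 𝕜] {N : Type*} [DecidableEq N] [Fintype N] {A : Type*} [Ring A]
  [Algebra 𝕜 A] {ω : 𝕜} {C : CurrentRep 𝕜 N A ω} {M : Finset N} {π : Equiv.Perm N}

/-- The right-hand side of the commutation relation is antisymmetric in `a` and `b`: the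
transposition exchanges the two currents, and the contraction annihilates their sum. -/
theorem f_mul_f_add (r t : ℤ) {a b : N} (hab : a ≠ b) (hrt : r + t ≠ 0) :
    C.f r a * C.f t b + C.f r b * C.f t a = C.f t b * C.f r a + C.f t a * C.f r b := by
  have h1 := C.f_comm r t a b hab hrt
  have h2 := C.f_comm r t b a hab.symm hrt
  have h3 := C.f_conj (Equiv.swap a b) (r + t) a
  have h4 := C.f_conj (Equiv.swap a b) (r + t) b
  rw [Equiv.swap_apply_left] at h3
  rw [Equiv.swap_apply_right] at h4
  have h5 := C.eps_f (r + t) a b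
  have h6 := C.f_eps (r + t) a b
  rw [Equiv.swap_comm b a, C.eps_symm b a] at h2
  rw [mul_add] at h5
  rw [add_mul] at h6
  have h7 : C.f r a * C.f t b - C.f t b * C.f r a + (C.f r b * C.f t a - C.f t a * C.f r b) =
      0 := by
    rw [h1, h2, sub_mul, sub_mul, mul_sub, mul_sub, h3, h4]
    calc _ = -(C.eps a b * C.f (r + t) a + C.eps a b * C.f (r + t) b) +
          (C.f (r + t) a * C.eps a b + C.f (r + t) b * C.eps a b) := by abel
      _ = 0 := by rw [h5, h6]; simp
  rw [← sub_eq_zero, ← h7]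
  abel

section Closure

variable [CharZero 𝕜]

/-- Interchanging the nodes `a` and `b` does not alter a closed word, so twice the word is the sum
over both labellings, in which neighbouring letters commute by `f_mul_f_add`. -/
theorem mul_brSym_mul_fWord_swap (hω : ω ≠ 0) (hM : ∀ a ∈ M, π a ∉ M) {Q Y : A}
    (hQ : ∀ a ∈ M, Q * C.eps a (π a) = ω • Q) (hY : ∀ a ∈ M, C.eps a (π a) * Y = ω • Y)
    {u z : List (ℤ × N)} {r t : ℤ} {a b : N} (hrt : r + t ≠ 0)
    (hw : ((u ++ (r, a) :: (t, b) :: z).map Prod.snd).Nodup)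
    (hwM : ∀ x ∈ (u ++ (r, a) :: (t, b) :: z).map Prod.snd, x ∈ M) :
    Q * C.brSym M * C.fWord (u ++ (r, a) :: (t, b) :: z) * Y =
      Q * C.brSym M * C.fWord (u ++ (t, a) :: (r, b) :: z) * Y := by
  have hab : a ≠ b := by
    simp only [List.map_append, List.map_cons, List.nodup_append, List.nodup_cons,
      List.mem_cons] at hw
    exact fun h => hw.2.1.1 (Or.inl h)
  have hperm : ((u ++ (r, a) :: (t, b) :: z).map Prod.snd).Perm
      ((u ++ (t, b) :: (r, a) :: z).map Prod.snd) :=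
    ((List.Perm.swap _ _ _).append_left u).map _
  have hw' := hperm.nodup_iff.1 hw
  have hwM' : ∀ x ∈ (u ++ (t, b) :: (r, a) :: z).map Prod.snd, x ∈ M :=
    fun x hx => hwM x (hperm.mem_iff.2 hx)
  simp only [List.map_append, List.map_cons] at hw hwM hw' hwM'
  have e1 : Q * C.brSym M * C.fWord (u ++ (r, a) :: (t, b) :: z) * Y =
      Q * C.brSym M * C.fWord (u ++ (r, b) :: (t, a) :: z) * Y :=
    mul_brSym_mul_fWord_eq hω hM hQ hY (by simpa using hw) (by simpa using hwM) (by simpa using hw')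
      (by simpa using hwM') (by simp)
  have e2 : Q * C.brSym M * C.fWord (u ++ (t, b) :: (r, a) :: z) * Y =
      Q * C.brSym M * C.fWord (u ++ (t, a) :: (r, b) :: z) * Y :=
    mul_brSym_mul_fWord_eq hω hM hQ hY (by simpa using hw') (by simpa using hwM')
      (by simpa using hw) (by simpa using hwM) (by simp)
  have e3 : Q * C.brSym M * C.fWord (u ++ (r, a) :: (t, b) :: z) * Y +
      Q * C.brSym M * C.fWord (u ++ (r, b) :: (t, a) :: z) * Y =
      Q * C.brSym M * C.fWord (u ++ (t, b) :: (r, a) :: z) * Y +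
      Q * C.brSym M * C.fWord (u ++ (t, a) :: (r, b) :: z) * Y := by
    simp only [fWord_append, fWord_cons]
    rw [← add_mul, ← add_mul, ← mul_add, ← mul_add, ← mul_add, ← mul_add,
      ← mul_assoc (C.f r a), ← mul_assoc (C.f r b), ← mul_assoc (C.f t b), ← mul_assoc (C.f t a),
      ← add_mul, ← add_mul, f_mul_f_add r t hab hrt]
  rw [← e1, e2, ← two_smul 𝕜, ← two_smul 𝕜] at e3
  have h3 := congrArg (fun z => (2 : 𝕜)⁻¹ • z) e3
  simpa only [smul_smul, inv_mul_cancel₀ (two_ne_zero (α := 𝕜)), one_smul] using h3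

/-- Closed up words are symmetric in the indices `r`. -/
theorem mul_brSym_mul_fWord_perm (hω : ω ≠ 0) (hM : ∀ a ∈ M, π a ∉ M) {Q Y : A}
    (hQ : ∀ a ∈ M, Q * C.eps a (π a) = ω • Q) (hY : ∀ a ∈ M, C.eps a (π a) * Y = ω • Y)
    {R R' : List ℤ} (hR : R.Perm R') (hneg : ∀ r ∈ R, r < 0) (u : List (ℤ × N)) (L : List N)
    (hL : (u.map Prod.snd ++ L).Nodup) (hLM : ∀ x ∈ u.map Prod.snd ++ L, x ∈ M)
    (hlen : R.length ≤ L.length) :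
    Q * C.brSym M * C.fWord (u ++ R.zip L) * Y = Q * C.brSym M * C.fWord (u ++ R'.zip L) * Y := by
  induction hR generalizing u L with
  | nil => rfl
  | @cons r R R' _ ih =>
    cases L with
    | nil => simp at hlen
    | cons a L =>
      have := ih (fun r hr => hneg r (List.mem_cons_of_mem _ hr)) (u ++ [(r, a)]) L
        (by simpa using hL) (by simpa using hLM) (by simpa using hlen)
      simpa using this
  | swap r t R =>
    match L, hlen with
    | a :: b :: L, _ =>
      simp only [List.zip_cons_cons]
      have hsub : ((u ++ (t, a) :: (r, b) :: R.zip L).map Prod.snd).Sublist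
          (u.map Prod.snd ++ (a :: b :: L)) := by
        simp only [List.map_append, List.map_cons]
        refine (List.Sublist.refl _).append (List.Sublist.cons_cons _ (List.Sublist.cons_cons _ ?_))
        exact map_snd_zip_sublist R L
      have h1 := hneg r (by simp)
      have h2 := hneg t (by simp)
      exact mul_brSym_mul_fWord_swap hω hM hQ hY (by omega) (hL.sublist hsub)
        fun x hx => hLM x (hsub.subset hx)
  | trans h1 h2 ih1 ih2 =>
    rw [ih1 hneg u L hL hLM hlen, ih2 (fun r hr => hneg r (h1.mem_iff.2 hr)) u L hL hLM
      (h1.length_eq ▸ hlen)]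

end Closure

/-- The strand `v` carries no letter, so the contraction in `Y` passes through the word and closes
the symmetriser to its partial trace. -/
theorem mul_eps_mul_brSym_insert [CharZero 𝕜] (hω : ∀ z : ℤ, ω + z ≠ 0) {S : Finset N} {v x : N}
    (hv : v ∉ S) (hx : x ∉ S) (hvx : v ≠ x) {w : List (ℤ × N)} (hw : ∀ y ∈ w.map Prod.snd, y ∈ S)
    (Q : A) {Y : A} (hY : C.eps v x * Y = ω • Y) :
    Q * C.eps v x * C.brSym (insert v S) * (C.fWord w * Y) =
      ((ω + S.card - 2) * (ω + 2 * S.card) / ((S.card + 1) * (ω + 2 * S.card - 2))) •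
        (Q * C.brSym S * (C.fWord w * Y)) := by
  have hω0 : ω ≠ 0 := by simpa using hω 0
  have h := eps_mul_fWord_mul (C := C) (w := w) (fun h => hv (hw _ h)) (fun h => hx (hw _ h)) hY
  set W := C.fWord w * Y with hW
  clear_value W
  have h1 : ω • (Q * C.eps v x * C.brSym (insert v S) * W) =
      Q * (C.eps v x * C.brSym (insert v S) * C.eps v x) * W := by
    simp only [mul_assoc, h, mul_smul_comm]
  rw [BrauerRep.eps_mul_brSym_insert_mul_eps hω hv hx hvx] at h1
  simp only [mul_assoc, smul_mul_assoc, mul_smul_comm, h] at h1 ⊢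
  rw [smul_comm] at h1
  have h2 := congrArg (fun z => ω⁻¹ • z) h1
  simpa only [smul_smul ω⁻¹ ω, inv_mul_cancel₀ hω0, one_smul] using h2

theorem smul_mul_brSym_mul_fWord [CharZero 𝕜] (hω : ∀ z : ℤ, ω + z ≠ 0) (hM : ∀ a ∈ M, π a ∉ M)
    {w : List (ℤ × N)} (hw : (w.map Prod.snd).Nodup) (hwM : ∀ x ∈ w.map Prod.snd, x ∈ M) {Q Y : A}
    (hQ : ∀ a ∈ w.map Prod.snd, Q * C.eps a (π a) = ω • Q)
    (hY : ∀ a ∈ w.map Prod.snd, C.eps a (π a) * Y = ω • Y) :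
    (ω + w.length - 2) • (Q * C.brSym (w.map Prod.snd).toFinset * (C.fWord w * Y)) =
      (ω + 2 * w.length - 2) • (Q * C.permSym (w.map Prod.snd).toFinset * (C.fWord w * Y)) := by
  have hω0 : ω ≠ 0 := by simpa using hω 0
  have h := BrauerRep.smul_mul_brSym_mul (B := C.toBrauerRep) (T := (w.map Prod.snd).toFinset)
    (π := π) (Q := Q) (W := C.fWord w * Y) hω
    (fun a ha h => hM a (hwM a (List.mem_toFinset.1 ha)) (hwM _ (List.mem_toFinset.1 h)))
    (fun a ha => hQ a (List.mem_toFinset.1 ha))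
    (fun a ha => swap_mul_fWord_mul hω0 hM hw hwM (List.mem_toFinset.1 ha)
      (hY a (List.mem_toFinset.1 ha)))
  rwa [List.toFinset_card_of_nodup hw, List.length_map] at h

theorem mul_permSym_mul_fWord_eq_zero [CharZero 𝕜] (hω : ω ≠ 0) (hM : ∀ a ∈ M, π a ∉ M)
    {w : List (ℤ × N)} (hw : (w.map Prod.snd).Nodup) (hwM : ∀ x ∈ w.map Prod.snd, x ∈ M) {Q Y : A}
    (hQ : ∀ a ∈ w.map Prod.snd, Q * C.eps a (π a) = ω • Q)
    (hY : ∀ a ∈ w.map Prod.snd, C.eps a (π a) * Y = ω • Y) (hodd : Odd w.length) :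
    Q * C.permSym (w.map Prod.snd).toFinset * (C.fWord w * Y) = 0 := by
  refine BrauerRep.mul_permSym_mul_eq_zero (B := C.toBrauerRep) (π := π) hω
    (fun a ha h => hM a (hwM a (List.mem_toFinset.1 ha)) (hwM _ (List.mem_toFinset.1 h))) ?_
    (fun a ha => hQ a (List.mem_toFinset.1 ha))
    (fun a ha => swap_mul_fWord_mul hω hM hw hwM (List.mem_toFinset.1 ha)
      (hY a (List.mem_toFinset.1 ha)))
  rwa [List.toFinset_card_of_nodup hw, List.length_map]

end CurrentRep
theorem eq_one_of_eq_smul {𝕜 V : Type*} [Field 𝕜] [AddCommGroup V] [Module 𝕜 V] {c : 𝕜} {x : V}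
    (hx : x ≠ 0) (h : x = c • x) : c = 1 := by
  have h' : (c - 1) • x = 0 := by rw [sub_smul, ← h, one_smul, sub_self]
  exact sub_eq_zero.1 ((smul_eq_zero.1 h').resolve_right hx)

/-! ### The nodes `1, …, m`, their partners and the contractions `q^{(k)}` -/

section Nodes

/-- The nodes `1, …, k`. -/
def nodes (m k : ℕ) : Finset (Fin (2 * m + 1)) :=
  Finset.univ.filter fun x => 1 ≤ (x : ℕ) ∧ (x : ℕ) ≤ k

variable {m k : ℕ}

theorem mem_nodes {x : Fin (2 * m + 1)} : x ∈ nodes m k ↔ 1 ≤ (x : ℕ) ∧ (x : ℕ) ≤ k := by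
  simp [nodes]

theorem val_node {a : ℕ} (ha : a ≤ 2 * m) : (node m a : ℕ) = a := by
  rw [node_eq (Nat.lt_succ_of_le ha)]

theorem node_mem_nodes {a : ℕ} (ha : a ≤ 2 * m) : node m a ∈ nodes m k ↔ 1 ≤ a ∧ a ≤ k := by
  rw [mem_nodes, val_node ha]

theorem nodes_mono {l : ℕ} (h : k ≤ l) : nodes m k ⊆ nodes m l := fun x hx => by
  rw [mem_nodes] at hx ⊢
  omega

theorem nodes_succ (hk : k + 1 ≤ 2 * m) : nodes m (k + 1) = insert (node m (k + 1)) (nodes m k) := by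
  ext x
  rw [Finset.mem_insert, mem_nodes, mem_nodes, Fin.ext_iff, val_node hk]
  omega

theorem card_nodes (hk : k ≤ 2 * m) : (nodes m k).card = k := by
  induction k with
  | zero =>
    rw [Finset.card_eq_zero, Finset.eq_empty_iff_forall_notMem]
    intro x hx
    rw [mem_nodes] at hx
    omega
  | succ k ih =>
    rw [nodes_succ hk, Finset.card_insert_of_notMem, ih (by omega)]
    rw [node_mem_nodes hk]
    omega

/-- The translation of the nodes by `m`. -/
def partner (m : ℕ) : Equiv.Perm (Fin (2 * m + 1)) := Equiv.addRight (node m m)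

theorem partner_node {a : ℕ} (ha : a ≤ m) : partner m (node m a) = node m (m + a) := by
  apply Fin.ext
  rw [partner, Equiv.coe_addRight, Fin.val_add, val_node (by omega), val_node (by omega),
    val_node (by omega), Nat.mod_eq_of_lt (by omega), add_comm]

theorem partner_notMem : ∀ a ∈ nodes m m, partner m a ∉ nodes m m := fun a ha h => by
  rw [mem_nodes] at ha
  rw [← node_val a, partner_node ha.2, node_mem_nodes (by omega)] at h
  omega

/-- The nodes `1, …, m` in increasing order. -/
def nodeList (m : ℕ) : List (Fin (2 * m + 1)) := (List.range' 1 m).map (node m)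

theorem length_nodeList : (nodeList m).length = m := by simp [nodeList]

theorem mem_nodeList {x : Fin (2 * m + 1)} : x ∈ nodeList m ↔ x ∈ nodes m m := by
  rw [nodeList, List.mem_map, mem_nodes]
  constructor
  · rintro ⟨a, ha, rfl⟩
    rw [List.mem_range'_1] at ha
    rw [val_node (by omega)]
    omega
  · exact fun h => ⟨x, List.mem_range'_1.2 (by omega), node_val x⟩

theorem nodup_nodeList : (nodeList m).Nodup := by
  refine List.Nodup.map_on ?_ (List.nodup_range')
  intro x hx y hy h
  rw [List.mem_range'_1] at hx hy
  exact (node_inj (by omega) (by omega)).1 h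

theorem map_snd_zip_nodeList {R : List ℤ} (hR : R.length ≤ m) :
    (R.zip (nodeList m)).map Prod.snd = (List.range' 1 R.length).map (node m) := by
  refine List.ext_getElem (by simp [length_nodeList, hR]) fun i h1 h2 => ?_
  simp [nodeList]

theorem toFinset_map_snd_zip_nodeList {R : List ℤ} (hR : R.length ≤ m) :
    ((R.zip (nodeList m)).map Prod.snd).toFinset = nodes m R.length := by
  ext x
  rw [map_snd_zip_nodeList hR, List.mem_toFinset, List.mem_map, mem_nodes]
  constructor
  · rintro ⟨a, ha, rfl⟩
    rw [List.mem_range'_1] at ha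
    rw [val_node (by omega)]
    omega
  · exact fun h => ⟨x, List.mem_range'_1.2 (by omega), node_val x⟩

end Nodes

section Contractions

variable {R : Type*} [CommRing R] (ω : R) {m : ℕ}

theorem q_succ (hm : 1 ≤ m) {k : ℕ} (hk : k + 1 ≤ m) :
    q ω m (k + 1) = q ω m k * epsN ω (node m (k + 1)) (partner m (node m (k + 1))) := by
  rw [q, List.range'_1_concat, List.map_append, List.prod_append, q, partner_node (by omega),
    ← ee_eq ω hm (by omega) (by omega) (by omega)]
  simp [add_comm]

theorem epsN_partner_commute (hm : 1 ≤ m) {a b : Fin (2 * m + 1)} (ha : a ∈ nodes m m)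
    (hb : b ∈ nodes m m) : Commute (epsN ω a (partner m a)) (epsN ω b (partner m b)) := by
  rcases eq_or_ne a b with rfl | hab
  · exact Commute.refl _
  · exact epsN_comm ω hm _ _ _ _ hab (fun h => partner_notMem b hb (h ▸ ha))
      (fun h => partner_notMem a ha (h ▸ hb)) (fun h => hab ((partner m).injective h))

theorem q_commute (hm : 1 ≤ m) {k : ℕ} (hk : k ≤ m) {a : Fin (2 * m + 1)} (ha : a ∈ nodes m m) :
    Commute (epsN ω a (partner m a)) (q ω m k) := by
  induction k with
  | zero => exact Commute.one_right _
  | succ k ih =>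
    rw [q_succ ω hm hk]
    exact (ih (by omega)).mul_right
      (epsN_partner_commute ω hm ha ((node_mem_nodes (by omega)).2 (by omega)))

theorem q_mul_epsN (hm : 1 ≤ m) {k : ℕ} (hk : k ≤ m) {a : Fin (2 * m + 1)} (ha : a ∈ nodes m k) :
    q ω m k * epsN ω a (partner m a) = ω • q ω m k := by
  induction k with
  | zero =>
    rw [mem_nodes] at ha
    omega
  | succ k ih =>
    have ham : a ∈ nodes m m := nodes_mono hk ha
    rw [nodes_succ (by omega), Finset.mem_insert] at ha
    rw [q_succ ω hm hk]
    rcases ha with rfl | ha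
    · rw [mul_assoc, epsN_sq ω hm, mul_smul_comm]
    · rw [mul_assoc, (epsN_partner_commute ω hm ham
        ((node_mem_nodes (by omega)).2 (by omega))).symm.eq, ← mul_assoc, ih (by omega) ha,
        smul_mul_assoc]

theorem epsN_mul_q (hm : 1 ≤ m) {k : ℕ} (hk : k ≤ m) {a : Fin (2 * m + 1)} (ha : a ∈ nodes m k) :
    epsN ω a (partner m a) * q ω m k = ω • q ω m k := by
  rw [(q_commute ω hm hk (nodes_mono hk ha)).eq, q_mul_epsN ω hm hk ha]

end Contractions

/-! ### Identification of `h^{(k)}` and `s^{(k)}` -/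

section Permutations

variable {R : Type*} [CommRing R] (ω : R) {m k : ℕ}

/-- The identification of `0, …, k - 1` with the nodes `1, …, k`. -/
def nodesEquiv (hk : k ≤ m) : Fin k ≃ {x // x ∈ nodes m k} where
  toFun i := ⟨⟨i + 1, by omega⟩, mem_nodes.2 ⟨by simp, i.2⟩⟩
  invFun x := ⟨x.1 - 1, by have := mem_nodes.1 x.2; omega⟩
  left_inv i := by simp
  right_inv x := by
    have := mem_nodes.1 x.2
    exact Subtype.ext (Fin.ext (by simp; omega))

theorem permElt_eq (hk : k ≤ m) (σ : Equiv.Perm (Fin k)) :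
    permElt ω m σ = perm ω m (σ.extendDomain (nodesEquiv hk)) := by
  have h : ∀ l : List ℕ, (∀ i ∈ l, i + 1 < k) → (l.map fun i => s ω m (i + 1)).prod =
      perm ω m (((l.map (adjSwap k)).prod).extendDomain (nodesEquiv hk)) := by
    intro l hl
    induction l with
    | nil => simp
    | cons i l ih =>
      have hi := hl i (by simp)
      rw [List.map_cons, List.prod_cons, List.map_cons, List.prod_cons,
        ← Equiv.Perm.extendDomain_mul, map_mul, ih fun j hj => hl j (by simp [hj]),
        ← perm_swap ω (by omega : i + 1 < 2 * m)]
      congr 2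
      rw [adjSwap, dif_pos hi]
      ext x
      congr 1
      by_cases hx : x ∈ nodes m k
      · obtain ⟨j, hj⟩ := (nodesEquiv hk).surjective ⟨x, hx⟩
        have hxj : x = ((nodesEquiv hk j : {x // x ∈ nodes m k}) : Fin (2 * m + 1)) := by rw [hj]
        have hv : ∀ j : Fin k, ((nodesEquiv hk j : {x // x ∈ nodes m k}) : Fin (2 * m + 1)) =
            node m (j + 1) := fun j => Fin.ext (by rw [val_node (by omega)]; rfl)
        rw [hxj, Equiv.Perm.extendDomain_apply_image, hv, hv]
        rw [Equiv.swap_apply_def, Equiv.swap_apply_def]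
        simp only [node_inj (m := m) (show (j : ℕ) + 1 ≤ 2 * m by omega)
          (show i + 1 ≤ 2 * m by omega), node_inj (m := m) (show (j : ℕ) + 1 ≤ 2 * m by omega)
          (show i + 1 + 1 ≤ 2 * m by omega), Fin.ext_iff, add_left_inj]
        split_ifs <;> rfl
      · rw [Equiv.Perm.extendDomain_apply_not_subtype _ _ hx, Equiv.swap_apply_of_ne_of_ne]
        · rintro rfl
          exact hx ((node_mem_nodes (by omega)).2 (by omega))
        · rintro rfl
          exact hx ((node_mem_nodes (by omega)).2 (by omega))
  have hw := h (word σ) (Classical.choose_spec (exists_word σ)).1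
  rw [permElt, hw]
  exact congrArg (fun τ : Equiv.Perm (Fin k) => perm ω m (τ.extendDomain (nodesEquiv hk)))
    (Classical.choose_spec (exists_word σ)).2

theorem extendDomain_injective (hk : k ≤ m) : Function.Injective fun σ : Equiv.Perm (Fin k) =>
    σ.extendDomain (nodesEquiv hk) :=
  Equiv.Perm.extendDomainHom_injective (nodesEquiv hk)

theorem image_extendDomain (hk : k ≤ m) :
    (Finset.univ.image fun σ : Equiv.Perm (Fin k) => σ.extendDomain (nodesEquiv hk)) =
      permsOn (nodes m k) := by
  refine Finset.eq_of_subset_of_card_le ?_ ?_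
  · intro g hg
    obtain ⟨σ, -, rfl⟩ := Finset.mem_image.1 hg
    exact mem_permsOn.2 fun x hx => Equiv.Perm.extendDomain_apply_not_subtype _ _ hx
  · rw [card_permsOn, card_nodes (by omega), Finset.card_image_of_injective _
      (extendDomain_injective hk), Finset.card_univ, Fintype.card_perm,
      Fintype.card_fin]

theorem exists_permElt_eq (hk : k ≤ m) {g : Equiv.Perm (Fin (2 * m + 1))}
    (hg : g ∈ permsOn (nodes m k)) : ∃ σ : Equiv.Perm (Fin k), permElt ω m σ = perm ω m g := by
  rw [← image_extendDomain hk] at hg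
  obtain ⟨σ, -, rfl⟩ := Finset.mem_image.1 hg
  exact ⟨σ, permElt_eq ω hk σ⟩

theorem sum_permElt (hk : k ≤ m) :
    ∑ σ : Equiv.Perm (Fin k), permElt ω m σ = ∑ g ∈ permsOn (nodes m k), perm ω m g := by
  rw [← image_extendDomain hk, Finset.sum_image (extendDomain_injective hk).injOn]
  exact Finset.sum_congr rfl fun σ _ => permElt_eq ω hk σ

theorem h_eq {𝕜 : Type*} [Field 𝕜] [Algebra ℂ 𝕜] (ω : 𝕜) (hm : 1 ≤ m) (hk : k ≤ m) :
    h ω m k = (bhatRep ω hm).permSym (nodes m k) := by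
  rw [h, sum_permElt ω hk, BrauerRep.permSym, card_nodes (by omega), map_inv₀, map_natCast]
  rfl

end Permutations

section Symmetriser

variable {R : Type*} [CommRing R] (ω : R) (m : ℕ)

/-- The character that is `1` on the `s_a` and `0` on all the other generators. -/
noncomputable def triv : Bhat R ω m →ₐ[R] R :=
  RingQuot.liftAlgHom R ⟨FreeAlgebra.lift R fun g => match g with
    | Gen.s _ => 1
    | _ => 0, by
    set F := FreeAlgebra.lift R fun g : Gen m => match g with
      | Gen.s _ => (1 : R)
      | _ => 0 with hF
    have hs : ∀ a, a < 2 * m → F (sFree R m a) = 1 := fun a ha => by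
      rw [sFree, dif_pos ha, hF, FreeAlgebra.lift_ι_apply]
    have he : ∀ a, F (eFree R m a) = 0 := fun a => by
      rw [eFree]; split_ifs <;> simp [hF]
    have hf : ∀ r a, F (fFree R m r a) = 0 := fun r a => by
      rw [fFree]; split_ifs <;> simp [hF]
    have ht : F (tauFree R m) = 0 := by simp [hF, tauFree]
    have hK : F (KFree R m) = 0 := by simp [hF, KFree]
    clear_value F
    clear hF
    intro x y hxy
    cases hxy
    case f_comm r t a b ha hb hab =>
      rw [map_add, map_sub, map_sub, map_mul, map_mul, map_mul, map_mul, map_smul, map_mul, hf, hf,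
        hf, hK]
      simp
    all_goals simp_all [Nat.lt_of_succ_lt]⟩

variable {m}

theorem triv_s {a : ℕ} (ha : a < 2 * m) : triv ω m (s ω m a) = 1 := by
  rw [triv, s, proj, sFree, dif_pos ha, RingQuot.liftAlgHom_mkAlgHom_apply,
    FreeAlgebra.lift_ι_apply]

theorem triv_e {a : ℕ} (ha : a < 2 * m) : triv ω m (e ω m a) = 0 := by
  rw [triv, e, proj, eFree, dif_pos ha, RingQuot.liftAlgHom_mkAlgHom_apply,
    FreeAlgebra.lift_ι_apply]

variable {k : ℕ}

theorem permElt_mem_brauerSub (σ : Equiv.Perm (Fin k)) : permElt ω m σ ∈ brauerSub ω m k := by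
  refine Subalgebra.list_prod_mem _ fun x hx => ?_
  obtain ⟨i, hi, rfl⟩ := List.mem_map.1 hx
  have := (Classical.choose_spec (exists_word σ)).1 i hi
  exact Algebra.subset_adjoin (Or.inl ⟨i + 1, by omega, by omega, rfl⟩)

theorem triv_permElt (hk : k ≤ m) (σ : Equiv.Perm (Fin k)) : triv ω m (permElt ω m σ) = 1 := by
  rw [permElt, map_list_prod, List.prod_eq_one]
  intro x hx
  rw [List.map_map] at hx
  obtain ⟨i, hi, rfl⟩ := List.mem_map.1 hx
  have := (Classical.choose_spec (exists_word σ)).1 i hi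
  exact triv_s ω (by omega)

theorem perm_mem_brauerSub (hk : k ≤ m) {g : Equiv.Perm (Fin (2 * m + 1))}
    (hg : g ∈ permsOn (nodes m k)) : perm ω m g ∈ brauerSub ω m k := by
  obtain ⟨σ, hσ⟩ := exists_permElt_eq ω hk hg
  exact hσ ▸ permElt_mem_brauerSub ω σ

theorem triv_perm (hk : k ≤ m) {g : Equiv.Perm (Fin (2 * m + 1))}
    (hg : g ∈ permsOn (nodes m k)) : triv ω m (perm ω m g) = 1 := by
  obtain ⟨σ, hσ⟩ := exists_permElt_eq ω hk hg
  exact hσ ▸ triv_permElt ω hk σ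

/-- The conjugating permutation is chosen within the nodes `1, …, k` and starts from `ε_1`, which
keeps `ε_{ab}` in `brauerSub`. -/
theorem epsN_eq_conj (hm : 1 ≤ m) {a b : Fin (2 * m + 1)} (ha : a ∈ nodes m k)
    (hb : b ∈ nodes m k) (hab : a ≠ b) : 2 ≤ k ∧ ∃ g ∈ permsOn (nodes m k),
      epsN ω a b = perm ω m g * e ω m 1 * perm ω m g⁻¹ := by
  have h2 : 2 ≤ k := by
    rw [mem_nodes] at ha hb
    have : (a : ℕ) ≠ b := fun h => hab (Fin.ext h)
    omega
  obtain ⟨g, hg, hl⟩ := exists_permsOn_map_eq (S := nodes m k) (l := [node m 1, node m 2])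
    (l' := [a, b]) (by simp [node_inj (m := m) (show 1 ≤ 2 * m by omega) (show 2 ≤ 2 * m by omega)])
    (by
      simp only [List.mem_cons, List.not_mem_nil, or_false, forall_eq_or_imp, forall_eq]
      exact ⟨(node_mem_nodes (by omega)).2 (by omega), (node_mem_nodes (by omega)).2 (by omega)⟩)
    (by simpa using hab) (by simp [ha, hb]) rfl
  simp only [List.map_cons, List.map_nil, List.cons.injEq, and_true] at hl
  refine ⟨h2, g, hg, ?_⟩
  rw [← epsN_succ ω hm (by omega : 1 < 2 * m), epsN_conj ω hm, hl.1, hl.2, mul_assoc,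
    perm_mul_perm_inv, mul_one]

theorem epsN_mem_brauerSub (hm : 1 ≤ m) (hk : k ≤ m) {a b : Fin (2 * m + 1)}
    (ha : a ∈ nodes m k) (hb : b ∈ nodes m k) : epsN ω a b ∈ brauerSub ω m k := by
  rcases eq_or_ne a b with rfl | hab
  · rw [epsN_self]
    exact zero_mem _
  obtain ⟨h2, g, hg, h⟩ := epsN_eq_conj ω hm ha hb hab
  rw [h]
  exact mul_mem (mul_mem (perm_mem_brauerSub ω hk hg)
    (Algebra.subset_adjoin (Or.inr ⟨1, by omega, by omega, rfl⟩)))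
    (perm_mem_brauerSub ω hk (inv_mem_permsOn hg))

theorem triv_epsN (hm : 1 ≤ m) (hk : k ≤ m) {a b : Fin (2 * m + 1)}
    (ha : a ∈ nodes m k) (hb : b ∈ nodes m k) : triv ω m (epsN ω a b) = 0 := by
  rcases eq_or_ne a b with rfl | hab
  · rw [epsN_self, map_zero]
  obtain ⟨h2, g, hg, h⟩ := epsN_eq_conj ω hm ha hb hab
  rw [h, map_mul, map_mul, triv_e ω (by omega), mul_zero, zero_mul]

section Field

variable {𝕜 : Type*} [Field 𝕜] [CharZero 𝕜] {ω : 𝕜}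

theorem matchSum_mem_brauerSub (hm : 1 ≤ m) (hk : k ≤ m) (j : ℕ) {S : Finset (Fin (2 * m + 1))} (hS : S ⊆ nodes m k) :
    (bhatRep ω hm).matchSum j S ∈ brauerSub ω m k := by
  induction j generalizing S with
  | zero => exact one_mem _
  | succ j ih =>
    refine Subalgebra.smul_mem _ (sum_mem fun a ha => sum_mem fun b hb => mul_mem ?_ (ih ?_)) _
    · exact epsN_mem_brauerSub ω hm hk (hS ha) (hS hb)
    · exact ((Finset.erase_subset _ _).trans (Finset.erase_subset _ _)).trans hS

theorem triv_matchSum_succ (hm : 1 ≤ m) (hk : k ≤ m) (j : ℕ) :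
    triv ω m ((bhatRep ω hm).matchSum (j + 1) (nodes m k)) = 0 := by
  rw [BrauerRep.matchSum, map_smul, map_sum, Finset.sum_eq_zero, smul_zero]
  intro a ha
  rw [map_sum]
  refine Finset.sum_eq_zero fun b hb => ?_
  rw [map_mul]
  exact mul_eq_zero_of_left (triv_epsN ω hm hk ha hb) _

theorem triv_permSym (hm : 1 ≤ m) (hk : k ≤ m) : triv ω m ((bhatRep ω hm).permSym (nodes m k)) = 1 := by
  rw [BrauerRep.permSym, map_smul, map_sum]
  rw [Finset.sum_congr rfl fun g hg => show triv ω m ((bhatRep ω hm).rho g) = 1 from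
    triv_perm ω hk hg, Finset.sum_const, card_permsOn, nsmul_one, smul_eq_mul, inv_mul_cancel₀]
  exact_mod_cast Nat.factorial_ne_zero _

theorem triv_brSym (hm : 1 ≤ m) (hk : k ≤ m) : triv ω m ((bhatRep ω hm).brSym (nodes m k)) = 1 := by
  rw [BrauerRep.brSym, map_sum, Finset.sum_range_succ', Finset.sum_eq_zero]
  · rw [map_smul, map_mul, BrauerRep.matchSum_zero, map_one, triv_permSym hm hk, symCoeff]
    simp
  · intro j _
    rw [map_smul, map_mul, triv_matchSum_succ hm hk, zero_mul, smul_zero]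

theorem isBrauerSymmetriser_brSym (hm : 1 ≤ m) (hk : k ≤ m) (hω : ∀ z : ℤ, ω + z ≠ 0) :
    IsBrauerSymmetriser ω m k ((bhatRep ω hm).brSym (nodes m k)) := by
  refine ⟨?_, ?_, BrauerRep.brSym_mul_brSym hω subset_rfl, ?_⟩
  · refine sum_mem fun j _ => Subalgebra.smul_mem _ (mul_mem
      (matchSum_mem_brauerSub hm hk j subset_rfl) (Subalgebra.smul_mem _ (sum_mem fun g hg => ?_) _)) _
    exact perm_mem_brauerSub ω hk hg
  -- Nonvanishing is seen by the character `triv`, which takes the value `1` on the symmetriser.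
  · intro h0
    have := triv_brSym (ω := ω) hm hk
    rw [h0, map_zero] at this
    exact zero_ne_one this
  · intro a ha1 ha2
    have h1 : node m a ∈ nodes m k := (node_mem_nodes (by omega)).2 (by omega)
    have h2 : node m (a + 1) ∈ nodes m k := (node_mem_nodes (by omega)).2 (by omega)
    rw [← perm_swap ω (by omega), ← epsN_succ ω hm (by omega)]
    exact ⟨BrauerRep.rho_mul_brSym (bhatRep ω hm).toBrauerRep (swap_mem_permsOn h1 h2),
      BrauerRep.brSym_mul_rho (bhatRep ω hm).toBrauerRep (swap_mem_permsOn h1 h2),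
      BrauerRep.eps_mul_brSym (B := (bhatRep ω hm).toBrauerRep) hω h1 h2,
      BrauerRep.brSym_mul_eps (B := (bhatRep ω hm).toBrauerRep) hω h1 h2⟩

theorem IsBrauerSymmetriser.mul_eq (hk : k ≤ m) {x z : Bhat 𝕜 ω m} (hx : IsBrauerSymmetriser ω m k x)
    (hz : z ∈ brauerSub ω m k) : z * x = triv ω m z • x ∧ x * z = triv ω m z • x := by
  induction hz using Algebra.adjoin_induction with
  | mem z hz =>
    rcases hz with ⟨a, h1, h2, rfl⟩ | ⟨a, h1, h2, rfl⟩
    · have := hx.2.2.2 a h1 h2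
      rw [triv_s ω (by omega), one_smul]
      exact ⟨this.1, this.2.1⟩
    · have := hx.2.2.2 a h1 h2
      rw [triv_e ω (by omega), zero_smul]
      exact this.2.2
  | algebraMap r =>
    rw [AlgHom.commutes, Algebra.algebraMap_self, RingHom.id_apply, ← Algebra.commutes,
      Algebra.smul_def]
    exact ⟨rfl, rfl⟩
  | add z w _ _ h1 h2 =>
    rw [add_mul, mul_add, map_add, add_smul, h1.1, h1.2, h2.1, h2.2]
    exact ⟨rfl, rfl⟩
  | mul z w _ _ h1 h2 =>
    rw [mul_assoc, ← mul_assoc x, h2.1, h1.2, mul_smul_comm, smul_mul_assoc, h1.1, h2.2, map_mul,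
      smul_smul, smul_smul, mul_comm (triv ω m w)]
    exact ⟨rfl, rfl⟩

/-- By `mul_eq` the subalgebra acts on a symmetriser through `triv`. A nonzero idempotent then has
`triv` equal to `1`, so `x * y` equals both `x` and `y`. -/
theorem IsBrauerSymmetriser.unique (hk : k ≤ m) {x y : Bhat 𝕜 ω m}
    (hx : IsBrauerSymmetriser ω m k x) (hy : IsBrauerSymmetriser ω m k y) : x = y := by
  have h1 : ∀ {z : Bhat 𝕜 ω m}, IsBrauerSymmetriser ω m k z → triv ω m z = 1 := fun {z} hz => by
    have h := (hz.mul_eq hk hz.1).1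
    rw [hz.2.2.1] at h
    exact eq_one_of_eq_smul hz.2.1 h
  have h2 := (hy.mul_eq hk hx.1).1
  have h3 := (hx.mul_eq hk hy.1).2
  rw [h1 hx, one_smul] at h2
  rw [h1 hy, one_smul] at h3
  exact h3.symm.trans h2

theorem brauerSym_eq (hm : 1 ≤ m) (hk : k ≤ m) (hω : ∀ z : ℤ, ω + z ≠ 0) :
    brauerSym ω m k = (bhatRep ω hm).brSym (nodes m k) :=
  IsBrauerSymmetriser.unique hk
    (Classical.epsilon_spec ⟨_, isBrauerSymmetriser_brSym hm hk hω⟩)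
    (isBrauerSymmetriser_brSym hm hk hω)

end Field

end Symmetriser

/-! ### Reduction of closed words to as many strands as letters -/

/-- The word `f[r_1]_1 ⋯ f[r_n]_n`. -/
noncomputable def fList {R : Type*} [CommRing R] (ω : R) {m : ℕ} (hm : 1 ≤ m) (l : List ℤ) :
    Bhat R ω m := (bhatRep ω hm).fWord (l.zip (nodeList m))

theorem length_sortedParts {m : ℕ} (l : m.Partition) : (sortedParts l).length = len l := by
  rw [sortedParts, Multiset.length_sort, len]

theorem len_le {m : ℕ} (l : m.Partition) : len l ≤ m := by
  have h : l.parts.card • 1 ≤ l.parts.sum := Multiset.card_nsmul_le_sum fun x hx => l.parts_pos hx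
  rw [l.parts_sum] at h
  simpa [len] using h

/-- The indices `-λ_1, …, -λ_ℓ`. -/
def negParts {m : ℕ} (l : m.Partition) : List ℤ := (sortedParts l).map fun p : ℕ => -(p : ℤ)

theorem length_negParts {m : ℕ} (l : m.Partition) : (negParts l).length = len l := by
  rw [negParts, List.length_map, length_sortedParts]

theorem fPart_eq {R : Type*} [CommRing R] (ω : R) {m : ℕ} (hm : 1 ≤ m) (l : m.Partition) :
    fPart ω m l = fList ω hm (negParts l) := by
  rw [fPart, fList, CurrentRep.fWord, bind_pure_comp, List.map_eq_map]
  congr 1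
  have hl := length_sortedParts l
  have hl' := len_le l
  refine List.ext_getElem (by simp [length_nodeList, negParts, hl, hl']) fun i h1 h2 => ?_
  have hi : i < len l := by rw [← hl]; simpa using h1
  rw [List.getElem_mapIdx, fr_eq ω _ (by omega)]
  simp [nodeList, negParts, bhatRep, add_comm]

section Field

variable {𝕜 : Type*} [Field 𝕜] [CharZero 𝕜] {ω : 𝕜} {m : ℕ}

theorem zip_nodeList_mem {R : List ℤ} (hR : R.length ≤ m) :
    ∀ x ∈ (R.zip (nodeList m)).map Prod.snd, x ∈ nodes m R.length := fun x hx => by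
  rw [← toFinset_map_snd_zip_nodeList hR]
  exact List.mem_toFinset.2 hx

theorem length_zip_nodeList {R : List ℤ} (hR : R.length ≤ m) :
    (R.zip (nodeList m)).length = R.length := by
  rw [List.length_zip, length_nodeList, min_eq_left hR]

theorem nodup_zip_nodeList (R : List ℤ) : ((R.zip (nodeList m)).map Prod.snd).Nodup :=
  nodup_nodeList.sublist (map_snd_zip_sublist _ _)

theorem smul_q_mul_brSym_mul_fList (hω : ∀ z : ℤ, ω + z ≠ 0) (hm : 1 ≤ m) {R : List ℤ}
    (hR : R.length ≤ m) :
    (ω + R.length - 2) • (q ω m R.length * (bhatRep ω hm).brSym (nodes m R.length) *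
        fList ω hm R * q ω m m) =
      (ω + 2 * R.length - 2) • (q ω m R.length * (bhatRep ω hm).permSym (nodes m R.length) *
        fList ω hm R * q ω m m) := by
  have h := CurrentRep.smul_mul_brSym_mul_fWord (C := bhatRep ω hm) (M := nodes m m)
    (π := partner m) hω partner_notMem (w := R.zip (nodeList m)) (nodup_zip_nodeList R)
    (fun x hx => nodes_mono hR (zip_nodeList_mem hR x hx)) (Q := q ω m R.length) (Y := q ω m m)
    (fun a ha => q_mul_epsN ω hm hR (zip_nodeList_mem hR a ha))
    (fun a ha => epsN_mul_q ω hm le_rfl (nodes_mono hR (zip_nodeList_mem hR a ha)))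
  rw [toFinset_map_snd_zip_nodeList hR, length_zip_nodeList hR] at h
  simp only [mul_assoc] at h ⊢
  exact h

theorem q_mul_permSym_mul_fList_eq_zero (hω : ω ≠ 0) (hm : 1 ≤ m) {R : List ℤ}
    (hR : R.length ≤ m) (hodd : Odd R.length) :
    q ω m R.length * (bhatRep ω hm).permSym (nodes m R.length) * fList ω hm R * q ω m m = 0 := by
  have h := CurrentRep.mul_permSym_mul_fWord_eq_zero (C := bhatRep ω hm) (M := nodes m m)
    (π := partner m) hω partner_notMem (w := R.zip (nodeList m)) (nodup_zip_nodeList R)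
    (fun x hx => nodes_mono hR (zip_nodeList_mem hR x hx)) (Q := q ω m R.length) (Y := q ω m m)
    (fun a ha => q_mul_epsN ω hm hR (zip_nodeList_mem hR a ha))
    (fun a ha => epsN_mul_q ω hm le_rfl (nodes_mono hR (zip_nodeList_mem hR a ha)))
    (by rwa [length_zip_nodeList hR])
  rw [toFinset_map_snd_zip_nodeList hR] at h
  simp only [mul_assoc] at h ⊢
  exact h

/-- The strand `k + 1` carries no letter because `R.length ≤ k`, and is removed by the partial
trace. -/
theorem q_mul_brSym_succ (hω : ∀ z : ℤ, ω + z ≠ 0) (hm : 1 ≤ m) {R : List ℤ} {k : ℕ}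
    (hR : R.length ≤ k) (hk : k + 1 ≤ m) :
    q ω m (k + 1) * (bhatRep ω hm).brSym (nodes m (k + 1)) * fList ω hm R * q ω m m =
      ((ω + k - 2) * (ω + 2 * k) / ((k + 1) * (ω + 2 * k - 2))) •
        (q ω m k * (bhatRep ω hm).brSym (nodes m k) * fList ω hm R * q ω m m) := by
  have hv : node m (k + 1) ∈ nodes m m := (node_mem_nodes (by omega)).2 (by omega)
  have h := CurrentRep.mul_eps_mul_brSym_insert (C := bhatRep ω hm) hω (S := nodes m k)
    (v := node m (k + 1)) (x := partner m (node m (k + 1)))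
    (fun h => by rw [node_mem_nodes (by omega)] at h; omega)
    (fun h => partner_notMem _ hv (nodes_mono (by omega) h))
    (fun h => partner_notMem _ hv (h ▸ hv)) (w := R.zip (nodeList m))
    (fun y hy => nodes_mono hR (zip_nodeList_mem (by omega) y hy)) (q ω m k) (Y := q ω m m)
    (epsN_mul_q ω hm le_rfl hv)
  rw [card_nodes (by omega), ← nodes_succ (by omega)] at h
  rw [q_succ ω hm hk]
  simp only [mul_assoc] at h ⊢
  exact h

/-- Reduction of a closed word from `m` to `ℓ` strands. -/
theorem smul_q_mul_brSym_eq (hω : ∀ z : ℤ, ω + z ≠ 0) (hm : 1 ≤ m) {R : List ℤ} {k : ℕ}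
    (hR : R.length ≤ k) (hk : k ≤ m) :
    ((ω + k - 2) / (ω + 2 * k - 2)) •
        (q ω m k * (bhatRep ω hm).brSym (nodes m k) * fList ω hm R * q ω m m) =
      ((R.length.factorial / k.factorial : 𝕜) * ∏ i ∈ Finset.Ico R.length k, (ω - 1 + i)) •
        (q ω m R.length * (bhatRep ω hm).permSym (nodes m R.length) * fList ω hm R * q ω m m) := by
  have hd : ∀ k : ℕ, ω + 2 * (k : 𝕜) - 2 ≠ 0 := fun k => by
    have := hω (2 * k - 2)
    push_cast at this
    convert this using 1
    ring
  induction k, hR using Nat.le_induction with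
  | base =>
    have h := congrArg (fun z => (ω + 2 * (R.length : 𝕜) - 2)⁻¹ • z)
      (smul_q_mul_brSym_mul_fList hω hm hk)
    have hf : (R.length.factorial : 𝕜) ≠ 0 := by exact_mod_cast Nat.factorial_ne_zero _
    simp only [smul_smul, inv_mul_cancel₀ (hd R.length)] at h
    rw [Finset.Ico_self, Finset.prod_empty, mul_one, div_self hf, div_eq_inv_mul]
    exact h
  | succ k hRk ih =>
    rw [q_mul_brSym_succ hω hm hRk hk, smul_smul, Finset.prod_Ico_succ_top hRk,
      Nat.factorial_succ]
    -- The partial trace multiplied by `γ_{k+1}` equals `γ_k` times `(ω - 1 + k) / (k + 1)`, one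
    -- more factor of the product.
    have h1 := congrArg (fun z => ((ω - 1 + k) / (k + 1 : 𝕜)) • z) (ih (by omega))
    simp only [smul_smul] at h1
    have hk1 : (k + 1 : 𝕜) ≠ 0 := Nat.cast_add_one_ne_zero k
    have hf : (k.factorial : 𝕜) ≠ 0 := by exact_mod_cast Nat.factorial_ne_zero _
    have hd0 := hd k
    have hd1 : ω + 2 * (k : 𝕜) ≠ 0 := by simpa using hω (2 * k)
    convert h1 using 2
    · push_cast
      have e : ω + 2 * (k + 1 : 𝕜) - 2 = ω + 2 * k := by ring
      rw [e]
      generalize ω + 2 * (k : 𝕜) - 2 = d at hd0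
      rw [mul_comm 2] at hd1 ⊢
      field_simp
      ring
    · push_cast
      field_simp

/-- The nodes are first relabelled to an initial segment of `nodeList m`; then the indices are
permuted, which is possible because they are negative. -/
theorem q_mul_brSym_mul_fWord_eq (hω : ω ≠ 0) (hm : 1 ≤ m) {R : List ℤ}
    {w : List (ℤ × Fin (2 * m + 1))}
    (hw : (w.map Prod.snd).Nodup) (hwM : ∀ x ∈ w.map Prod.snd, x ∈ nodes m m)
    (hneg : ∀ r ∈ R, r < 0) (hR : (w.map Prod.fst).Perm R) :
    q ω m m * (bhatRep ω hm).brSym (nodes m m) * (bhatRep ω hm).fWord w * q ω m m =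
      q ω m m * (bhatRep ω hm).brSym (nodes m m) * fList ω hm R * q ω m m := by
  have hl : (w.map Prod.fst).length ≤ m := by
    have h1 := List.toFinset_card_of_nodup hw
    have h2 : (w.map Prod.snd).toFinset ⊆ nodes m m := fun x hx => hwM x (List.mem_toFinset.1 hx)
    have h3 := Finset.card_le_card h2
    rw [card_nodes (by omega), h1] at h3
    simpa using h3
  have hQ : ∀ a ∈ nodes m m, q ω m m * epsN ω a (partner m a) = ω • q ω m m :=
    fun a ha => q_mul_epsN ω hm le_rfl ha
  have hY : ∀ a ∈ nodes m m, epsN ω a (partner m a) * q ω m m = ω • q ω m m :=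
    fun a ha => epsN_mul_q ω hm le_rfl ha
  rw [CurrentRep.mul_brSym_mul_fWord_eq (C := bhatRep ω hm) (π := partner m) hω partner_notMem hQ hY
    hw hwM (nodup_zip_nodeList (w.map Prod.fst))
    (fun x hx => nodes_mono hl (zip_nodeList_mem hl x hx))
    (by rw [List.map_fst_zip]; rwa [length_nodeList])]
  have := CurrentRep.mul_brSym_mul_fWord_perm (C := bhatRep ω hm) (π := partner m) hω
    partner_notMem hQ hY hR (fun r hr => hneg r (hR.mem_iff.1 hr)) [] (nodeList m)
    (by simpa using nodup_nodeList) (by simp [mem_nodeList]) (by rwa [length_nodeList])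
  simpa [fList] using this

end Field

/-! ### Inserting a point into the cycles of a permutation -/

section CycleInsertion

open Equiv Equiv.Perm

variable {α : Type*} [DecidableEq α] [Fintype α]

theorem parts_partition_eq (σ : Perm α) : σ.partition.parts =
    σ.cycleType + Multiset.replicate (Fintype.card α - σ.cycleType.sum) 1 := by
  rw [parts_partition, sum_cycleType]

theorem parts_partition_permCongr {β : Type*} [DecidableEq β] [Fintype β] (e : α ≃ β)
    (σ : Perm α) : (e.permCongr σ).partition.parts = σ.partition.parts := by
  have h : e.permCongr σ = σ.extendDomain (e.trans (Equiv.Set.univ β).symm) := by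
    ext y
    obtain ⟨x, rfl⟩ := e.surjective y
    have := Perm.extendDomain_apply_image σ (e.trans (Equiv.Set.univ β).symm) x
    simpa using this.symm
  rw [parts_partition_eq, parts_partition_eq, h, cycleType_extendDomain, Fintype.card_congr e]

theorem optionCongr_mul (σ τ : Perm α) :
    optionCongr (σ * τ) = (optionCongr σ * optionCongr τ : Perm (Option α)) :=
  by
  ext1 x
  cases x <;> rfl

theorem cycleType_optionCongr (σ : Perm α) :
    cycleType (optionCongr σ : Perm (Option α)) = σ.cycleType := by
  have h : (optionCongr σ : Perm (Option α)) =
      σ.extendDomain (Equiv.optionIsSomeEquiv α).symm := by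
    ext1 x
    cases x with
    | none => rw [Perm.extendDomain_apply_not_subtype _ _ (by simp)]; rfl
    | some x =>
      have := Perm.extendDomain_apply_image σ (Equiv.optionIsSomeEquiv α).symm x
      exact this.symm
  rw [h, cycleType_extendDomain]

theorem optionCongr_formPerm (l : List α) :
    (optionCongr l.formPerm : Perm (Option α)) = (l.map some).formPerm := by
  induction l with
  | nil => exact optionCongr_one
  | cons x l ih =>
    cases l with
    | nil => exact optionCongr_one
    | cons y l =>
      rw [List.formPerm_cons_cons, optionCongr_mul, optionCongr_swap, ih]
      rfl

/-- The number of elements in the cycle of `x`, fixed points counting as cycles of length `1`. -/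
def cycleLength (σ : Perm α) (x : α) : ℕ := if σ x = x then 1 else (σ.cycleOf x).support.card

/-- Multiplication by the transposition inserts `none` into the cycle through `x`, since `(none x)(x
y ⋯) = (none x y ⋯)`; the other cycles are disjoint from it and stay as they are. -/
theorem cycleType_swap_mul_optionCongr (σ : Perm α) (x : α) (hx : σ x ≠ x) :
    cycleType (swap none (some x) * optionCongr σ : Perm (Option α)) =
      (cycleLength σ x + 1) ::ₘ σ.cycleType.erase (cycleLength σ x) := by
  have hxs : x ∈ σ.support := mem_support.2 hx
  have hc := cycleOf_mem_cycleFactorsFinset_iff.2 hxs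
  have hd := disjoint_mul_inv_of_mem_cycleFactorsFinset hc
  set c := σ.cycleOf x with hcdef
  set ρ := σ * c⁻¹ with hρ
  have hσ : σ = c * ρ := by rw [← hd.commute.eq, hρ, inv_mul_cancel_right]
  obtain ⟨t, ht⟩ : ∃ t, σ.toList x = x :: t := by
    have h0 := Perm.toList_getElem_zero σ x hxs
    cases hl : σ.toList x with
    | nil => exact absurd hxs (Perm.toList_eq_nil_iff.1 hl)
    | cons y t =>
      simp only [hl, List.getElem_cons_zero] at h0
      exact ⟨t, by rw [h0]⟩
  have hnd : (σ.toList x).Nodup := Perm.nodup_toList σ x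
  have hlen : (σ.toList x).length = cycleLength σ x := by
    rw [Perm.length_toList, cycleLength, if_neg hx]
  have h2 : 2 ≤ (σ.toList x).length := Perm.two_le_length_toList_iff_mem_support.2 hxs
  have hform : (swap none (some x) * optionCongr c : Perm (Option α)) =
      (none :: (σ.toList x).map some).formPerm := by
    rw [hcdef, ← Perm.formPerm_toList, optionCongr_formPerm, ht, List.map_cons,
      List.formPerm_cons_cons]
  have hnd' : (none :: (σ.toList x).map some).Nodup := by
    rw [List.nodup_cons]
    exact ⟨by simp, hnd.map (Option.some_injective α)⟩
  have hdis : Perm.Disjoint (none :: (σ.toList x).map some).formPerm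
      (optionCongr ρ : Perm (Option α)) := by
    intro y
    cases y with
    | none => right; rfl
    | some y =>
      by_cases hy : y ∈ σ.toList x
      · right
        have hy' : y ∈ c.support := by
          rw [hcdef, mem_support_cycleOf_iff]
          exact Perm.mem_toList_iff.1 hy
        rcases hd y with h | h
        · simp [h]
        · exact absurd h (mem_support.1 hy')
      · left
        exact List.formPerm_apply_of_notMem (by simpa using hy)
  have hcyc : IsCycle (none :: (σ.toList x).map some).formPerm :=
    List.isCycle_formPerm hnd' (by simp; omega)
  have hσ' : (swap none (some x) * optionCongr σ : Perm (Option α)) =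
      (none :: (σ.toList x).map some).formPerm * optionCongr ρ := by
    conv_lhs => rw [hσ]
    rw [optionCongr_mul, ← mul_assoc, hform]
  rw [hσ', hdis.cycleType_mul, hcyc.cycleType, List.support_formPerm_of_nodup _ hnd'
    (fun z h => by
      have := congrArg List.length h
      simp only [List.length_cons, List.length_map, List.length_nil] at this
      omega), cycleType_optionCongr, hρ, cycleType_mul_inv_mem_cycleFactorsFinset_eq_sub hc,
    (isCycle_cycleOf σ hx).cycleType, List.toFinset_card_of_nodup hnd', List.length_cons,
    List.length_map, hlen, Multiset.sub_singleton, Multiset.singleton_add, cycleLength, if_neg hx]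

/-- A fixed point `x` needs its own argument, as `cycleType` does not record it: there a part `1` is
traded for a new cycle of length `2`. -/
theorem parts_swap_mul_optionCongr (σ : Perm α) (x : α) :
    (swap none (some x) * optionCongr σ : Perm (Option α)).partition.parts =
      (cycleLength σ x + 1) ::ₘ σ.partition.parts.erase (cycleLength σ x) := by
  by_cases hx : σ x = x
  · have hd : Perm.Disjoint (swap none (some x)) (optionCongr σ : Perm (Option α)) := by
      intro y
      cases y with
      | none => right; rfl
      | some y =>
        by_cases hy : y = x
        · right
          simp [hy, hx]
        · left
          exact swap_apply_of_ne_of_ne (by simp) (by simpa using hy)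
    have hlt : σ.cycleType.sum < Fintype.card α := by
      rw [sum_cycleType]
      exact Finset.card_lt_univ_of_notMem (x := x) (by simp [hx])
    rw [parts_partition_eq, parts_partition_eq, hd.cycleType_mul, cycleType_optionCongr,
      isSwap_iff_cycleType.1 ⟨none, some x, by simp, rfl⟩, cycleLength, if_pos hx,
      Fintype.card_option, Multiset.sum_add, Multiset.sum_singleton,
      Multiset.erase_add_right_neg _ (fun h => absurd (one_lt_of_mem_cycleType h) (lt_irrefl 1)),
      show Fintype.card α + 1 - (2 + σ.cycleType.sum) = Fintype.card α - σ.cycleType.sum - 1 by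
        omega]
    obtain ⟨n, hn⟩ : ∃ n, Fintype.card α - σ.cycleType.sum = n + 1 :=
      ⟨Fintype.card α - σ.cycleType.sum - 1, by omega⟩
    rw [hn, Multiset.replicate_succ, Multiset.erase_cons_head, Nat.add_sub_cancel]
    simp [add_assoc]
  · have hmem : cycleLength σ x ∈ σ.cycleType := by
      rw [cycleLength, if_neg hx, cycleType_def]
      exact Multiset.mem_map_of_mem _ (cycleOf_mem_cycleFactorsFinset_iff.2 (mem_support.2 hx))
    have hsum : cycleLength σ x + (σ.cycleType.erase (cycleLength σ x)).sum = σ.cycleType.sum := by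
      rw [← Multiset.sum_cons, Multiset.cons_erase hmem]
    rw [parts_partition_eq, parts_partition_eq, cycleType_swap_mul_optionCongr σ x hx,
      Multiset.erase_add_left_pos _ hmem, Fintype.card_option, Multiset.sum_cons,
      show Fintype.card α + 1 - (cycleLength σ x + 1 + (σ.cycleType.erase (cycleLength σ x)).sum) =
        Fintype.card α - σ.cycleType.sum by omega, Multiset.cons_add]

theorem parts_optionCongr (σ : Perm α) :
    (Perm.partition (optionCongr σ : Perm (Option α))).parts = 1 ::ₘ σ.partition.parts := by
  have h : σ.cycleType.sum ≤ Fintype.card α := sum_cycleType_le σ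
  rw [parts_partition_eq, parts_partition_eq, cycleType_optionCongr, Fintype.card_option,
    Nat.succ_sub h, Multiset.replicate_succ, Multiset.add_cons]

/-- A cycle of length `p` contains `p` points; the fixed points make up the parts equal to `1`. -/
theorem sum_cycleLength {M : Type*} [AddCommMonoid M] (σ : Perm α) (F : ℕ → M) :
    ∑ x, F (cycleLength σ x) = (σ.partition.parts.map fun p => p • F p).sum := by
  have h1 : ∑ x ∈ σ.support, F (cycleLength σ x) =
      (σ.cycleType.map fun p => p • F p).sum := by
    rw [← Finset.sum_fiberwise_of_maps_to (t := σ.cycleFactorsFinset) (g := σ.cycleOf)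
      fun x hx => cycleOf_mem_cycleFactorsFinset_iff.2 hx, cycleType_def, Multiset.map_map]
    refine Finset.sum_congr rfl fun c hc => ?_
    have hf : (σ.support.filter fun x => σ.cycleOf x = c) = c.support := by
      ext x
      rw [Finset.mem_filter]
      constructor
      · rintro ⟨hx, rfl⟩
        exact mem_support_cycleOf_iff.2 ⟨SameCycle.refl _ _, hx⟩
      · intro hx
        exact ⟨mem_cycleFactorsFinset_support_le hc hx, (cycle_is_cycleOf hx hc).symm⟩
    rw [hf]
    simp only [Function.comp_apply]
    rw [← Finset.sum_const]
    refine Finset.sum_congr rfl fun x hx => ?_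
    have hx' := mem_support.1 (mem_cycleFactorsFinset_support_le hc hx)
    rw [cycleLength, if_neg hx', ← cycle_is_cycleOf hx hc]
  have h2 : ∑ x ∈ σ.supportᶜ, F (cycleLength σ x) =
      (Fintype.card α - σ.support.card) • F 1 := by
    rw [← Finset.card_compl, ← Finset.sum_const]
    refine Finset.sum_congr rfl fun x hx => ?_
    rw [cycleLength, if_pos (notMem_support.1 (Finset.mem_compl.1 hx))]
  rw [← Finset.sum_add_sum_compl σ.support, h1, h2, parts_partition, Multiset.map_add,
    Multiset.sum_add, Multiset.map_replicate, Multiset.sum_replicate, one_smul]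

/-- A permutation of `Option α` is a permutation of `α` with `none` either kept fixed or inserted
into the cycle of some `x`. -/
theorem sum_parts_option {M : Type*} [AddCommMonoid M] (F : Multiset ℕ → M) :
    ∑ σ : Perm (Option α), F σ.partition.parts = ∑ σ : Perm α, (F (1 ::ₘ σ.partition.parts) +
      (σ.partition.parts.map fun p => p • F ((p + 1) ::ₘ σ.partition.parts.erase p)).sum) := by
  rw [← Equiv.sum_comp decomposeOption.symm, Fintype.sum_prod_type_right]
  refine Finset.sum_congr rfl fun σ _ => ?_
  rw [Fintype.sum_option, ← sum_cycleLength σ fun p => F ((p + 1) ::ₘ σ.partition.parts.erase p)]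
  congr 1
  · rw [decomposeOption_symm_apply, swap_self]
    exact congrArg F (parts_optionCongr σ)
  · refine Finset.sum_congr rfl fun x _ => ?_
    rw [decomposeOption_symm_apply]
    exact congrArg F (parts_swap_mul_optionCongr σ x)

theorem sum_parts_fin_succ {M : Type*} [AddCommMonoid M] (F : Multiset ℕ → M) (n : ℕ) :
    ∑ σ : Perm (Fin (n + 1)), F σ.partition.parts = ∑ σ : Perm (Fin n),
      (F (1 ::ₘ σ.partition.parts) +
        (σ.partition.parts.map fun p => p • F ((p + 1) ::ₘ σ.partition.parts.erase p)).sum) := by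
  rw [← sum_parts_option, ← Equiv.sum_comp (finSuccEquiv n).permCongr]
  exact Finset.sum_congr rfl fun σ _ => by rw [parts_partition_permCongr]

theorem sum_parts_eq_sum_partition {M : Type*} [AddCommMonoid M] (F : Multiset ℕ → M) (n : ℕ) :
    ∑ σ : Perm (Fin n), F σ.partition.parts = ∑ l : n.Partition, cycleCount l • F l.parts := by
  rw [← Finset.sum_fiberwise_of_maps_to (t := Finset.univ) (g := fun σ : Perm (Fin n) =>
    (⟨σ.partition.parts, σ.partition.parts_pos,
      by rw [σ.partition.parts_sum, Fintype.card_fin]⟩ : n.Partition)) fun _ _ => Finset.mem_univ _]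
  refine Finset.sum_congr rfl fun l _ => ?_
  simp only [Nat.Partition.ext_iff]
  rw [Finset.sum_congr rfl fun σ hσ => by rw [(Finset.mem_filter.1 hσ).2], Finset.sum_const,
    cycleCount, Nat.card_eq_fintype_card, Fintype.card_subtype]

end CycleInsertion

/-! ### The combinatorics of moving `τ` to the right -/

section Expansion

variable {N : Type*}

/-- The sizes of a word. -/
def sizes (w : List (ℕ × N)) : Multiset ℕ := (w.map Prod.fst : List ℕ)

/-- All words that arise from `w` by raising a size by one, with the size as multiplicity. -/
def bumps : List (ℕ × N) → Multiset (List (ℕ × N))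
  | [] => 0
  | x :: w => Multiset.replicate x.1 ((x.1 + 1, x.2) :: w) + (bumps w).map (x :: ·)

/-- The words in the expansion of a product of `f_a = τ + f[-1]_a`. -/
def expand : List N → Multiset (List (ℕ × N))
  | [] => {[]}
  | a :: L => (expand L).bind fun w => ((1, a) :: w) ::ₘ bumps w

theorem bumps_spec {w v : List (ℕ × N)} (hv : v ∈ bumps w) (hw : ∀ p ∈ sizes w, 1 ≤ p) :
    v.map Prod.snd = w.map Prod.snd ∧ ∀ p ∈ sizes v, 1 ≤ p := by
  induction w generalizing v with
  | nil => simp [bumps] at hv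
  | cons x w ih =>
    have hw' : ∀ p ∈ sizes w, 1 ≤ p := fun p hp => hw p (by
      simp only [sizes, List.map_cons, Multiset.mem_coe, List.mem_cons] at hp ⊢
      exact Or.inr hp)
    have hx : 1 ≤ x.1 := hw _ (by simp [sizes])
    rw [bumps, Multiset.mem_add] at hv
    rcases hv with hv | hv
    · rw [Multiset.eq_of_mem_replicate hv]
      refine ⟨rfl, fun p hp => ?_⟩
      simp only [sizes, List.map_cons, Multiset.mem_coe, List.mem_cons] at hp
      rcases hp with rfl | hp
      · omega
      · exact hw' p hp
    · obtain ⟨u, hu, rfl⟩ := Multiset.mem_map.1 hv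
      obtain ⟨h1, h2⟩ := ih hu hw'
      refine ⟨by simp [h1], fun p hp => ?_⟩
      simp only [sizes, List.map_cons, Multiset.mem_coe, List.mem_cons] at hp
      rcases hp with rfl | hp
      · exact hx
      · exact h2 p hp

theorem expand_spec {L : List N} {w : List (ℕ × N)} (hw : w ∈ expand L) :
    (w.map Prod.snd).Sublist L ∧ ∀ p ∈ sizes w, 1 ≤ p := by
  induction L generalizing w with
  | nil =>
    rw [expand, Multiset.mem_singleton] at hw
    simp [hw, sizes]
  | cons a L ih =>
    rw [expand, Multiset.mem_bind] at hw
    obtain ⟨u, hu, hw⟩ := hw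
    obtain ⟨h1, h2⟩ := ih hu
    rw [Multiset.mem_cons] at hw
    rcases hw with rfl | hw
    · refine ⟨h1.cons_cons a, fun p hp => ?_⟩
      simp only [sizes, List.map_cons, Multiset.mem_coe, List.mem_cons] at hp
      rcases hp with rfl | hp
      · exact le_rfl
      · exact h2 p hp
    · obtain ⟨h3, h4⟩ := bumps_spec hw h2
      exact ⟨h3 ▸ h1.cons a, h4⟩

theorem sum_bumps {M : Type*} [AddCommMonoid M] (w : List (ℕ × N)) (F : Multiset ℕ → M) :
    ((bumps w).map fun v => F (sizes v)).sum =
      ((sizes w).map fun p => p • F ((p + 1) ::ₘ (sizes w).erase p)).sum := by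
  induction w generalizing F with
  | nil => simp [bumps, sizes]
  | cons x w ih =>
    have hc : ∀ (y : ℕ × N) (v : List (ℕ × N)), sizes (y :: v) = y.1 ::ₘ sizes v := fun _ _ => rfl
    rw [bumps, Multiset.map_add, Multiset.sum_add, Multiset.map_replicate,
      Multiset.sum_replicate, Multiset.map_map, hc, hc x w, Multiset.map_cons, Multiset.sum_cons,
      Multiset.erase_cons_head]
    congr 1
    have := ih fun s => F (x.1 ::ₘ s)
    simp only [Function.comp_def, hc]
    rw [this]
    congr 1
    refine Multiset.map_congr rfl fun p hp => ?_
    rw [Multiset.cons_swap]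
    congr 3
    by_cases h : p = x.1
    · rw [h, Multiset.erase_cons_head, Multiset.cons_erase (h ▸ hp)]
    · rw [Multiset.erase_cons_tail _ (fun h' => h h'.symm)]

/-- Both sides obey the same recursion: a new factor adds a part `1` or raises a part `p` with
multiplicity `p`, as the insertion of a point does for cycles. -/
theorem sum_expand {M : Type*} [AddCommMonoid M] (L : List N) (F : Multiset ℕ → M) :
    ((expand L).map fun w => F (sizes w)).sum =
      ∑ σ : Equiv.Perm (Fin L.length), F σ.partition.parts := by
  induction L generalizing F with
  | nil =>
    rw [expand, Multiset.map_singleton, Multiset.sum_singleton, List.length_nil]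
    simp [sizes, parts_partition_eq]
  | cons a L ih =>
    rw [expand, Multiset.map_bind, Multiset.sum_bind, List.length_cons, sum_parts_fin_succ,
      ← ih fun s => F (1 ::ₘ s) + (s.map fun p => p • F ((p + 1) ::ₘ s.erase p)).sum]
    congr 1
    refine Multiset.map_congr rfl fun w _ => ?_
    rw [Multiset.map_cons, Multiset.sum_cons, sum_bumps]
    rfl

end Expansion

theorem neg_intCast_neg_smul {R V : Type*} [CommRing R] [AddCommGroup V] [Module R V] (p : ℕ)
    (x : V) : -(((-(p : ℤ) : ℤ) : R) • x) = p • x := by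
  rw [← neg_smul, ← Nat.cast_smul_eq_nsmul R]
  simp

/-! ### Commutation with `τ` and the expansion of `f_1 ⋯ f_m` -/

section Tau

variable {R : Type*} [CommRing R] (ω : R) {m : ℕ}

theorem tau_commute_s (a : ℕ) : Commute (tau ω m) (s ω m a) := by
  by_cases ha : a < 2 * m
  · simpa [Commute, SemiconjBy, tau, s] using proj_eq_of_rel ω m (Rel.tau_s a ha)
  · rw [s, sFree, dif_neg ha, map_zero]
    exact Commute.zero_right _

theorem tau_commute_e (a : ℕ) : Commute (tau ω m) (e ω m a) := by
  by_cases ha : a < 2 * m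
  · simpa [Commute, SemiconjBy, tau, e] using proj_eq_of_rel ω m (Rel.tau_e a ha)
  · rw [e, eFree, dif_neg ha, map_zero]
    exact Commute.zero_right _

theorem ee_eq_conjWord (a b : ℕ) :
    ee ω m a b = conjWord (s ω m) (e ω m) (min a b) (max a b) := by
  rw [ee, eeFree, map_conjWord]
  rfl

theorem tau_commute_ee (a b : ℕ) : Commute (tau ω m) (ee ω m a b) := by
  rw [ee_eq_conjWord, conjWord]
  refine ((Commute.list_prod_right _ _ ?_).mul_right (tau_commute_e ω _)).mul_right
    (Commute.list_prod_right _ _ ?_)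
  all_goals
    intro x hx
    obtain ⟨i, -, rfl⟩ := List.mem_map.1 hx
    exact tau_commute_s ω i

theorem tau_commute_q (k : ℕ) : Commute (tau ω m) (q ω m k) := by
  refine Commute.list_prod_right _ _ fun x hx => ?_
  obtain ⟨i, -, rfl⟩ := List.mem_map.1 hx
  exact tau_commute_ee ω _ _

theorem tau_mul_fr (r : ℤ) {a : ℕ} (ha : a ≤ m) :
    tau ω m * fr ω m r a = fr ω m r a * tau ω m - (r : R) • fr ω m (r - 1) a := by
  have h := proj_eq_of_rel ω m (Rel.f_tau r a ha)
  rw [map_sub, map_mul, map_mul, map_smul] at h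
  change fr ω m r a * tau ω m - tau ω m * fr ω m r a = (r : R) • fr ω m (r - 1) a at h
  rw [← h]
  abel

/-- At `r = -p` the relation `f[r] τ - τ f[r] = r f[r-1]` makes the multiplicity positive. -/
theorem tau_mul_fN (p : ℕ) {x : Fin (2 * m + 1)} (hx : x ∈ nodes m m) :
    tau ω m * fN ω (-(p : ℤ)) x =
      fN ω (-(p : ℤ)) x * tau ω m + p • fN ω (-((p + 1 : ℕ) : ℤ)) x := by
  have hx' := (mem_nodes.1 hx).2
  rw [← node_val x, ← fr_eq ω _ hx', ← fr_eq ω _ hx', tau_mul_fr ω _ hx', sub_eq_add_neg,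
    show -(p : ℤ) - 1 = -((p + 1 : ℕ) : ℤ) by push_cast; ring]
  exact congrArg _ (neg_intCast_neg_smul (R := R) (V := Bhat R ω m) p _)

/-- The word `f[-p_1]_{a_1} ⋯ f[-p_n]_{a_n}`. -/
noncomputable def negWord (w : List (ℕ × Fin (2 * m + 1))) : Bhat R ω m :=
  (w.map fun x => fN ω (-(x.1 : ℤ)) x.2).prod

theorem negWord_cons (x : ℕ × Fin (2 * m + 1)) (w : List (ℕ × Fin (2 * m + 1))) :
    negWord ω (x :: w) = fN ω (-(x.1 : ℤ)) x.2 * negWord ω w := rfl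

theorem tau_mul_negWord {w : List (ℕ × Fin (2 * m + 1))}
    (hw : ∀ x ∈ w.map Prod.snd, x ∈ nodes m m) :
    tau ω m * negWord ω w = negWord ω w * tau ω m + ((bumps w).map (negWord ω)).sum := by
  induction w with
  | nil => simp [negWord, bumps]
  | cons x w ih =>
    simp only [List.map_cons, List.mem_cons, forall_eq_or_imp] at hw
    have h : ((bumps w).map (negWord ω ∘ fun v => x :: v)).sum =
        fN ω (-(x.1 : ℤ)) x.2 * ((bumps w).map (negWord ω)).sum := by
      rw [← Multiset.sum_map_mul_left]
      rfl
    rw [negWord_cons, ← mul_assoc, tau_mul_fN ω x.1 hw.1, add_mul, mul_assoc, ih hw.2, bumps,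
      Multiset.map_add, Multiset.sum_add, Multiset.map_replicate, Multiset.sum_replicate,
      Multiset.map_map, h, negWord_cons, smul_mul_assoc, mul_add, mul_assoc]
    abel

/-- Everything that ends in `τ` is collected in `y * tau ω m`, since it does not affect the constant
term. -/
theorem prod_eq_sum_expand {L : List (Fin (2 * m + 1))} (hL : ∀ x ∈ L, x ∈ nodes m m) :
    ∃ y, (L.map fun x => tau ω m + fN ω (-1) x).prod =
      ((expand L).map (negWord ω)).sum + y * tau ω m := by
  induction L with
  | nil => exact ⟨0, by simp [expand, negWord]⟩
  | cons a L ih =>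
    simp only [List.mem_cons, forall_eq_or_imp] at hL
    obtain ⟨y, hy⟩ := ih hL.2
    refine ⟨((expand L).map (negWord ω)).sum + (tau ω m + fN ω (-1) a) * y, ?_⟩
    have h : ((expand (a :: L)).map (negWord ω)).sum + ((expand L).map (negWord ω)).sum * tau ω m =
        (tau ω m + fN ω (-1) a) * ((expand L).map (negWord ω)).sum := by
      rw [expand, Multiset.map_bind, Multiset.sum_bind, ← Multiset.sum_map_mul_left,
        ← Multiset.sum_map_mul_right, ← Multiset.sum_map_add]
      congr 1
      refine Multiset.map_congr rfl fun w hw => ?_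
      rw [Multiset.map_cons, Multiset.sum_cons, add_mul, tau_mul_negWord ω fun x hx =>
        hL.2 x ((expand_spec hw).1.subset hx), negWord_cons]
      simp only [Nat.cast_one]
      abel
    rw [List.map_cons, List.prod_cons, hy, mul_add, ← h, add_mul (Multiset.sum _),
      mul_assoc _ y, add_assoc]

end Tau

/-! ### Existence and uniqueness of the constant term -/

section ConstantTerm

open Polynomial

variable {R : Type*} [CommRing R] (ω : R) {m : ℕ}

/-- The shift `τ ↦ τ + X` on generators. -/
noncomputable def shiftFree : FreeAlgebra R (Gen m) →ₐ[R] (Bhat R ω m)[X] :=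
  FreeAlgebra.lift R fun g => C (proj ω m (FreeAlgebra.ι R g)) + match g with
    | Gen.tau => X
    | _ => 0

theorem shiftFree_sFree (a : ℕ) : shiftFree ω (sFree R m a) = C (proj ω m (sFree R m a)) := by
  rw [sFree]
  split_ifs <;> simp [shiftFree]

theorem shiftFree_eFree (a : ℕ) : shiftFree ω (eFree R m a) = C (proj ω m (eFree R m a)) := by
  rw [eFree]
  split_ifs <;> simp [shiftFree]

theorem shiftFree_fFree (r : ℤ) (a : ℕ) :
    shiftFree ω (fFree R m r a) = C (proj ω m (fFree R m r a)) := by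
  rw [fFree]
  split_ifs <;> simp [shiftFree]

theorem shiftFree_KFree : shiftFree ω (KFree R m) = C (proj ω m (KFree R m)) := by
  simp [shiftFree, KFree]

theorem shiftFree_tauFree : shiftFree ω (tauFree R m) = C (proj ω m (tauFree R m)) + X := by
  simp [shiftFree, tauFree]

theorem shiftFree_conjWord {S T : ℕ → FreeAlgebra R (Gen m)}
    (hS : ∀ a, shiftFree ω (S a) = C (proj ω m (S a)))
    (hT : ∀ a, shiftFree ω (T a) = C (proj ω m (T a))) (a b : ℕ) :
    shiftFree ω (conjWord S T a b) = C (proj ω m (conjWord S T a b)) := by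
  have h : ∀ x : Bhat R ω m, C x = (C : Bhat R ω m →+* (Bhat R ω m)[X]) x := fun _ => rfl
  rw [map_conjWord (shiftFree ω), map_conjWord (proj ω m), map_conjWord C]
  congr 1
  · funext a
    exact hS a
  · funext a
    exact hT a

theorem C_smul_eq (r : R) (x : Bhat R ω m) : C (r • x) = r • (C x : (Bhat R ω m)[X]) :=
  (smul_C r x).symm

theorem shiftFree_rel {x y : FreeAlgebra R (Gen m)} (hxy : Rel m ω x y) :
    shiftFree ω x = shiftFree ω y := by
  have hss : ∀ a b, shiftFree ω (ssFree R m a b) = C (proj ω m (ssFree R m a b)) := fun a b =>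
    shiftFree_conjWord ω (shiftFree_sFree ω) (shiftFree_sFree ω) _ _
  have hee : ∀ a b, shiftFree ω (eeFree R m a b) = C (proj ω m (eeFree R m a b)) := fun a b =>
    shiftFree_conjWord ω (shiftFree_sFree ω) (shiftFree_eFree ω) _ _
  have key := congrArg (C : Bhat R ω m →+* (Bhat R ω m)[X]) (proj_eq_of_rel ω m hxy)
  cases hxy
  case K_central g =>
    simp only [map_mul] at key ⊢
    have hg : shiftFree ω (FreeAlgebra.ι R g) = C (proj ω m (FreeAlgebra.ι R g)) ∨
        shiftFree ω (FreeAlgebra.ι R g) = C (proj ω m (FreeAlgebra.ι R g)) + X := by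
      cases g <;> simp [shiftFree]
    rw [shiftFree_KFree]
    rcases hg with hg | hg
    · rw [hg, key]
    · rw [hg, mul_add, add_mul, key, X_mul_C]
  case tau_s a ha =>
    simp only [map_mul] at key ⊢
    rw [shiftFree_tauFree, shiftFree_sFree, add_mul, mul_add, key, X_mul_C]
  case tau_e a ha =>
    simp only [map_mul] at key ⊢
    rw [shiftFree_tauFree, shiftFree_eFree, add_mul, mul_add, key, X_mul_C]
  case f_tau r a ha =>
    simp only [map_mul, map_sub, map_smul, C_smul_eq] at key ⊢
    rw [shiftFree_tauFree, shiftFree_fFree, shiftFree_fFree, add_mul, mul_add, X_mul_C]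
    exact (add_sub_add_right_eq_sub _ _ _).trans key
  all_goals
    simpa only [map_mul, map_add, map_sub, map_smul, map_one, map_zero, shiftFree_sFree,
      shiftFree_eFree, shiftFree_fFree, shiftFree_KFree, hss, hee, C_smul_eq] using key

/-- The homomorphism that maps `τ` to `τ + X` and fixes the other generators. -/
noncomputable def shift : Bhat R ω m →ₐ[R] (Bhat R ω m)[X] :=
  RingQuot.liftAlgHom R ⟨shiftFree ω, fun _ _ h => shiftFree_rel ω h⟩

theorem shift_proj (x : FreeAlgebra R (Gen m)) : shift ω (proj ω m x) = shiftFree ω x :=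
  RingQuot.liftAlgHom_mkAlgHom_apply ..

theorem shift_of_mem_coeffSub {c : Bhat R ω m} (hc : c ∈ coeffSub ω m) : shift ω c = C c := by
  induction hc using Algebra.adjoin_induction with
  | mem c hc =>
    rcases hc with ((⟨a, -, rfl⟩ | ⟨a, -, rfl⟩) | ⟨r, a, -, rfl⟩) | hc
    · rw [s, shift_proj, shiftFree_sFree]
    · rw [e, shift_proj, shiftFree_eFree]
    · rw [fr, shift_proj, shiftFree_fFree]
    · rw [Set.mem_singleton_iff.1 hc, K, shift_proj, shiftFree_KFree]
  | algebraMap r =>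
    rw [AlgHom.commutes, Polynomial.algebraMap_apply]
  | add x y _ _ hx hy => rw [map_add, hx, hy, map_add]
  | mul x y _ _ hx hy => rw [map_mul, hx, hy, map_mul]

/-- Evaluation at `-t` is not multiplicative over a noncommutative ring. Left multiplication by `C t
+ X` acts on values as the commutator with `t`, which vanishes on `1` and hence on all powers. -/
theorem eval_add_X_pow {S : Type*} [Ring S] (t : S) (k : ℕ) :
    ((C t + X) ^ (k + 1)).eval (-t) = 0 := by
  have h : ∀ p : S[X], ((C t + X) * p).eval (-t) = t * p.eval (-t) - p.eval (-t) * t := by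
    intro p
    rw [add_mul, eval_add, eval_C_mul, X_mul, eval_mul_X, mul_neg, sub_eq_add_neg]
  induction k with
  | zero =>
    simpa using h 1
  | succ k ih => rw [pow_succ', h, ih, mul_zero, zero_mul, sub_zero]

/-- The shift sends `c τ^k` to `c (τ + X)^k`, and evaluation at `X = -τ` annihilates this for `k ≥
1`. The right-hand side depends on `x` alone, which gives uniqueness. -/
theorem IsConstantTerm.eq_eval {x y : Bhat R ω m} (h : IsConstantTerm ω m x y) :
    y = (shift ω x).eval (-tau ω m) := by
  obtain ⟨n, c, hc, rfl, rfl⟩ := h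
  have hτ : shift ω (tau ω m) = C (tau ω m) + X := by rw [tau, shift_proj, shiftFree_tauFree]
  rw [map_sum, eval_finsetSum, Finset.sum_range_succ', Finset.sum_eq_zero, zero_add, map_mul,
    shift_of_mem_coeffSub ω (hc 0), eval_C_mul]
  · simp
  · intro k _
    rw [map_mul, map_pow, shift_of_mem_coeffSub ω (hc _), eval_C_mul, hτ, eval_add_X_pow, mul_zero]

theorem IsConstantTerm.unique {x y z : Bhat R ω m} (hy : IsConstantTerm ω m x y)
    (hz : IsConstantTerm ω m x z) : y = z :=
  (hy.eq_eval ω).trans (hz.eq_eval ω).symm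

theorem s_mem_coeffSub (a : ℕ) : s ω m a ∈ coeffSub ω m := by
  by_cases ha : a < 2 * m
  · exact Algebra.subset_adjoin (Or.inl (Or.inl (Or.inl ⟨a, ha, rfl⟩)))
  · rw [s, sFree, dif_neg ha, map_zero]
    exact zero_mem _

theorem e_mem_coeffSub (a : ℕ) : e ω m a ∈ coeffSub ω m := by
  by_cases ha : a < 2 * m
  · exact Algebra.subset_adjoin (Or.inl (Or.inl (Or.inr ⟨a, ha, rfl⟩)))
  · rw [e, eFree, dif_neg ha, map_zero]
    exact zero_mem _

theorem fr_mem_coeffSub (r : ℤ) (a : ℕ) : fr ω m r a ∈ coeffSub ω m := by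
  by_cases ha : a < m + 1
  · exact Algebra.subset_adjoin (Or.inl (Or.inr ⟨r, a, by omega, rfl⟩))
  · rw [fr, fFree, dif_neg ha, map_zero]
    exact zero_mem _

theorem K_mem_coeffSub : K ω m ∈ coeffSub ω m := Algebra.subset_adjoin (Or.inr rfl)

/-- The commutator with `τ` is a derivation that maps each generator of the subalgebra back into it.
-/
theorem tau_mul_sub_mem {c : Bhat R ω m} (hc : c ∈ coeffSub ω m) :
    tau ω m * c - c * tau ω m ∈ coeffSub ω m := by
  induction hc using Algebra.adjoin_induction with
  | mem c hc =>
    rcases hc with ((⟨a, -, rfl⟩ | ⟨a, -, rfl⟩) | ⟨r, a, ha, rfl⟩) | hc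
    · rw [(tau_commute_s ω a).eq, sub_self]
      exact zero_mem _
    · rw [(tau_commute_e ω a).eq, sub_self]
      exact zero_mem _
    · rw [tau_mul_fr ω r ha, sub_sub_cancel_left]
      exact neg_mem (Subalgebra.smul_mem _ (fr_mem_coeffSub ω _ _) _)
    · have h := proj_eq_of_rel ω m (Rel.K_central Gen.tau)
      rw [map_mul, map_mul] at h
      rw [Set.mem_singleton_iff.1 hc, show tau ω m * K ω m = K ω m * tau ω m from h.symm, sub_self]
      exact zero_mem _
  | algebraMap r =>
    rw [Algebra.commutes, sub_self]
    exact zero_mem _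
  | add x y _ _ hx hy =>
    have := add_mem hx hy
    convert this using 1
    rw [mul_add, add_mul]
    abel
  | mul x y hx' hy' hx hy =>
    have := add_mem (mul_mem hx hy') (mul_mem hx' hy)
    convert this using 1
    rw [sub_mul, mul_sub]
    simp only [mul_assoc]
    abel

/-- Every element is a polynomial in `τ`. -/
theorem exists_eval_eq (x : Bhat R ω m) :
    ∃ P : (Bhat R ω m)[X], (∀ k, P.coeff k ∈ coeffSub ω m) ∧ P.eval (tau ω m) = x := by
  have hC : ∀ g ∈ coeffSub ω m, ∀ P : (Bhat R ω m)[X], (∀ k, P.coeff k ∈ coeffSub ω m) →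
      ∃ P' : (Bhat R ω m)[X], (∀ k, P'.coeff k ∈ coeffSub ω m) ∧
        P'.eval (tau ω m) = g * P.eval (tau ω m) := fun g hg P hP =>
    ⟨C g * P, fun k => by rw [coeff_C_mul]; exact mul_mem hg (hP k), eval_C_mul⟩
  have hτ : ∀ P : (Bhat R ω m)[X], (∀ k, P.coeff k ∈ coeffSub ω m) →
      ∃ P' : (Bhat R ω m)[X], (∀ k, P'.coeff k ∈ coeffSub ω m) ∧
        P'.eval (tau ω m) = tau ω m * P.eval (tau ω m) := by
    intro P hP
    -- This is `τ P(τ) = P(τ) τ + ∑ [τ, c_k] τ^k`, with the commutators again in the coefficient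
    -- subalgebra.
    refine ⟨P * X + ∑ k ∈ Finset.range (P.natDegree + 1),
      C (tau ω m * P.coeff k - P.coeff k * tau ω m) * X ^ k, fun k => ?_, ?_⟩
    · rw [coeff_add, finsetSum_coeff]
      refine add_mem ?_ (sum_mem fun i _ => ?_)
      · cases k with
        | zero => rw [mul_coeff_zero, coeff_X_zero, mul_zero]; exact zero_mem _
        | succ k => rw [coeff_mul_X]; exact hP k
      · rw [coeff_C_mul_X_pow]
        split_ifs
        · exact tau_mul_sub_mem ω (hP i)
        · exact zero_mem _
    · rw [eval_add, eval_mul_X, eval_finsetSum, eval_eq_sum_range, Finset.sum_mul,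
        Finset.mul_sum, ← Finset.sum_add_distrib]
      refine Finset.sum_congr rfl fun k _ => ?_
      rw [C_mul_X_pow_eq_monomial, eval_monomial, sub_mul, mul_assoc, mul_assoc, mul_assoc, ← pow_succ, pow_succ']
      abel
  obtain ⟨z, rfl⟩ := RingQuot.mkAlgHom_surjective R (Rel m ω) x
  -- Strengthened to closure under left multiplication by `z`, so that the induction passes through
  -- products.
  suffices h : ∀ P : (Bhat R ω m)[X], (∀ k, P.coeff k ∈ coeffSub ω m) →
      ∃ P' : (Bhat R ω m)[X], (∀ k, P'.coeff k ∈ coeffSub ω m) ∧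
        P'.eval (tau ω m) = proj ω m z * P.eval (tau ω m) by
    obtain ⟨P', h1, h2⟩ := h 1 fun k => by
      rw [coeff_one]
      split_ifs
      exacts [one_mem _, zero_mem _]
    exact ⟨P', h1, by rw [h2, eval_one, mul_one]; rfl⟩
  induction z using FreeAlgebra.induction with
  | grade0 r =>
    rw [AlgHom.commutes]
    exact hC _ (algebraMap_mem _ r)
  | grade1 g =>
    cases g with
    | s a =>
      have : proj ω m (FreeAlgebra.ι R (Gen.s a)) = s ω m a := by rw [s, sFree, dif_pos a.2]
      rw [this]
      exact hC _ (s_mem_coeffSub ω a)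
    | e a =>
      have : proj ω m (FreeAlgebra.ι R (Gen.e a)) = e ω m a := by rw [e, eFree, dif_pos a.2]
      rw [this]
      exact hC _ (e_mem_coeffSub ω a)
    | f r a =>
      have : proj ω m (FreeAlgebra.ι R (Gen.f r a)) = fr ω m r a := by
        rw [fr, fFree, dif_pos a.2]
      rw [this]
      exact hC _ (fr_mem_coeffSub ω r a)
    | tau => exact hτ
    | K => exact hC _ (K_mem_coeffSub ω)
  | mul x y hx hy =>
    intro P hP
    obtain ⟨P1, h1, h2⟩ := hy P hP
    obtain ⟨P2, h3, h4⟩ := hx P1 h1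
    exact ⟨P2, h3, by rw [h4, h2, map_mul, mul_assoc]⟩
  | add x y hx hy =>
    intro P hP
    obtain ⟨P1, h1, h2⟩ := hx P hP
    obtain ⟨P2, h3, h4⟩ := hy P hP
    exact ⟨P1 + P2, fun k => by rw [coeff_add]; exact add_mem (h1 k) (h3 k),
      by rw [eval_add, h2, h4, map_add, add_mul]⟩

theorem isConstantTerm_add_mul_tau {c : Bhat R ω m} (hc : c ∈ coeffSub ω m) (y : Bhat R ω m) :
    IsConstantTerm ω m (c + y * tau ω m) c := by
  obtain ⟨P, hP, rfl⟩ := exists_eval_eq ω y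
  refine ⟨(C c + P * X).natDegree, (C c + P * X).coeff, fun k => ?_, ?_, ?_⟩
  · rw [coeff_add]
    cases k with
    | zero => simpa using hc
    | succ k =>
      rw [coeff_C_succ, zero_add, coeff_mul_X]
      exact hP k
  · rw [← eval_eq_sum_range, eval_add, eval_C, eval_mul_X]
  · simp

theorem ee_mem_coeffSub (a b : ℕ) : ee ω m a b ∈ coeffSub ω m := by
  rw [ee_eq_conjWord, conjWord]
  refine mul_mem (mul_mem (Subalgebra.list_prod_mem _ ?_) (e_mem_coeffSub ω _))
    (Subalgebra.list_prod_mem _ ?_)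
  all_goals
    intro x hx
    obtain ⟨i, -, rfl⟩ := List.mem_map.1 hx
    exact s_mem_coeffSub ω i

theorem q_mem_coeffSub (k : ℕ) : q ω m k ∈ coeffSub ω m := by
  refine Subalgebra.list_prod_mem _ fun x hx => ?_
  obtain ⟨i, -, rfl⟩ := List.mem_map.1 hx
  exact ee_mem_coeffSub ω _ _

theorem h_mem_coeffSub [Algebra ℂ R] (k : ℕ) : h ω m k ∈ coeffSub ω m := by
  refine Subalgebra.smul_mem _ (sum_mem fun σ _ => Subalgebra.list_prod_mem _ fun x hx => ?_) _
  obtain ⟨i, -, rfl⟩ := List.mem_map.1 hx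
  exact s_mem_coeffSub ω _

theorem fPart_mem_coeffSub (l : m.Partition) : fPart ω m l ∈ coeffSub ω m := by
  refine Subalgebra.list_prod_mem _ fun x hx => ?_
  obtain ⟨i, hi, rfl⟩ := List.mem_mapIdx.1 hx
  exact fr_mem_coeffSub ω _ _

theorem integralForm_mem_coeffSub [Algebra ℂ R] : integralForm ω m ∈ coeffSub ω m :=
  sum_mem fun l _ => Subalgebra.smul_mem _ (mul_mem (mul_mem (mul_mem (q_mem_coeffSub ω _)
    (h_mem_coeffSub ω _)) (fPart_mem_coeffSub ω l)) (q_mem_coeffSub ω _)) _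

end ConstantTerm

/-! ### Assembly of the formula for `φ_m` -/

section Expansion

variable {𝕜 : Type*} [Field 𝕜] [CharZero 𝕜] {ω : 𝕜} {m : ℕ}

theorem negWord_eq (hm : 1 ≤ m) (w : List (ℕ × Fin (2 * m + 1))) :
    negWord ω w = (bhatRep ω hm).fWord (w.map fun x => (-(x.1 : ℤ), x.2)) := by
  rw [negWord, CurrentRep.fWord, List.map_map]
  rfl

theorem prod_f_eq : ((List.range' 1 m).map fun a => f ω m a).prod =
    ((nodeList m).map fun x => tau ω m + fN ω (-1) x).prod := by
  rw [nodeList, List.map_map]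
  congr 1
  refine List.map_congr_left fun a ha => ?_
  rw [List.mem_range'_1] at ha
  rw [f, fr_eq ω _ (by omega)]
  rfl

theorem q_mul_brSym_mul_negWord (hω : ω ≠ 0) (hm : 1 ≤ m) {w : List (ℕ × Fin (2 * m + 1))}
    (hw : w ∈ expand (nodeList m)) :
    q ω m m * (bhatRep ω hm).brSym (nodes m m) * negWord ω w * q ω m m =
      q ω m m * (bhatRep ω hm).brSym (nodes m m) *
        fList ω hm (((sizes w).sort fun a b => b ≤ a).map fun p : ℕ => -(p : ℤ)) * q ω m m := by
  obtain ⟨h1, h2⟩ := expand_spec hw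
  rw [negWord_eq hm]
  have hs : (w.map fun x => (-(x.1 : ℤ), x.2)).map Prod.snd = w.map Prod.snd := by
    rw [List.map_map]
    rfl
  refine q_mul_brSym_mul_fWord_eq hω hm (hs ▸ nodup_nodeList.sublist h1)
    (fun x hx => mem_nodeList.1 (h1.subset (hs ▸ hx))) (fun r hr => ?_) ?_
  · obtain ⟨p, hp, rfl⟩ := List.mem_map.1 hr
    have := h2 p ((Multiset.mem_sort _).1 hp)
    omega
  · have h3 : (w.map fun x => (-(x.1 : ℤ), x.2)).map Prod.fst =
        (w.map Prod.fst).map fun p : ℕ => -(p : ℤ) := by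
      rw [List.map_map, List.map_map]
      rfl
    rw [h3]
    refine List.Perm.map _ (Multiset.coe_eq_coe.1 ?_)
    rw [Multiset.sort_eq]
    rfl

theorem q_mul_brSym_mul_sum_expand (hω : ω ≠ 0) (hm : 1 ≤ m) :
    q ω m m * (bhatRep ω hm).brSym (nodes m m) * ((expand (nodeList m)).map (negWord ω)).sum *
      q ω m m = ∑ l : m.Partition, cycleCount l •
        (q ω m m * (bhatRep ω hm).brSym (nodes m m) * fList ω hm (negParts l) * q ω m m) := by
  set F : Multiset ℕ → Bhat 𝕜 ω m := fun t => q ω m m * (bhatRep ω hm).brSym (nodes m m) *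
        fList ω hm ((t.sort fun a b => b ≤ a).map fun p : ℕ => -(p : ℤ)) * q ω m m with hF
  have h1 := sum_expand (nodeList m) F
  rw [length_nodeList, sum_parts_eq_sum_partition] at h1
  refine Eq.trans ?_ h1
  rw [← Multiset.sum_map_mul_left, ← Multiset.sum_map_mul_right]
  congr 1
  exact Multiset.map_congr rfl fun w hw => q_mul_brSym_mul_negWord hω hm hw

/-- The expansion groups the words by partitions. Each closed word reduces to `len l` strands with
the scalar `𝒴_{m,ℓ}(ω - 1)`, and the odd lengths drop out. -/
theorem exists_eq_integralForm_add [Algebra ℂ 𝕜] (hω : ∀ z : ℤ, ω + z ≠ 0) (hm : 1 ≤ m) :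
    ∃ y, ((ω + m - 2) / (ω + 2 * m - 2)) • (q ω m m * brauerSym ω m m *
      ((List.range' 1 m).map fun a => f ω m a).prod * q ω m m) =
      integralForm ω m + y * tau ω m := by
  have hω0 : ω ≠ 0 := by simpa using hω 0
  obtain ⟨y, hy⟩ := prod_eq_sum_expand ω (L := nodeList m) fun x hx => mem_nodeList.1 hx
  refine ⟨((ω + m - 2) / (ω + 2 * m - 2)) • (q ω m m * brauerSym ω m m * y * q ω m m), ?_⟩
  rw [prod_f_eq, hy, mul_add, add_mul, brauerSym_eq hm le_rfl hω,
    q_mul_brSym_mul_sum_expand hω0 hm, smul_add, smul_mul_assoc]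
  congr 1
  · rw [integralForm, Finset.sum_filter, Finset.smul_sum]
    refine Finset.sum_congr rfl fun l _ => ?_
    have hl : (negParts l).length ≤ m := (length_negParts l).trans_le (len_le l)
    have h1 := smul_q_mul_brSym_eq hω hm hl le_rfl
    have h2 := q_mul_permSym_mul_fList_eq_zero (m := m) hω0 hm hl
    rw [length_negParts, ← h_eq ω hm (len_le l), ← fPart_eq ω hm] at h1 h2
    rw [smul_comm, ← fPart_eq ω hm, h1]
    split_ifs with he
    · have h3 : Polynomial.aeval (ω - 1) (Y m (len l)) =
          ((len l).factorial / m.factorial : 𝕜) * ∏ i ∈ Finset.Ico (len l) m, (ω - 1 + i) := by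
        rw [Y, map_mul, map_prod, Polynomial.aeval_C]
        simp
      rw [h3, ← Nat.cast_smul_eq_nsmul 𝕜, smul_smul, mul_comm]
    · rw [h2 (Nat.not_even_iff_odd.1 he), smul_zero, smul_zero]
  · simp only [mul_assoc]
    -- The closing `q^{(m)}` commutes with `τ`, so the remainder still ends in `τ`.
    rw [(tau_commute_q ω m).eq]

theorem isConstantTerm_iff [Algebra ℂ 𝕜] (hω : ∀ z : ℤ, ω + z ≠ 0) (hm : 1 ≤ m)
    (φ : Bhat 𝕜 ω m) :
    IsConstantTerm ω m (((ω + m - 2) / (ω + 2 * m - 2)) • (q ω m m * brauerSym ω m m *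
      ((List.range' 1 m).map fun a => f ω m a).prod * q ω m m)) φ ↔ φ = integralForm ω m := by
  obtain ⟨y, hy⟩ := exists_eq_integralForm_add hω hm
  have h := isConstantTerm_add_mul_tau ω (integralForm_mem_coeffSub ω) y
  rw [hy]
  exact ⟨fun hφ => hφ.unique ω h, fun hφ => hφ ▸ h⟩

theorem smul_q_mul_brauerSym_mul_fPart [Algebra ℂ 𝕜] (hω : ∀ z : ℤ, ω + z ≠ 0) (hm : 1 ≤ m)
    (l : m.Partition) :
    ((ω + len l - 2) / (ω + 2 * len l - 2)) •
        (q ω m (len l) * brauerSym ω m (len l) * fPart ω m l * q ω m m) =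
      q ω m (len l) * h ω m (len l) * fPart ω m l * q ω m m := by
  have hl : (negParts l).length ≤ m := (length_negParts l).trans_le (len_le l)
  have h1 := smul_q_mul_brSym_eq hω hm le_rfl hl
  have hf : ((len l).factorial : 𝕜) ≠ 0 := by exact_mod_cast Nat.factorial_ne_zero _
  rw [length_negParts, Finset.Ico_self, Finset.prod_empty, mul_one, div_self hf, one_smul,
    ← fPart_eq ω hm, ← h_eq ω hm (len_le l), ← brauerSym_eq hm (len_le l) hω] at h1
  exact h1

end Expansion

/-! ### Extension of scalars from `ℂ[ω]` to `ℂ(ω)` -/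

section BaseChange

variable {R S : Type*} [CommRing R] [CommRing S] [Algebra R S] {ω : R} {ω' : S} {m : ℕ}
  (hω : algebraMap R S ω = ω')

theorem baseChange_proj (x : FreeAlgebra R (Gen m)) :
    baseChange ω ω' m hω (proj ω m x) = proj ω' m (freeBaseChange m x) :=
  RingQuot.liftAlgHom_mkAlgHom_apply ..

theorem baseChange_s (a : ℕ) : baseChange ω ω' m hω (s ω m a) = s ω' m a := by
  rw [s, baseChange_proj, freeBaseChange_sFree, s]

theorem baseChange_q (k : ℕ) : baseChange ω ω' m hω (q ω m k) = q ω' m k := by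
  rw [q, q, map_list_prod, List.map_map]
  congr 2
  funext a
  rw [Function.comp_apply, ee, baseChange_proj, freeBaseChange_eeFree, ee]

theorem baseChange_fPart (l : m.Partition) :
    baseChange ω ω' m hω (fPart ω m l) = fPart ω' m l := by
  rw [fPart, fPart, map_list_prod]
  congr 1
  refine List.ext_getElem (by simp only [List.length_map, List.length_mapIdx]) fun i _ _ => ?_
  rw [List.getElem_map, List.getElem_mapIdx, List.getElem_mapIdx, fr, baseChange_proj, freeBaseChange_fFree, fr]

theorem baseChange_smul (r : R) (x : Bhat R ω m) :
    baseChange ω ω' m hω (r • x) = algebraMap R S r • baseChange ω ω' m hω x := by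
  rw [map_smul, algebraMap_smul]

theorem baseChange_h [Algebra ℂ R] [Algebra ℂ S] [IsScalarTower ℂ R S] (k : ℕ) :
    baseChange ω ω' m hω (h ω m k) = h ω' m k := by
  rw [h, baseChange_smul, ← IsScalarTower.algebraMap_apply, map_sum, h]
  congr 1
  refine Finset.sum_congr rfl fun σ _ => ?_
  rw [permElt, permElt, map_list_prod, List.map_map]
  congr 2
  funext a
  exact baseChange_s hω _

theorem baseChange_integralForm [Algebra ℂ R] [Algebra ℂ S] [IsScalarTower ℂ R S] :
    baseChange ω ω' m hω (integralForm ω m) = integralForm ω' m := by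
  rw [integralForm, integralForm, map_sum]
  refine Finset.sum_congr rfl fun l _ => ?_
  rw [baseChange_smul, map_mul, map_mul, map_mul, map_mul, baseChange_q, baseChange_q,
    baseChange_h, baseChange_fPart, map_natCast, ← Polynomial.aeval_algebraMap_apply, map_sub, hω,
    map_one]

end BaseChange

/-- The one genericity condition on the parameter: every denominator met above has the form `ω + z`
with `z` an integer, up to nonzero rational factors. -/
theorem ratFunc_X_add_intCast_ne_zero (z : ℤ) : (RatFunc.X : RatFunc ℂ) + z ≠ 0 := by
  have h : (RatFunc.X : RatFunc ℂ) + z =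
      algebraMap (Polynomial ℂ) (RatFunc ℂ) (Polynomial.X + Polynomial.C (z : ℂ)) := by
    rw [map_add, RatFunc.algebraMap_X, Polynomial.C_eq_intCast, map_intCast]
  rw [h]
  exact RatFunc.algebraMap_ne_zero (Polynomial.X_add_C_ne_zero _)

end ExtBrauer

theorem proposition4p5 (m : ℕ) (hm : 1 ≤ m) :
    (∀ φ : ExtBrauer.Bhat (RatFunc ℂ) RatFunc.X m,
      ExtBrauer.IsConstantTerm RatFunc.X m
        (ExtBrauer.gam m •
          (ExtBrauer.q RatFunc.X m m * ExtBrauer.brauerSym RatFunc.X m m *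
            ((List.range' 1 m).map fun a => ExtBrauer.f RatFunc.X m a).prod *
            ExtBrauer.q RatFunc.X m m)) φ ↔
      φ = ExtBrauer.integralForm RatFunc.X m) ∧
    ExtBrauer.baseChange (Polynomial.X : Polynomial ℂ) (RatFunc.X : RatFunc ℂ) m
        RatFunc.algebraMap_X (ExtBrauer.integralForm Polynomial.X m) =
      ExtBrauer.integralForm RatFunc.X m ∧
    ∀ l : m.Partition,
      ExtBrauer.gam (ExtBrauer.len l) •
        (ExtBrauer.q (RatFunc.X : RatFunc ℂ) m (ExtBrauer.len l) *
          ExtBrauer.brauerSym RatFunc.X m (ExtBrauer.len l) *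
          ExtBrauer.fPart RatFunc.X m l * ExtBrauer.q RatFunc.X m m) =
      ExtBrauer.q RatFunc.X m (ExtBrauer.len l) * ExtBrauer.h RatFunc.X m (ExtBrauer.len l) *
        ExtBrauer.fPart RatFunc.X m l * ExtBrauer.q RatFunc.X m m := by
  have hchar : CharZero (RatFunc ℂ) := charZero_of_injective_algebraMap (R := ℂ)
    (algebraMap ℂ (RatFunc ℂ)).injective
  exact ⟨ExtBrauer.isConstantTerm_iff ExtBrauer.ratFunc_X_add_intCast_ne_zero hm,
    ExtBrauer.baseChange_integralForm _,
    ExtBrauer.smul_q_mul_brauerSym_mul_fPart ExtBrauer.ratFunc_X_add_intCast_ne_zero hm⟩
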